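/- **Setting.** Let $d\ge 2$, let $\mathcal A\subset\mathbb Z^d$ be finite and $\mathcal L=\mathbb Z^d\setminus\mathcal A$. $|\cdot|$ is the Euclidean norm of vectors of $\mathbb Z^d$, $\mathbb Z^{\mathcal A}$ and $\mathbb R^{\mathcal A}$, and $\mathrm{Leb}$ is (outer) Lebesgue measure on $\mathbb R^{\mathcal A}$. *Blocks.* For an integer $\Delta\ge0$ let $[a]_\Delta$ be the class of $a\in\mathcal L$ for the equivalence relation on $\mathcal L$ generated by: $a\sim b$ iff $|a|^2=|b|^2$ and $|a-b|\le\Delta$. Let $d_\Delta$ be the supremum of the diameters of all blocks $[a]_\Delta$, and $\mathrm{dist}(X,Y)=\inf_{x\in X,y\in Y}|x-y|$. A matrix $Q:\mathcal L\times\mathcal L\to\mathbb C$ is on *normal form* $\mathcal{NF}_\Delta$ if it is Hermitian and $Q_a^b=0$ whenever $[a]_\Delta\ne[b]_\Delta$. For $I\subset\mathcal L$, $Q_I=Q|_{I\times I}$, and $\sigma$ denotes the spectrum. *Töplitz matrices.* The Töplitz limits of $Q$ are $Q(\pm,c)_a^b=\lim_{t\to+\infty}Q_{a+tc}^{b\pm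 tc}$, $c\in\mathbb Z^d$ ($Q(\pm,0)=Q$). $Q$ is 1-Töplitz if they all exist, $n$-Töplitz if they all exist and are $(n-1)$-Töplitz, and *Töplitz at $\infty$* if it is $(d-1)$-Töplitz. For $\Lambda\ge0$ and $c\neq0$ let $D_\Lambda(c)$ be the set of $(a,b)\in\mathcal L\times\mathcal L$ such that $|a|/|c|,\,|b|/|c|\ge2\Lambda^2$ and there are $a',b'\in\mathbb Z^d$ and an integer $t\ge0$ with $a=a'+tc$, $b=b'+tc$, $|a|\ge\Lambda(|a'|+|c|)|c|$, $|b|\ge\Lambda(|b'|+|c|)|c|$. Put $${}^1\langle Q\rangle_\Lambda=\sup_{c\ne0}\ \sup_{(a,b)\in D_\Lambda(c)}\Big(\max\big(\tfrac{|a|}{|c|},\tfrac{|b|}{|c|}\big)+1\Big)\,|Q_a^b-Q(+,c)_a^b|\;+\;\sup_{a,b}|Q_a^b|,$$ $${}^n\langle Q\rangle_\Lambda=\sup_{c\in\mathbb Z^d}\max\big({}^{n-1}\langle Q(+,c)\rangle_\Lambda,{}^{n-1}\langle Q(-,c)\rangle_\Lambda\big),\qquad \langle Q\rangle_\Lambda={}^{d-1}\langle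 Q\rangle_\Lambda .$$ For a family $H(\omega)$ put $\langle H\rangle_{\Lambda,U}=\sup_{\omega\in U}\max\big(\langle H(\omega)\rangle_\Lambda,\ \sup_{|v|\le1}\langle\partial_vH(\omega)\rangle_\Lambda\big)$, where $\partial_v$ is the derivative in the direction $v\in\mathbb R^{\mathcal A}$. **Proposition.** Let $\Delta\ge0$ be an integer, $\Delta'>1$, $0<\kappa<1$, $\Lambda\ge0$, $C_1\ge1$, $C_3,C_4>0$ and $C_2\in\mathbb R$. Let $U\subset\{\omega\in\mathbb R^{\mathcal A}:|\omega|\le C_1\}$ be any subset of an open convex set $B\subset\mathbb R^{\mathcal A}$. Let $\Omega_a(\omega)\in\mathbb R$ $(a\in\mathcal L)$ and the entries of $H(\omega):\mathcal L\times\mathcal L\to\mathbb C$ be of class $\mathcal C^1$ in $\omega\in B$; $\Omega(\omega)$ is the diagonal matrix with diagonal elements $\Omega_a(\omega)$. Assume for all $\omega\in B$: * $|\Omega_a(\omega)-|a|^2|\le C_2e^{-C_3|a|}$ and $|\partial_\omega(\Omega_a(\omega)-|a|^2)|\le C_2e^{-C_3|a|}$ for all $a\in\mathcal L$; * for all $k\in\mathbb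 Z^{\mathcal A}\setminus0$ and all $a,b\in\mathcal L$, the scalar products of $\frac{k}{|k|}$ with $\partial_\omega(\langle k,\omega\rangle+\Omega_a(\omega))$, with $\partial_\omega(\langle k,\omega\rangle+\Omega_a(\omega)+\Omega_b(\omega))$ and, if $|a|\ne|b|$, with $\partial_\omega(\langle k,\omega\rangle+\Omega_a(\omega)-\Omega_b(\omega))$ are all $\ge C_4$; * $\|\partial_vH(\omega)\|\le\frac{C_4}4$ for all $|v|\le1$ (operator norm on $\ell^2(\mathcal L)$). Assume also that, for all $\omega\in U$, $H(\omega)$ and all $\partial_vH(\omega)$ are Töplitz at $\infty$ and on normal form $\mathcal{NF}_\Delta$. Then there is a subset $U'\subset U$ with $$\mathrm{Leb}(U\setminus U')\le \mathrm{cte.}\,\max(\Delta',d_\Delta^2,\Lambda)^{\exp+\#\mathcal A-1}\,\big(C_1+\langle H\rangle_{\Lambda,U}\big)^d\,\kappa^{(\frac1{d+1})^d}\,C_1^{\#\mathcal A-1}$$ such that, for all $\omega\in U'$, all $k\in\mathbb Z^{\mathcal A}$ with $0<|k|\le\Delta'$ and all $a,b\in\mathcal L$ with $\mathrm{dist}([a]_\Delta,[b]_\Delta)\le\Delta'$,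 $$|\langle k,\omega\rangle+\alpha-\beta|\ge\kappa\qquad\forall\,\alpha\in\sigma\big((\Omega+H)(\omega)_{[a]_\Delta}\big),\ \forall\,\beta\in\sigma\big((\Omega+H)(\omega)_{[b]_\Delta}\big).$$ Moreover the $\kappa$-neighbourhood of $U\setminus U'$ satisfies the same measure estimate. The exponent $\exp$ is a natural number that depends only on $d$, and the constant $\mathrm{cte.}>0$ depends only on $d$, $\#\mathcal A$, $C_2$, $C_3$, $C_4$. -/

import Mathlib

open Filter Topology MeasureTheory
open scoped ENNReal

namespace ToplitzLattice

noncomputable section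

/-- An integer vector seen in Euclidean space, so that `‖vec a‖` is its `ℓ²`-norm `|a|`. -/
def vec {ι : Type*} (a : ι → ℤ) : EuclideanSpace ℝ ι :=
  WithLp.toLp 2 fun i => (a i : ℝ)

/-- The index set `𝓛 = ℤ^d ∖ 𝓐`. -/
abbrev Site {d : ℕ} (A : Finset (Fin d → ℤ)) : Type :=
  {a : Fin d → ℤ // a ∉ A}

/-- The parameter space `ℝ^𝓐`, with its Euclidean norm. -/
abbrev Param {d : ℕ} (A : Finset (Fin d → ℤ)) : Type :=
  EuclideanSpace ℝ {a : Fin d → ℤ // a ∈ A}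

/-- Scalar matrices `𝓛 × 𝓛 → ℂ`; the entry `Q_a^b` is `Q a b`. -/
abbrev Mat {d : ℕ} (A : Finset (Fin d → ℤ)) : Type :=
  Matrix (Site A) (Site A) ℂ

section Blocks

variable {d : ℕ} {A : Finset (Fin d → ℤ)}

/-- The pre-equivalence relation `|a|² = |b|²` and `|a - b| ≤ Δ`. -/
def PreEquiv (Δ : ℕ) (a b : Site A) : Prop :=
  ‖vec a.1‖ ^ 2 = ‖vec b.1‖ ^ 2 ∧ ‖vec (a.1 - b.1)‖ ≤ Δ

/-- The block `[a]_Δ`: the class of `a` for the equivalence relation on `𝓛` generated by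
`PreEquiv Δ`. -/
def block (Δ : ℕ) (a : Site A) : Set (Site A) :=
  {b | Relation.EqvGen (PreEquiv Δ) a b}

theorem norm_vec_eq_of_mem_block {Δ : ℕ} {a b : Site A} (h : b ∈ block Δ a) :
    ‖vec a.1‖ ^ 2 = ‖vec b.1‖ ^ 2 := by
  have h' : Relation.EqvGen (PreEquiv Δ) a b := h
  induction h' with
  | rel x y hxy => exact hxy.1
  | refl x => rfl
  | symm x y _ ih => exact (ih ‹_›).symm
  | trans x y z _ _ ih1 ih2 => exact (ih1 ‹_›).trans (ih2 ‹_›)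

theorem finite_block (Δ : ℕ) (a : Site A) : (block Δ a).Finite := by
  obtain ⟨N, hN⟩ := exists_nat_ge ‖vec a.1‖
  have hfin : (Set.Icc (fun _ => -(N : ℤ)) (fun _ => (N : ℤ)) : Set (Fin d → ℤ)).Finite :=
    Set.finite_Icc _ _
  refine Set.Finite.of_finite_image (f := Subtype.val) (hfin.subset ?_)
    Subtype.val_injective.injOn
  rintro _ ⟨b, hb, rfl⟩
  have h1 : ‖vec b.1‖ ≤ N := by
    have h2 := norm_vec_eq_of_mem_block hb
    rw [pow_left_inj₀ (norm_nonneg _) (norm_nonneg _) two_ne_zero] at h2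
    exact h2 ▸ hN
  have h3 : ∀ i, |(b.1 i : ℝ)| ≤ N := fun i =>
    (PiLp.norm_apply_le (vec b.1) i).trans h1
  refine ⟨fun i => ?_, fun i => ?_⟩
  · have := (abs_le.mp (h3 i)).1
    exact_mod_cast this
  · have := (abs_le.mp (h3 i)).2
    exact_mod_cast this

instance fintypeBlock (Δ : ℕ) (a : Site A) : Fintype (block Δ a) :=
  (finite_block Δ a).fintype

variable (A) in
/-- `d_Δ`, the supremum of the diameters of all blocks. -/
def blockDiam (Δ : ℕ) : ℝ≥0∞ :=
  ⨆ a : Site A, Metric.ediam ((fun b : Site A => vec b.1) '' block Δ a)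

/-- `dist(X, Y) = inf {|x - y| : x ∈ X, y ∈ Y}`. -/
def setDist (X Y : Set (Site A)) : ℝ≥0∞ :=
  ⨅ x ∈ X, ⨅ y ∈ Y, edist (vec x.1) (vec y.1)

/-- The restriction `Q_[a] = Q|_{[a] × [a]}` of a matrix to a block. -/
def blockRestrict (Q : Mat A) (Δ : ℕ) (a : Site A) : Matrix (block Δ a) (block Δ a) ℂ :=
  Q.submatrix Subtype.val Subtype.val

/-- Normal form: Hermitian, and block-diagonal over the decomposition into blocks `[·]_Δ`. -/
def NormalForm (Δ : ℕ) (Q : Mat A) : Prop :=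
  Q.IsHermitian ∧ ∀ a b : Site A, block Δ a ≠ block Δ b → Q a b = 0

end Blocks

section Toplitz

variable {d : ℕ} {A : Finset (Fin d → ℤ)}

/-- The entries of a matrix as a function on `ℤ^d × ℤ^d`. The value `0` off `𝓛 × 𝓛` plays no
role in a limit at infinity, since `𝓐` is finite. -/
def entry (Q : Mat A) (x y : Fin d → ℤ) : ℂ :=
  if h : x ∉ A ∧ y ∉ A then Q ⟨x, h.1⟩ ⟨y, h.2⟩ else 0

/-- `P` is the Töplitz limit `Q(±, c)`, i.e. `P_a^b = lim_{t → +∞} Q_{a + tc}^{b ± tc}`;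
the sign is `s`. -/
def IsToplitzLimit (s : ℤˣ) (c : Fin d → ℤ) (Q P : Mat A) : Prop :=
  ∀ a b : Site A, Tendsto
    (fun t : ℕ => entry Q (a.1 + (t : ℤ) • c) (b.1 + ((s : ℤ) * t) • c)) atTop (𝓝 (P a b))

/-- `Q` is `n`-Töplitz: all Töplitz limits `Q(±, c)` exist and are `(n-1)`-Töplitz
(with no condition for `n = 0`). -/
def IsNToplitz : ℕ → Mat A → Prop
  | 0, _ => True
  | n + 1, Q => ∀ (s : ℤˣ) (c : Fin d → ℤ), ∃ P : Mat A, IsToplitzLimit s c Q P ∧ IsNToplitz n P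

/-- Töplitz at `∞` in dimension `d ≥ 2`: being `(d-1)`-Töplitz. -/
def IsToplitz (Q : Mat A) : Prop :=
  IsNToplitz (d - 1) Q

/-- The Töplitz limit `Q(±, c)` as a matrix (meaningful when the limits exist; for `c = 0`
it is `Q`). -/
def toplitzLimit (s : ℤˣ) (c : Fin d → ℤ) (Q : Mat A) : Mat A := fun a b =>
  limUnder atTop fun t : ℕ => entry Q (a.1 + (t : ℤ) • c) (b.1 + ((s : ℤ) * t) • c)

/-- The Lipschitz domain `D_Λ(c) = D_Λ^+(c)`, for `c ≠ 0`. -/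
def lipDomain (A : Finset (Fin d → ℤ)) (Λ : ℝ) (c : Fin d → ℤ) : Set (Site A × Site A) :=
  {p | (∃ (a' b' : Fin d → ℤ) (t : ℕ),
      p.1.1 = a' + (t : ℤ) • c ∧ p.2.1 = b' + (t : ℤ) • c ∧
      Λ * (‖vec a'‖ + ‖vec c‖) * ‖vec c‖ ≤ ‖vec p.1.1‖ ∧
      Λ * (‖vec b'‖ + ‖vec c‖) * ‖vec c‖ ≤ ‖vec p.2.1‖) ∧
    2 * Λ ^ 2 ≤ ‖vec p.1.1‖ / ‖vec c‖ ∧ 2 * Λ ^ 2 ≤ ‖vec p.2.1‖ / ‖vec c‖}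

/-- The supremum norm `|Q| = sup_{a, b} |Q_a^b|`. -/
def supNorm (Q : Mat A) : ℝ≥0∞ :=
  ⨆ (a : Site A) (b : Site A), ‖Q a b‖ₑ

/-- The Lipschitz constant
`sup_{c ≠ 0} sup_{(a,b) ∈ D_Λ(c)} (max(|a|/|c|, |b|/|c|) + 1) |Q_a^b - Q(+,c)_a^b|`. -/
def lipConst (Λ : ℝ) (Q : Mat A) : ℝ≥0∞ :=
  ⨆ (c : Fin d → ℤ) (_ : c ≠ 0) (p : Site A × Site A) (_ : p ∈ lipDomain A Λ c),
    ENNReal.ofReal (max (‖vec p.1.1‖ / ‖vec c‖) (‖vec p.2.1‖ / ‖vec c‖) + 1) *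
      ‖Q p.1 p.2 - toplitzLimit 1 c Q p.1 p.2‖ₑ

/-- The norms `ⁿ⟨Q⟩_Λ`, `n ≥ 1` (without exponential weight): `¹⟨Q⟩_Λ` is the Lipschitz
constant plus the supremum norm, and `ⁿ⟨Q⟩_Λ = sup_c max(ⁿ⁻¹⟨Q(+,c)⟩_Λ, ⁿ⁻¹⟨Q(-,c)⟩_Λ)`,
`c = 0` being allowed. The value at `n = 0` is not used. -/
def lipNormN (Λ : ℝ) : ℕ → Mat A → ℝ≥0∞
  | 0, Q => supNorm Q
  | 1, Q => lipConst Λ Q + supNorm Q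
  | n + 2, Q => ⨆ (s : ℤˣ) (c : Fin d → ℤ), lipNormN Λ (n + 1) (toplitzLimit s c Q)

/-- The Lipschitz norm `⟨Q⟩_Λ` in dimension `d ≥ 2`. -/
def lipNorm (Λ : ℝ) (Q : Mat A) : ℝ≥0∞ :=
  lipNormN Λ (d - 1) Q

/-- The operator norm of a matrix on `ℓ²(𝓛)`, computed on finitely supported vectors. -/
def opNorm (Q : Mat A) : ℝ≥0∞ :=
  ⨆ (x : Site A →₀ ℂ) (_ : ∑ b ∈ x.support, ‖x b‖ ^ 2 ≤ 1),
    (∑' a, ‖∑ b ∈ x.support, Q a b * x b‖ₑ ^ 2) ^ (1 / 2 : ℝ)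

end Toplitz

section Families

variable {d : ℕ} {A : Finset (Fin d → ℤ)}

/-- The directional derivative `∂_v H(ω)` of a family of matrices, entry by entry. -/
def derivMat (H : Param A → Mat A) (ω v : Param A) : Mat A := fun a b =>
  fderiv ℝ (fun w => H w a b) ω v

/-- The Lipschitz norm of a family over `U`: the supremum over `ω ∈ U` of `⟨H(ω)⟩_Λ` and
`⟨∂_ω H(ω)⟩_Λ`, the latter being the supremum of `⟨∂_v H(ω)⟩_Λ` over `|v| ≤ 1`. -/
def lipNormOn (Λ : ℝ) (U : Set (Param A)) (H : Param A → Mat A) : ℝ≥0∞ :=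
  ⨆ ω ∈ U, max (lipNorm Λ (H ω))
    (⨆ (v : Param A) (_ : ‖v‖ ≤ 1), lipNorm Λ (derivMat H ω v))

/-- `Ω_a(ω)` and its gradient are exponentially close to `|a|²` and `0` on `B`. -/
def CloseToSquares (C₂ C₃ : ℝ) (B : Set (Param A)) (Ω : Param A → Site A → ℝ) : Prop :=
  ∀ a : Site A, ∀ ω ∈ B,
    |Ω ω a - ‖vec a.1‖ ^ 2| ≤ C₂ * Real.exp (-C₃ * ‖vec a.1‖) ∧
    ‖fderiv ℝ (fun w => Ω w a - ‖vec a.1‖ ^ 2) ω‖ ≤ C₂ * Real.exp (-C₃ * ‖vec a.1‖)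

/-- The transversality conditions: the derivatives of `⟨k,ω⟩ + Ω_a`, `⟨k,ω⟩ + Ω_a + Ω_b` and,
if `|a| ≠ |b|`, `⟨k,ω⟩ + Ω_a - Ω_b` in the direction `k / |k|` are at least `C₄`. -/
def Transversal (C₄ : ℝ) (B : Set (Param A)) (Ω : Param A → Site A → ℝ) : Prop :=
  ∀ k : {a : Fin d → ℤ // a ∈ A} → ℤ, k ≠ 0 → ∀ ω ∈ B, ∀ a b : Site A,
    C₄ ≤ fderiv ℝ (fun w => inner ℝ (vec k) w + Ω w a) ω (‖vec k‖⁻¹ • vec k) ∧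
    C₄ ≤ fderiv ℝ (fun w => inner ℝ (vec k) w + Ω w a + Ω w b) ω (‖vec k‖⁻¹ • vec k) ∧
    (‖vec a.1‖ ≠ ‖vec b.1‖ →
      C₄ ≤ fderiv ℝ (fun w => inner ℝ (vec k) w + Ω w a - Ω w b) ω (‖vec k‖⁻¹ • vec k))

/-- The matrix `(Ω + H)(ω)`, where `Ω` is diagonal. -/
def hamMat (Ω : Param A → Site A → ℝ) (H : Param A → Mat A) (ω : Param A) : Mat A :=
  Matrix.diagonal (fun a => (Ω ω a : ℂ)) + H ω

/-- The second Melnikov condition at `ω`, for `0 < |k| ≤ Δ'` and for blocks at distance at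
most `Δ'`. -/
def SecondMelnikov (Δ : ℕ) (Δ' κ : ℝ) (Ω : Param A → Site A → ℝ) (H : Param A → Mat A)
    (ω : Param A) : Prop :=
  ∀ k : {a : Fin d → ℤ // a ∈ A} → ℤ, 0 < ‖vec k‖ → ‖vec k‖ ≤ Δ' →
    ∀ a b : Site A, setDist (block Δ a) (block Δ b) ≤ ENNReal.ofReal Δ' →
      ∀ α ∈ spectrum ℂ (blockRestrict (hamMat Ω H ω) Δ a),
      ∀ β ∈ spectrum ℂ (blockRestrict (hamMat Ω H ω) Δ b),
        κ ≤ ‖((inner ℝ (vec k) ω : ℝ) : ℂ) + α - β‖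

variable (A) in
/-- The bound on the measure of the excluded set of parameters. -/
def measureBound (e : ℕ) (cte : ℝ) (Δ : ℕ) (Δ' κ Λ C₁ : ℝ) (hNorm : ℝ≥0∞) : ℝ≥0∞ :=
  ENNReal.ofReal cte *
    max (ENNReal.ofReal Δ') (max (blockDiam A Δ ^ 2) (ENNReal.ofReal Λ)) ^ (e + A.card - 1) *
    (ENNReal.ofReal C₁ + hNorm) ^ d *
    ENNReal.ofReal (κ ^ ((1 / ((d : ℝ) + 1)) ^ d)) *
    ENNReal.ofReal C₁ ^ (A.card - 1)

end Families

end

end ToplitzLattice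

open ToplitzLattice

/-! One pair of blocks. Fix `k ≠ 0` and put `e = k/|k|`. Transversality of the sums with `b = a`,
applied to `k` and to `-k`, shows that both `½⟨k,ω⟩ + Ω_a` and `½⟨k,ω⟩ - Ω_a` grow along `e` with
speed at least `C₄/2`; the perturbation `H` costs at most `C₄/4`. Hence the Hermitian families
`½⟨k,ω⟩ + (Ω+H)_[a]` and `½⟨k,ω⟩ - (Ω+H)_[b]` have growing quadratic forms, and by Weyl's principle
their ordered eigenvalues grow as well. The numbers `⟨k,ω⟩ + α - β` are sums of such eigenvalues, so
the parameters where one of them is small lie in thickened Lipschitz graphs over the hyperplane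
orthogonal to `e`. The `κ`-neighbourhood of such a set is open with short fibres along `e`, and
Fubini bounds its measure whether or not `U` is measurable (`volume_thickening_resonantSet_le`).

Infinitely many pairs. A resonance bounds `|a|² - |b|²`, hence also `⟨a, x - y⟩` for all points `x,
y` of the two blocks. If `a` is long, Dirichlet approximation gives `a = a' + tc` with `c ≠ 0`
short, and the integer `⟨c, x - y⟩` is forced to vanish. The Töplitz-Lipschitz property replaces `H`
near the blocks by its limit in the direction `c`, with an error of order `1/|a|`. That limit is
invariant under translation by `c`, and such translations preserve `|x|² - |y|²`, so the whole
configuration may be moved back towards the hyperplane orthogonal to `c`. The step is then repeated.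
Each new direction is independent of the previous ones and all are orthogonal to some `x - y ≠ 0`,
so at most `d - 1` limits are taken (`Stage.step`). If both blocks are the same single point then `α
= β`, and only `⟨k,ω⟩` matters. Thus every resonance belongs to a finite list that does not depend
on `ω` (`resonance_cases`).

Scales. Let `κ_j = κ^{(1/(d+1))^j}`. A further limit is taken after `j` limits only when the base
point lies beyond the radius `R_{j+1} ~ 1/κ_{j+1}`, at the cost of an error `κ_{j+1}`. The
resonances left after `j` limits have about `R_{j+1}^d` base points and width about `κ_j`; since
`κ_j = κ_{j+1}^{d+1}`, their total measure is of order `κ_{j+1} ≤ κ_d` (`resonance_sum_le`). -/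

namespace ToplitzLattice

/-! ### Quadratic forms and Weyl's principle -/

section Forms

variable {ι : Type*} [Fintype ι]

/-- The real part of the quadratic form `u* M u`. -/
noncomputable def form (M : Matrix ι ι ℂ) (u : ι → ℂ) : ℝ :=
  (∑ i, ∑ j, star (u i) * M i j * u j).re

/-- The squared `ℓ²`-norm of a vector. -/
noncomputable def nsq (u : ι → ℂ) : ℝ := ∑ i, ‖u i‖ ^ 2

theorem nsq_nonneg (u : ι → ℂ) : 0 ≤ nsq u := Finset.sum_nonneg fun _ _ => sq_nonneg _

theorem form_sub (M N : Matrix ι ι ℂ) (u : ι → ℂ) : form (M - N) u = form M u - form N u := by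
  simp only [form, Matrix.sub_apply, mul_sub, sub_mul, Finset.sum_sub_distrib, Complex.sub_re]

theorem form_add (M N : Matrix ι ι ℂ) (u : ι → ℂ) : form (M + N) u = form M u + form N u := by
  simp only [form, Matrix.add_apply, mul_add, add_mul, Finset.sum_add_distrib, Complex.add_re]

theorem form_diagonal [DecidableEq ι] (f : ι → ℝ) (u : ι → ℂ) :
    form (Matrix.diagonal fun i => (f i : ℂ)) u = ∑ i, f i * ‖u i‖ ^ 2 := by
  simp only [form, Complex.re_sum]
  refine Finset.sum_congr rfl fun i _ => ?_
  rw [Finset.sum_eq_single i]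
  · rw [Matrix.diagonal_apply_eq, ← Complex.normSq_eq_norm_sq, Complex.normSq_apply]
    simp
    ring
  · intro j _ hj
    simp [Matrix.diagonal_apply_ne _ hj.symm]
  · simp

/-- Cauchy–Schwarz applied to `(∑ ‖u i‖)²`; the dimension is the price of an entrywise bound. -/
theorem abs_form_le {M : Matrix ι ι ℂ} {ε : ℝ} (hM : ∀ i j, ‖M i j‖ ≤ ε) (u : ι → ℂ) :
    |form M u| ≤ Fintype.card ι * ε * nsq u := by
  have h1 : |form M u| ≤ ∑ i, ∑ j, ε * (‖u i‖ * ‖u j‖) := by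
    refine (Complex.abs_re_le_norm _).trans ((norm_sum_le _ _).trans (Finset.sum_le_sum fun i _ =>
      (norm_sum_le _ _).trans (Finset.sum_le_sum fun j _ => ?_)))
    rw [norm_mul, norm_mul, norm_star]
    have := mul_le_mul_of_nonneg_right (hM i j) (mul_nonneg (norm_nonneg (u i)) (norm_nonneg (u j)))
    linarith
  have h2 : ∑ i, ∑ j, ε * (‖u i‖ * ‖u j‖) = ε * (∑ i, ‖u i‖) ^ 2 := by
    rw [sq, Finset.sum_mul_sum, Finset.mul_sum]
    simp [Finset.mul_sum]
  rcases isEmpty_or_nonempty ι with hι | ⟨⟨i⟩⟩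
  · simp [form, nsq]
  have hε : 0 ≤ ε := (norm_nonneg _).trans (hM i i)
  have h3 : (∑ i, ‖u i‖) ^ 2 ≤ Fintype.card ι * nsq u := by
    simpa [nsq] using sq_sum_le_card_mul_sum_sq (s := Finset.univ) (f := fun i => ‖u i‖)
  calc |form M u| ≤ ε * (∑ i, ‖u i‖) ^ 2 := h1.trans h2.le
    _ ≤ ε * (Fintype.card ι * nsq u) := by gcongr
    _ = _ := by ring

variable [DecidableEq ι]

theorem inner_toEuclideanLin_eq_sum {M : Matrix ι ι ℂ} (hM : M.IsHermitian)
    (u : EuclideanSpace ℂ ι) :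
    form M u = ∑ i, hM.eigenvalues i * ‖inner ℂ (hM.eigenvectorBasis i) u‖ ^ 2 := by
  have h1 : inner ℂ u (Matrix.toEuclideanLin M u) = ∑ i, ∑ j, star (u i) * M i j * u j := by
    simp only [PiLp.inner_apply, Matrix.toLpLin_apply, Matrix.mulVec, dotProduct,
      RCLike.inner_apply]
    refine Finset.sum_congr rfl fun i _ => ?_
    rw [Finset.sum_mul]
    refine Finset.sum_congr rfl fun j _ => ?_
    simp
    ring
  have hsymm := Matrix.isSymmetric_toEuclideanLin_iff.mpr hM
  have h2 : ∀ i, inner ℂ (hM.eigenvectorBasis i) (Matrix.toEuclideanLin M u) =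
      (hM.eigenvalues i : ℂ) * inner ℂ (hM.eigenvectorBasis i) u := by
    intro i
    rw [← hsymm]
    have : Matrix.toEuclideanLin M (hM.eigenvectorBasis i) =
        (hM.eigenvalues i : ℂ) • hM.eigenvectorBasis i := by
      have := hM.mulVec_eigenvectorBasis i
      rw [Matrix.toLpLin_apply, this]
      ext; simp
    rw [this, inner_smul_left]
    simp
  rw [form, ← h1, ← hM.eigenvectorBasis.sum_inner_mul_inner, Complex.re_sum]
  refine Finset.sum_congr rfl fun i _ => ?_
  rw [h2, ← inner_conj_symm u]
  generalize inner ℂ (hM.eigenvectorBasis i) u = z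
  rw [← Complex.normSq_eq_norm_sq, Complex.normSq_apply]
  simp
  ring

theorem nsq_eq_sum_inner {M : Matrix ι ι ℂ} (hM : M.IsHermitian) (u : EuclideanSpace ℂ ι) :
    nsq u = ∑ i, ‖inner ℂ (hM.eigenvectorBasis i) u‖ ^ 2 := by
  rw [hM.eigenvectorBasis.sum_sq_norm_inner_right, EuclideanSpace.norm_sq_eq]; rfl

/-- Weyl's monotonicity principle for the ordered eigenvalues of Hermitian matrices. -/
theorem eigenvalues₀_le_of_form_le {M N : Matrix ι ι ℂ} (hM : M.IsHermitian) (hN : N.IsHermitian)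
    {ε : ℝ} (h : ∀ u, form M u ≤ form N u + ε * nsq u) (j : Fin (Fintype.card ι)) :
    hM.eigenvalues₀ j ≤ hN.eigenvalues₀ j + ε := by
  classical
  let e : Fin (Fintype.card ι) ≃ ι := Fintype.equivOfCardEq (Fintype.card_fin _)
  -- Courant–Fischer by counting dimensions. The ordered eigenvalues decrease, and `L u = 0` imposes
  -- only `card ι - 1` conditions: `u` is orthogonal to the eigenvectors of `M` after `j` and to
  -- those of `N` before `j`. For a nonzero such `u`, the form of `M` is at least its `j`-th
  -- eigenvalue times `nsq u`, and that of `N` at most its own.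
  let L : EuclideanSpace ℂ ι →ₗ[ℂ] ({i : Fin (Fintype.card ι) // j < i} → ℂ) ×
      ({i : Fin (Fintype.card ι) // i < j} → ℂ) :=
    { toFun := fun u => (fun i => inner ℂ (hM.eigenvectorBasis (e i)) u,
        fun i => inner ℂ (hN.eigenvectorBasis (e i)) u)
      map_add' := fun u v => by ext <;> simp
      map_smul' := fun c u => by ext <;> simp }
  have hker : LinearMap.ker L ≠ ⊥ := by
    apply LinearMap.ker_ne_bot_of_finrank_lt
    rw [Module.finrank_prod, Module.finrank_fintype_fun_eq_card, Module.finrank_fintype_fun_eq_card,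
      finrank_euclideanSpace, Fintype.card_subtype, Fintype.card_subtype]
    have h1 : (Finset.univ.filter fun i => j < i) = Finset.Ioi j := by ext; simp
    have h2 : (Finset.univ.filter fun i => i < j) = Finset.Iio j := by ext; simp
    rw [h1, h2, Fin.card_Ioi, Fin.card_Iio]
    omega
  obtain ⟨u, hu, hu0⟩ := (Submodule.ne_bot_iff _).mp hker
  have hu' : L u = 0 := hu
  have hu1 : ∀ i, j < i → inner ℂ (hM.eigenvectorBasis (e i)) u = 0 := fun i hi =>
    congrFun (congrArg Prod.fst hu') ⟨i, hi⟩
  have hu2 : ∀ i, i < j → inner ℂ (hN.eigenvectorBasis (e i)) u = 0 := fun i hi =>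
    congrFun (congrArg Prod.snd hu') ⟨i, hi⟩
  have hpos : 0 < nsq u := by
    have : nsq u = ‖u‖ ^ 2 := by rw [EuclideanSpace.norm_sq_eq]; rfl
    rw [this]
    have := norm_pos_iff.mpr hu0
    positivity
  have eM : ∀ i, hM.eigenvalues (e i) = hM.eigenvalues₀ i := fun i => by
    simp [Matrix.IsHermitian.eigenvalues, e]
  have eN : ∀ i, hN.eigenvalues (e i) = hN.eigenvalues₀ i := fun i => by
    simp [Matrix.IsHermitian.eigenvalues, e]
  have k1 : hM.eigenvalues₀ j * nsq u ≤ form M u := by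
    rw [inner_toEuclideanLin_eq_sum hM, nsq_eq_sum_inner hM, Finset.mul_sum, ← e.sum_comp,
      ← e.sum_comp]
    refine Finset.sum_le_sum fun i _ => ?_
    rcases le_or_gt i j with hi | hi
    · rw [eM]
      exact mul_le_mul_of_nonneg_right (hM.eigenvalues₀_antitone hi) (sq_nonneg _)
    · simp [hu1 i hi]
  have k2 : form N u ≤ hN.eigenvalues₀ j * nsq u := by
    rw [inner_toEuclideanLin_eq_sum hN, nsq_eq_sum_inner hN, Finset.mul_sum, ← e.sum_comp,
      ← e.sum_comp]
    refine Finset.sum_le_sum fun i _ => ?_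
    rcases le_or_gt j i with hi | hi
    · rw [eN]
      exact mul_le_mul_of_nonneg_right (hN.eigenvalues₀_antitone hi) (sq_nonneg _)
    · simp [hu2 i hi]
  have := h u
  have k3 : hM.eigenvalues₀ j * nsq u ≤ (hN.eigenvalues₀ j + ε) * nsq u := by linarith
  exact le_of_mul_le_mul_right k3 hpos

theorem mem_spectrum_iff_eigenvalues₀ {M : Matrix ι ι ℂ} (hM : M.IsHermitian) {α : ℂ} :
    α ∈ spectrum ℂ M ↔ ∃ j, (hM.eigenvalues₀ j : ℂ) = α := by
  rw [hM.spectrum_eq_image_range]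
  constructor
  · rintro ⟨_, ⟨i, rfl⟩, rfl⟩
    exact ⟨_, rfl⟩
  · rintro ⟨j, rfl⟩
    refine ⟨_, ⟨Fintype.equivOfCardEq (Fintype.card_fin _) j, rfl⟩, ?_⟩
    simp [Matrix.IsHermitian.eigenvalues]

/-- Eigenvalues of Hermitian matrices move by at most the distance of the quadratic forms. -/
theorem exists_mem_spectrum_near {M N : Matrix ι ι ℂ} (hM : M.IsHermitian) (hN : N.IsHermitian)
    {ε : ℝ} (h : ∀ u, |form M u - form N u| ≤ ε * nsq u) {α : ℂ} (hα : α ∈ spectrum ℂ M) :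
    ∃ β ∈ spectrum ℂ N, ‖α - β‖ ≤ ε := by
  obtain ⟨j, rfl⟩ := (mem_spectrum_iff_eigenvalues₀ hM).mp hα
  refine ⟨_, (mem_spectrum_iff_eigenvalues₀ hN).mpr ⟨j, rfl⟩, ?_⟩
  rw [← Complex.ofReal_sub, Complex.norm_real, Real.norm_eq_abs, abs_sub_le_iff]
  have h1 := eigenvalues₀_le_of_form_le hM hN (ε := ε)
    (fun u => by have := (abs_le.mp (h u)).2; linarith) j
  have h2 := eigenvalues₀_le_of_form_le hN hM (ε := ε)
    (fun u => by have := (abs_le.mp (h u)).1; linarith) j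
  constructor <;> linarith

theorem spectrum_submatrix_equiv {κ : Type*} [Fintype κ] [DecidableEq κ] (e : κ ≃ ι)
    (M : Matrix ι ι ℂ) : spectrum ℂ (M.submatrix e e) = spectrum ℂ M :=
  AlgEquiv.spectrum_eq (Matrix.reindexAlgEquiv ℂ ℂ e.symm) M

end Forms

/-! ### Measure of neighbourhoods of thickened Lipschitz graphs -/

section SlabMeasure

variable {ι : Type*} [Fintype ι]

/-- A bounded open set whose fibres in a fixed direction have diameter at most `ℓ`. -/
theorem volume_le_of_fibre_le {S : Set (EuclideanSpace ℝ ι)} (hS : IsOpen S) {ρ ℓ : ℝ}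
    (hρ : ∀ x ∈ S, ‖x‖ ≤ ρ) {e : EuclideanSpace ℝ ι} (he : ‖e‖ = 1)
    (hfib : ∀ x ∈ S, ∀ s : ℝ, x + s • e ∈ S → |s| ≤ ℓ) :
    volume S ≤ ENNReal.ofReal ℓ * ENNReal.ofReal (2 * ρ) ^ (Fintype.card ι - 1) := by
  classical
  obtain ⟨m, hm⟩ : ∃ m, Fintype.card ι = m + 1 := by
    refine Nat.exists_eq_succ_of_ne_zero fun h0 => ?_
    have := Fintype.card_eq_zero_iff.mp h0
    rw [Subsingleton.elim e 0] at he
    simp at he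
  obtain ⟨b, hb⟩ : ∃ b : OrthonormalBasis (Fin (m + 1)) ℝ (EuclideanSpace ℝ ι), b 0 = e := by
    have ho : Orthonormal ℝ (Set.domRestrict {(0 : Fin (m + 1))} fun _ => e) := by
      rw [orthonormal_iff_ite]
      rintro ⟨i, rfl⟩ ⟨j, rfl⟩
      simp [Set.domRestrict, he]
    obtain ⟨b, hb⟩ := ho.exists_orthonormalBasis_extension_of_card_eq (by simp [hm])
    exact ⟨b, hb 0 rfl⟩
  -- coordinates
  let f : (Fin (m + 1) → ℝ) → EuclideanSpace ℝ ι := fun y => b.repr.symm (WithLp.toLp 2 y)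
  have hf : MeasurePreserving f :=
    (b.measurePreserving_repr_symm).comp (PiLp.volume_preserving_toLp (Fin (m + 1)))
  let g := MeasurableEquiv.piFinSuccAbove (fun _ : Fin (m + 1) => ℝ) 0
  have hg : MeasurePreserving g.symm :=
    (volume_preserving_piFinSuccAbove (fun _ : Fin (m + 1) => ℝ) 0).symm
  have hfg : MeasurePreserving (f ∘ g.symm) := hf.comp hg
  rw [← hfg.measure_preimage hS.measurableSet.nullMeasurableSet]
  have hfg_apply : ∀ p : ℝ × (Fin m → ℝ), (f ∘ g.symm) p =
      p.1 • e + b.repr.symm (WithLp.toLp 2 (Fin.cons 0 p.2 : Fin (m + 1) → ℝ)) := by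
    intro p
    have : (g.symm p : Fin (m + 1) → ℝ) = Fin.cons p.1 p.2 := by
      simp [g, MeasurableEquiv.piFinSuccAbove, Fin.insertNthEquiv]
    simp only [Function.comp, f, this, ← hb]
    rw [← b.repr_symm_single, ← map_smul, ← map_add]
    congr 1
    ext i
    refine Fin.cases ?_ (fun i => ?_) i <;> simp
  have hmeas : MeasurableSet ((f ∘ g.symm) ⁻¹' S) := hfg.measurable hS.measurableSet
  -- Fubini in an orthonormal basis starting with `e`: fibres along `e` have length at most `ℓ`, and
  -- the other coordinates range over a cube of half-side `ρ`.
  rw [Measure.volume_eq_prod, Measure.prod_apply_symm hmeas]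
  have hcoord : ∀ p : ℝ × (Fin m → ℝ), (f ∘ g.symm) p ∈ S → ∀ i, |p.2 i| ≤ ρ := by
    intro p hp i
    have h1 := hρ _ hp
    have h2 : (f ∘ g.symm) p = b.repr.symm (WithLp.toLp 2 (Fin.cons p.1 p.2 : Fin (m+1) → ℝ)) := by
      have : (g.symm p : Fin (m + 1) → ℝ) = Fin.cons p.1 p.2 := by
        simp [g, MeasurableEquiv.piFinSuccAbove, Fin.insertNthEquiv]
      simp only [Function.comp, f, this]
    rw [h2, LinearIsometryEquiv.norm_map] at h1
    simpa using (PiLp.norm_apply_le (WithLp.toLp 2 (Fin.cons p.1 p.2 : Fin (m+1) → ℝ)) i.succ).trans h1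
  have hbound : ∀ y : Fin m → ℝ, volume ((fun x => (x, y)) ⁻¹' ((f ∘ g.symm) ⁻¹' S)) ≤
      (Set.Icc (fun _ => -ρ) (fun _ => ρ) : Set (Fin m → ℝ)).indicator
        (fun _ => ENNReal.ofReal ℓ) y := by
    intro y
    by_cases hy : y ∈ (Set.Icc (fun _ => -ρ) (fun _ => ρ) : Set (Fin m → ℝ))
    · rw [Set.indicator_of_mem hy]
      refine (Real.volume_le_diam _).trans (Metric.ediam_le fun s hs t ht => ?_)
      rw [edist_dist]
      refine ENNReal.ofReal_le_ofReal ?_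
      simp only [Set.mem_preimage, hfg_apply] at hs ht
      rw [dist_comm, Real.dist_eq]
      refine hfib _ hs _ ?_
      convert ht using 1
      module
    · rw [Set.indicator_of_notMem hy, nonpos_iff_eq_zero]
      convert measure_empty (μ := (volume : Measure ℝ))
      rw [Set.eq_empty_iff_forall_notMem]
      intro s hs
      exact hy ⟨fun i => (abs_le.mp (hcoord (s, y) hs i)).1,
        fun i => (abs_le.mp (hcoord (s, y) hs i)).2⟩
  refine (lintegral_mono hbound).trans ?_
  rw [lintegral_indicator measurableSet_Icc, lintegral_const, Measure.restrict_apply_univ,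
    Real.volume_Icc_pi, hm]
  simp only [Finset.prod_const, Finset.card_univ, Fintype.card_fin, sub_neg_eq_add, ← two_mul,
    Nat.add_sub_cancel, le_refl]

/-- The measure of a `κ`-neighbourhood of a subset of a thickened Lipschitz graph. -/
theorem volume_thickening_le {E : Set (EuclideanSpace ℝ ι)} {C₁ κ A L : ℝ} (hκ : 0 ≤ κ) (hL : 0 ≤ L)
    (hE : ∀ x ∈ E, ‖x‖ ≤ C₁) {e : EuclideanSpace ℝ ι} (he : ‖e‖ = 1)
    (hcone : ∀ x ∈ E, ∀ y ∈ E, 0 ≤ inner ℝ e (x - y) →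
      inner ℝ e (x - y) ≤ A + L * ‖(x - y) - (inner ℝ e (x - y) : ℝ) • e‖) :
    volume (Metric.thickening κ E) ≤ ENNReal.ofReal (A + (4 * L + 2) * κ) *
      ENNReal.ofReal (2 * (C₁ + κ)) ^ (Fintype.card ι - 1) := by
  refine volume_le_of_fibre_le Metric.isOpen_thickening (fun x hx => ?_) he ?_
  · obtain ⟨y, hy, hxy⟩ := Metric.mem_thickening_iff.mp hx
    have := hE y hy
    rw [dist_eq_norm] at hxy
    calc ‖x‖ = ‖y + (x - y)‖ := by congr 1; abel
      _ ≤ ‖y‖ + ‖x - y‖ := norm_add_le _ _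
      _ ≤ C₁ + κ := by linarith
  · have key : ∀ x ∈ Metric.thickening κ E, ∀ s : ℝ, 0 ≤ s → x + s • e ∈ Metric.thickening κ E →
        s ≤ A + (4 * L + 2) * κ := by
      intro x hx s hs hx'
      obtain ⟨y, hy, hxy⟩ := Metric.mem_thickening_iff.mp hx
      obtain ⟨y', hy', hxy'⟩ := Metric.mem_thickening_iff.mp hx'
      rw [dist_eq_norm] at hxy hxy'
      -- The two points of the neighbourhood are compared with points of `E`, with total error `w`
      -- of norm at most `2κ`. It changes the component along `e` by at most `2κ` and the
      -- transversal component by at most `4κ`, whence `4 * L + 2`.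
      obtain ⟨w, hw⟩ : ∃ w, w = (x - y) - (x + s • e - y') := ⟨_, rfl⟩
      have hwn : ‖w‖ ≤ 2 * κ := by
        rw [hw]; refine (norm_sub_le _ _).trans ?_; linarith
      have hyy : y' - y = s • e + w := by rw [hw]; abel
      have hee : inner ℝ e e = (1 : ℝ) := by rw [real_inner_self_eq_norm_sq, he]; norm_num
      have hin : inner ℝ e (y' - y) = s + inner ℝ e w := by
        rw [hyy, inner_add_right, inner_smul_right, hee, mul_one]
      have hew : |inner ℝ e w| ≤ 2 * κ := by
        refine (abs_real_inner_le_norm _ _).trans ?_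
        rw [he, one_mul]; exact hwn
      have hab := abs_le.mp hew
      rcases lt_or_ge (inner ℝ e (y' - y)) 0 with hneg | hnn
      · have hA : 0 ≤ A := by
          have := hcone y hy y hy (by simp)
          simpa using this
        nlinarith
      · have h1 := hcone y' hy' y hy hnn
        have hperp : ‖(y' - y) - (inner ℝ e (y' - y) : ℝ) • e‖ ≤ 4 * κ := by
          have : (y' - y) - (inner ℝ e (y' - y) : ℝ) • e = w - (inner ℝ e w : ℝ) • e := by
            rw [hin, hyy]; module
          rw [this]
          refine (norm_sub_le _ _).trans ?_
          rw [norm_smul, he, mul_one, Real.norm_eq_abs]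
          linarith
        have := mul_le_mul_of_nonneg_left hperp hL
        nlinarith
    intro x hx s hxs
    rcases le_total 0 s with hs | hs
    · rw [abs_of_nonneg hs]; exact key x hx s hs hxs
    · rw [abs_of_nonpos hs]
      refine key (x + s • e) hxs (-s) (by linarith) ?_
      convert hx using 1
      module

end SlabMeasure

/-! ### Near-resonances of two growing Hermitian families -/

section Resonance

variable {τ ι ι' : Type*} [Fintype τ] [Fintype ι] [Fintype ι'] [DecidableEq ι] [DecidableEq ι']

/-- The quadratic forms of the family `N` increase with speed `g` in the direction `e`, up to a
loss `L` times the transversal displacement. -/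
def Growth (U : Set (EuclideanSpace ℝ τ)) (e : EuclideanSpace ℝ τ) (g L : ℝ)
    (N : EuclideanSpace ℝ τ → Matrix ι ι ℂ) : Prop :=
  ∀ x ∈ U, ∀ y ∈ U, 0 ≤ inner ℝ e (x - y) → ∀ u,
    (g * inner ℝ e (x - y) - L * ‖(x - y) - (inner ℝ e (x - y) : ℝ) • e‖) * nsq u ≤
      form (N x) u - form (N y) u

/-- Weyl's principle with a tolerance that is negative when the forms really grow. -/
theorem Growth.eigenvalues₀ {U : Set (EuclideanSpace ℝ τ)} {e : EuclideanSpace ℝ τ} {g L : ℝ}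
    {N : EuclideanSpace ℝ τ → Matrix ι ι ℂ} (h : Growth U e g L N) {x y : EuclideanSpace ℝ τ}
    (hx : x ∈ U) (hy : y ∈ U) (hxy : 0 ≤ inner ℝ e (x - y)) (Nx : (N x).IsHermitian)
    (Ny : (N y).IsHermitian) (j) :
    g * inner ℝ e (x - y) - L * ‖(x - y) - (inner ℝ e (x - y) : ℝ) • e‖ ≤
      Nx.eigenvalues₀ j - Ny.eigenvalues₀ j := by
  have := eigenvalues₀_le_of_form_le Ny Nx
    (ε := -(g * inner ℝ e (x - y) - L * ‖(x - y) - (inner ℝ e (x - y) : ℝ) • e‖))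
    (fun u => by have := h x hx y hy hxy u; linarith) j
  linarith

/-- The measure of the set of near-resonant parameters of two growing Hermitian families. -/
theorem volume_thickening_resonant_le {U : Set (EuclideanSpace ℝ τ)} {C₁ κ θ g L : ℝ}
    (hκ : 0 ≤ κ) (hg : 0 < g) (hL : 0 ≤ L) (hU : ∀ x ∈ U, ‖x‖ ≤ C₁) {e : EuclideanSpace ℝ τ}
    (he : ‖e‖ = 1) {N : EuclideanSpace ℝ τ → Matrix ι ι ℂ} {N' : EuclideanSpace ℝ τ → Matrix ι' ι' ℂ}
    (hN : ∀ x ∈ U, (N x).IsHermitian) (hN' : ∀ x ∈ U, (N' x).IsHermitian)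
    (gN : Growth U e g L N) (gN' : Growth U e g L N') :
    volume (Metric.thickening κ
      {x | x ∈ U ∧ ∃ α ∈ spectrum ℂ (N x), ∃ β ∈ spectrum ℂ (N' x), ‖α + β‖ < θ}) ≤
      Fintype.card ι * Fintype.card ι' * (ENNReal.ofReal (θ / g + (4 * (L / g) + 2) * κ) *
        ENNReal.ofReal (2 * (C₁ + κ)) ^ (Fintype.card τ - 1)) := by
  let E : Fin (Fintype.card ι) × Fin (Fintype.card ι') → Set (EuclideanSpace ℝ τ) := fun p =>
    {x | ∃ hx : x ∈ U, |(hN x hx).eigenvalues₀ p.1 + (hN' x hx).eigenvalues₀ p.2| < θ}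
  have hsub : {x | x ∈ U ∧ ∃ α ∈ spectrum ℂ (N x), ∃ β ∈ spectrum ℂ (N' x), ‖α + β‖ < θ} ⊆
      ⋃ p, E p := by
    rintro x ⟨hx, α, hα, β, hβ, hαβ⟩
    obtain ⟨i, rfl⟩ := (mem_spectrum_iff_eigenvalues₀ (hN x hx)).mp hα
    obtain ⟨j, rfl⟩ := (mem_spectrum_iff_eigenvalues₀ (hN' x hx)).mp hβ
    refine Set.mem_iUnion.mpr ⟨(i, j), hx, ?_⟩
    rwa [← Complex.ofReal_add, Complex.norm_real, Real.norm_eq_abs] at hαβ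
  refine (measure_mono (Metric.thickening_subset_of_subset κ hsub)).trans ?_
  rw [Metric.thickening_iUnion]
  refine (measure_iUnion_fintype_le _ _).trans ?_
  have hE : ∀ p, volume (Metric.thickening κ (E p)) ≤
      ENNReal.ofReal (θ / g + (4 * (L / g) + 2) * κ) *
        ENNReal.ofReal (2 * (C₁ + κ)) ^ (Fintype.card τ - 1) := by
    intro p
    refine volume_thickening_le hκ (by positivity) (fun x hx => hU x hx.1) he ?_
    rintro x ⟨hx, hxp⟩ y ⟨hy, hyp⟩ hxy
    have h1 := gN.eigenvalues₀ hx hy hxy (hN x hx) (hN y hy) p.1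
    have h2 := gN'.eigenvalues₀ hx hy hxy (hN' x hx) (hN' y hy) p.2
    have h3 := abs_lt.mp hxp
    have h4 := abs_lt.mp hyp
    generalize inner ℝ e (x - y) = s at *
    generalize ‖(x - y) - (s : ℝ) • e‖ = r at *
    -- The sum of the two eigenvalues grows at speed `2g` with transversal loss `2L`, but varies by
    -- less than `2θ` between two points of the set.
    have h5 : g * s ≤ θ + L * r := by linarith
    rw [div_mul_eq_mul_div, ← add_div, le_div_iff₀ hg]
    linarith
  refine (Finset.sum_le_sum fun p _ => hE p).trans ?_
  rw [Finset.sum_const, Finset.card_univ, Fintype.card_prod, Fintype.card_fin, Fintype.card_fin,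
    nsmul_eq_mul, Nat.cast_mul]

end Resonance

/-! ### Lipschitz bounds for quadratic forms -/

section FormLip

variable {d : ℕ} {A : Finset (Fin d → ℤ)}

/-- The quadratic forms of the finite submatrices of `P` are Lipschitz over `U`. -/
def FormLip (c : ℝ) (U : Set (Param A)) (P : Param A → Mat A) : Prop :=
  ∀ x ∈ U, ∀ y ∈ U, ∀ (ι : Type) [Fintype ι] (f : ι → Site A), Function.Injective f → ∀ u,
    |form ((P x).submatrix f f) u - form ((P y).submatrix f f) u| ≤ c * ‖x - y‖ * nsq u

/-- Extending `u` by zero outside the range of `f` gives a finitely supported vector, to which the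
operator norm applies after normalisation; Cauchy–Schwarz turns the bound on `Q u` into a bound on
the form. -/
theorem abs_form_le_of_opNorm_le {Q : Mat A} {c : ℝ} (hc : 0 ≤ c)
    (hQ : opNorm Q ≤ ENNReal.ofReal c) {ι : Type*} [Fintype ι] {f : ι → Site A}
    (hf : Function.Injective f) (u : ι → ℂ) :
    |form (Q.submatrix f f) u| ≤ c * nsq u := by
  classical
  -- the bound for vectors of norm one
  have key : ∀ u : ι → ℂ, nsq u ≤ 1 → ∑ i, ‖∑ j, Q (f i) (f j) * u j‖ ^ 2 ≤ c ^ 2 := by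
    intro u hu
    let x : Site A →₀ ℂ := (Finsupp.equivFunOnFinite.symm u).embDomain ⟨f, hf⟩
    have hsum : ∀ {M : Type} [AddCommMonoid M] (F : Site A → ℂ → M), (∀ b, F b 0 = 0) →
        ∑ b ∈ x.support, F b (x b) = ∑ i, F (f i) (u i) := by
      intro M _ F hF
      have h1 := Finsupp.sum_embDomain (f := ⟨f, hf⟩) (v := Finsupp.equivFunOnFinite.symm u) (g := F)
      have h2 := Finsupp.sum_fintype (Finsupp.equivFunOnFinite.symm u) (fun i z => F (f i) z)
        (fun i => hF _)
      exact h1.trans h2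
    have h1 : ∑ b ∈ x.support, ‖x b‖ ^ 2 ≤ 1 := by
      rw [hsum (fun _ z => ‖z‖ ^ 2) (by simp)]; exact hu
    have h2 := (le_iSup₂ (f := fun (x : Site A →₀ ℂ) (_ : ∑ b ∈ x.support, ‖x b‖ ^ 2 ≤ 1) =>
      (∑' a, ‖∑ b ∈ x.support, Q a b * x b‖ₑ ^ 2) ^ (1 / 2 : ℝ)) x h1).trans hQ
    have h3 : ∑ i, ‖∑ j, Q (f i) (f j) * u j‖ₑ ^ 2 ≤
        ∑' a, ‖∑ b ∈ x.support, Q a b * x b‖ₑ ^ 2 := by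
      rw [← tsum_fintype (L := SummationFilter.unconditional _)]
      refine le_trans (le_of_eq ?_) (ENNReal.tsum_comp_le_tsum_of_injective hf _)
      refine tsum_congr fun i => ?_
      rw [hsum (fun b z => Q (f i) b * z) (by simp)]
    have h4 : ∑ i, ‖∑ j, Q (f i) (f j) * u j‖ₑ ^ 2 ≤ ENNReal.ofReal (c ^ 2) := by
      refine h3.trans ?_
      have := ENNReal.rpow_le_rpow h2 (z := 2) (by norm_num)
      rw [← ENNReal.rpow_mul] at this
      norm_num at this
      rw [ENNReal.ofReal_pow hc]
      exact this
    have h5 : ENNReal.ofReal (∑ i, ‖∑ j, Q (f i) (f j) * u j‖ ^ 2) ≤ ENNReal.ofReal (c ^ 2) := by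
      rw [ENNReal.ofReal_sum_of_nonneg (fun _ _ => sq_nonneg _)]
      refine le_trans (le_of_eq (Finset.sum_congr rfl fun i _ => ?_)) h4
      rw [ENNReal.ofReal_pow (norm_nonneg _), ofReal_norm]
    exact (ENNReal.ofReal_le_ofReal_iff (sq_nonneg c)).mp h5
  -- homogeneity
  have key2 : ∑ i, ‖∑ j, Q (f i) (f j) * u j‖ ^ 2 ≤ c ^ 2 * nsq u := by
    rcases (nsq_nonneg u).eq_or_lt with h0 | hpos
    · have hu : ∀ i, u i = 0 := by
        intro i
        have := (Finset.sum_eq_zero_iff_of_nonneg (fun i _ => sq_nonneg ‖u i‖)).mp h0.symm i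
          (Finset.mem_univ i)
        simpa using this
      simp [hu, nsq]
    · set r := Real.sqrt (nsq u) with hr
      have hr0 : 0 < r := Real.sqrt_pos.mpr hpos
      have hr2 : r ^ 2 = nsq u := Real.sq_sqrt hpos.le
      have h1 := key (fun i => ((r⁻¹ : ℝ) : ℂ) * u i) (by
        simp only [nsq, norm_mul, mul_pow, ← Finset.mul_sum]
        rw [Complex.norm_real, norm_inv, Real.norm_of_nonneg hr0.le]
        change r⁻¹ ^ 2 * nsq u ≤ 1
        rw [← hr2, ← mul_pow, inv_mul_cancel₀ hr0.ne', one_pow])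
      have h2 : ∀ i, ‖∑ j, Q (f i) (f j) * (((r⁻¹ : ℝ) : ℂ) * u j)‖ ^ 2 =
          r⁻¹ ^ 2 * ‖∑ j, Q (f i) (f j) * u j‖ ^ 2 := by
        intro i
        have : ∑ j, Q (f i) (f j) * (((r⁻¹ : ℝ) : ℂ) * u j) =
            ((r⁻¹ : ℝ) : ℂ) * ∑ j, Q (f i) (f j) * u j := by
          rw [Finset.mul_sum]; exact Finset.sum_congr rfl fun j _ => by ring
        rw [this, norm_mul, mul_pow, Complex.norm_real, norm_inv, Real.norm_of_nonneg hr0.le]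
      simp only [h2, ← Finset.mul_sum] at h1
      rw [inv_pow, hr2] at h1
      rw [inv_mul_le_iff₀ hpos] at h1
      linarith
  have h1 : |form (Q.submatrix f f) u| ≤ ∑ i, ‖u i‖ * ‖∑ j, Q (f i) (f j) * u j‖ := by
    refine (Complex.abs_re_le_norm _).trans ((norm_sum_le _ _).trans (Finset.sum_le_sum fun i _ => ?_))
    simp only [mul_assoc, ← Finset.mul_sum, norm_mul, norm_star, Matrix.submatrix_apply]
    exact le_rfl
  refine h1.trans (abs_le_of_sq_le_sq' ?_ (mul_nonneg hc (nsq_nonneg u))).2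
  refine (Finset.sum_mul_sq_le_sq_mul_sq _ _ _).trans ?_
  have := mul_le_mul_of_nonneg_left key2 (nsq_nonneg u)
  calc _ ≤ nsq u * (c ^ 2 * nsq u) := this
    _ = _ := by ring

/-- Mean value theorem along a segment in `B` for the scalar function `ω ↦ u* H(ω) u`, whose
derivative is the form of `derivMat`. The conclusion involves no derivative, which is what lets it
survive Töplitz limits. -/
theorem formLip_of_opNorm_derivMat_le {B : Set (Param A)} (hB : IsOpen B) (hBc : Convex ℝ B)
    {H : Param A → Mat A} (hH : ∀ a b, ContDiffOn ℝ 1 (fun ω => H ω a b) B) {c : ℝ} (hc : 0 ≤ c)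
    (hop : ∀ ω ∈ B, ∀ v : Param A, ‖v‖ ≤ 1 → opNorm (derivMat H ω v) ≤ ENNReal.ofReal c) :
    FormLip c B H := by
  intro x hx y hy ι _ f hf u
  have hd : ∀ ω ∈ B, ∀ a b, HasFDerivAt (fun w => H w a b) (fderiv ℝ (fun w => H w a b) ω) ω :=
    fun ω hω a b =>
      (((hH a b).differentiableOn one_ne_zero).differentiableAt (hB.mem_nhds hω)).hasFDerivAt
  let F' : Param A → (Param A →L[ℝ] ℝ) := fun ω => Complex.reCLM.comp
    (∑ i, ∑ j, u j • star (u i) • fderiv ℝ (fun w => H w (f i) (f j)) ω)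
  have hF : ∀ ω ∈ B, HasFDerivWithinAt (fun w => form ((H w).submatrix f f) u) (F' ω) B ω := by
    intro ω hω
    refine HasFDerivAt.hasFDerivWithinAt ?_
    refine Complex.reCLM.hasFDerivAt.comp ω (HasFDerivAt.fun_sum fun i _ =>
      HasFDerivAt.fun_sum fun j _ => ?_)
    exact ((hd ω hω (f i) (f j)).const_mul (star (u i))).mul_const (u j)
  have hF' : ∀ ω v, F' ω v = form ((derivMat H ω v).submatrix f f) u := by
    intro ω v
    simp only [F', form, ContinuousLinearMap.comp_apply, Complex.reCLM_apply,
      sum_apply, smul_apply, smul_eq_mul,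
      Matrix.submatrix_apply, derivMat]
    congr 1
    exact Finset.sum_congr rfl fun i _ => Finset.sum_congr rfl fun j _ => by ring
  obtain ⟨z, hz, hzeq⟩ := domain_mvt hF hBc hy hx
  have hzB : z ∈ B := hBc.segment_subset hy hx hz
  rw [hzeq]
  rcases eq_or_ne (x - y) 0 with h0 | h0
  · simp [h0]
  have hn : ‖x - y‖ ≠ 0 := norm_ne_zero_iff.mpr h0
  have h1 : F' z (x - y) = ‖x - y‖ * F' z (‖x - y‖⁻¹ • (x - y)) := by
    rw [map_smul, smul_eq_mul, mul_inv_cancel_left₀ hn]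
  rw [h1, abs_mul, abs_norm, hF']
  have h2 := abs_form_le_of_opNorm_le hc (hop z hzB (‖x - y‖⁻¹ • (x - y)) (by
    rw [norm_smul, norm_inv, norm_norm, inv_mul_cancel₀ hn])) hf u
  calc _ ≤ ‖x - y‖ * (c * nsq u) := by gcongr
    _ = _ := by ring

/-- Speed of `½⟨k,ω⟩ ± Ω_a(ω)` in the direction of `k`. -/
theorem Transversal.half_le {B : Set (Param A)} (hB : IsOpen B) {Ω : Param A → Site A → ℝ}
    (hΩ : ∀ a, ContDiffOn ℝ 1 (fun ω => Ω ω a) B) {C₄ : ℝ} (hT : Transversal C₄ B Ω)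
    {k : {a : Fin d → ℤ // a ∈ A} → ℤ} (hk : k ≠ 0) {ω : Param A} (hω : ω ∈ B) (a : Site A) :
    C₄ / 2 ≤ ‖vec k‖ / 2 + fderiv ℝ (fun w => Ω w a) ω (‖vec k‖⁻¹ • vec k) ∧
    C₄ / 2 ≤ ‖vec k‖ / 2 - fderiv ℝ (fun w => Ω w a) ω (‖vec k‖⁻¹ • vec k) := by
  have hd : HasFDerivAt (fun w => Ω w a) (fderiv ℝ (fun w => Ω w a) ω) ω :=
    (((hΩ a).differentiableOn one_ne_zero).differentiableAt (hB.mem_nhds hω)).hasFDerivAt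
  -- Transversality of sums with `b = a`; the vectors `k` and `-k` give the two signs.
  have key : ∀ k : {a : Fin d → ℤ // a ∈ A} → ℤ, k ≠ 0 →
      C₄ ≤ ‖vec k‖ + 2 * fderiv ℝ (fun w => Ω w a) ω (‖vec k‖⁻¹ • vec k) := by
    intro k hk
    have h := (hT k hk ω hω a a).2.1
    have h1 : HasFDerivAt (fun w => inner ℝ (vec k) w + Ω w a + Ω w a)
        (innerSL ℝ (vec k) + fderiv ℝ (fun w => Ω w a) ω + fderiv ℝ (fun w => Ω w a) ω) ω :=
      (((innerSL ℝ (vec k)).hasFDerivAt).add hd).add hd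
    rw [h1.fderiv] at h
    have hv : ‖vec k‖ ≠ 0 := by
      rw [norm_ne_zero_iff]
      intro h0
      apply hk
      funext i
      have := congrArg (fun v : Param A => v i) h0
      simpa [vec] using this
    simp only [add_apply, innerSL_apply_apply, inner_smul_right,
      real_inner_self_eq_norm_sq] at h
    have : ‖vec k‖⁻¹ * ‖vec k‖ ^ 2 = ‖vec k‖ := by field_simp
    rw [this] at h
    linarith
  have hneg : vec (-k) = -vec k := by
    ext i; simp [vec]
  have h1 := key k hk
  have h2 := key (-k) (neg_ne_zero.mpr hk)
  rw [hneg, norm_neg, smul_neg, map_neg] at h2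
  constructor <;> linarith

end FormLip

/-! ### Measure of the resonances of one pair of families -/

section PairMeasure

variable {d : ℕ} {A : Finset (Fin d → ℤ)}

theorem vec_ne_zero {ι : Type*} [Fintype ι] {k : ι → ℤ} (hk : k ≠ 0) : vec k ≠ 0 := by
  intro h0
  apply hk
  funext i
  have := congrArg (fun v : EuclideanSpace ℝ ι => v i) h0
  simpa [vec] using this

/-- The unit vector `k / |k|`. -/
noncomputable def dir {ι : Type*} [Fintype ι] (k : ι → ℤ) : EuclideanSpace ℝ ι :=
  ‖vec k‖⁻¹ • vec k

theorem norm_dir {ι : Type*} [Fintype ι] {k : ι → ℤ} (hk : k ≠ 0) : ‖dir k‖ = 1 := by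
  rw [dir, norm_smul, norm_inv, norm_norm, inv_mul_cancel₀ (norm_ne_zero_iff.mpr (vec_ne_zero hk))]

theorem norm_mul_inner_dir {ι : Type*} [Fintype ι] {k : ι → ℤ} (hk : k ≠ 0)
    (v : EuclideanSpace ℝ ι) : ‖vec k‖ * inner ℝ (dir k) v = inner ℝ (vec k) v := by
  rw [dir, real_inner_smul_left, mul_inv_cancel_left₀ (norm_ne_zero_iff.mpr (vec_ne_zero hk))]

theorem form_scalar {ι : Type*} [Fintype ι] [DecidableEq ι] (r : ℝ) (u : ι → ℂ) :
    form (Matrix.diagonal fun _ : ι => (r : ℂ)) u = r * nsq u := by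
  rw [form_diagonal, nsq, Finset.mul_sum]

theorem form_ofReal_smul {ι : Type*} [Fintype ι] (r : ℝ) (M : Matrix ι ι ℂ) (u : ι → ℂ) :
    form ((r : ℂ) • M) u = r * form M u := by
  rw [form, form, ← Complex.re_ofReal_mul, Finset.mul_sum]
  congr 1
  refine Finset.sum_congr rfl fun i _ => ?_
  rw [Finset.mul_sum]
  refine Finset.sum_congr rfl fun j _ => ?_
  simp only [Matrix.smul_apply, smul_eq_mul]
  ring

/-- The families whose eigenvalues enter the resonance conditions: `½⟨k,ω⟩ ± M(ω)`. -/
noncomputable def shifted {ι : Type*} [DecidableEq ι]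
    (k : {a : Fin d → ℤ // a ∈ A} → ℤ) (m σ : ℝ) (M : Param A → Matrix ι ι ℂ) (ω : Param A) :
    Matrix ι ι ℂ :=
  Matrix.diagonal (fun _ => ((inner ℝ (vec k) ω / 2 + m : ℝ) : ℂ)) + (σ : ℂ) • M ω

theorem form_shifted_sub {ι : Type*} [Fintype ι] [DecidableEq ι]
    (k : {a : Fin d → ℤ // a ∈ A} → ℤ) (m σ : ℝ) (M : Param A → Matrix ι ι ℂ) (x y : Param A)
    (u : ι → ℂ) : form (shifted k m σ M x) u - form (shifted k m σ M y) u =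
      inner ℝ (vec k) (x - y) / 2 * nsq u + σ * (form (M x) u - form (M y) u) := by
  simp only [shifted, form_add, form_scalar, form_ofReal_smul, inner_sub_right]
  ring

theorem norm_le_inner_dir_add {ι : Type*} [Fintype ι] {k : ι → ℤ} (hk : k ≠ 0)
    (v : EuclideanSpace ℝ ι) (hv : 0 ≤ inner ℝ (dir k) v) :
    ‖v‖ ≤ inner ℝ (dir k) v + ‖v - (inner ℝ (dir k) v : ℝ) • dir k‖ := by
  calc ‖v‖ = ‖(inner ℝ (dir k) v : ℝ) • dir k + (v - (inner ℝ (dir k) v : ℝ) • dir k)‖ := by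
        congr 1; abel
    _ ≤ ‖(inner ℝ (dir k) v : ℝ) • dir k‖ + _ := norm_add_le _ _
    _ = _ := by rw [norm_smul, norm_dir hk, mul_one, Real.norm_of_nonneg hv]

theorem abs_sign_mul_le {σ x c : ℝ} (hσ : σ = 1 ∨ σ = -1) (hx : |x| ≤ c) : -c ≤ σ * x := by
  have := abs_le.mp hx
  rcases hσ with rfl | rfl <;> linarith

/-- Growth of a form-Lipschitz family. -/
theorem FormLip.growth {U : Set (Param A)} {P : Param A → Mat A} {C₄ : ℝ} (hC₄ : 0 < C₄)
    (C₂ : ℝ) (hP : FormLip (C₄ / 4) U P) {k : {a : Fin d → ℤ // a ∈ A} → ℤ} (hk : k ≠ 0)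
    (hkC : C₄ ≤ ‖vec k‖) {ι : Type} [Fintype ι] [DecidableEq ι] {f : ι → Site A}
    (hf : Function.Injective f) (m : ℝ) {σ : ℝ} (hσ : σ = 1 ∨ σ = -1) :
    Growth U (dir k) (C₄ / 4) (|C₂| + C₄ / 4)
      (shifted k m σ fun ω => (P ω).submatrix f f) := by
  intro x hx y hy hxy u
  rw [form_shifted_sub, ← norm_mul_inner_dir hk]
  have h1 := abs_sign_mul_le hσ (hP x hx y hy ι f hf u)
  have h2 := norm_le_inner_dir_add hk _ hxy
  have hr := norm_nonneg (x - y - (inner ℝ (dir k) (x - y) : ℝ) • dir k)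
  generalize inner ℝ (dir k) (x - y) = s at *
  generalize ‖x - y - s • dir k‖ = r at *
  have hr0 : 0 ≤ |C₂| * r := mul_nonneg (abs_nonneg _) hr
  have hu := nsq_nonneg u
  have h3 : C₄ / 4 * ‖x - y‖ ≤ C₄ / 4 * (s + r) := by gcongr
  have h4 : C₄ * s ≤ ‖vec k‖ * s := by gcongr
  -- Since `|k| ≥ C₄`, the scalar part has speed at least `C₄/2`, half of which is lost to the
  -- Lipschitz constant of `P`. The term `|C₂|` is padding, so that limits and blocks share the same
  -- growth constants.
  have h5 : C₄ / 4 * s - (|C₂| + C₄ / 4) * r ≤ ‖vec k‖ * s / 2 - C₄ / 4 * ‖x - y‖ := by linarith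
  have := mul_le_mul_of_nonneg_right h5 hu
  linarith

/-- Growth of `½⟨k,ω⟩ ± (Ω + H)(ω)`. -/
theorem growth_hamMat {B : Set (Param A)} (hB : IsOpen B) (hBc : Convex ℝ B)
    {Ω : Param A → Site A → ℝ} {H : Param A → Mat A}
    (hΩ : ∀ a, ContDiffOn ℝ 1 (fun ω => Ω ω a) B) {C₂ C₃ C₄ : ℝ} (hC₃ : 0 < C₃) (hC₄ : 0 < C₄)
    (hcl : CloseToSquares C₂ C₃ B Ω) (hT : Transversal C₄ B Ω) (hH : FormLip (C₄ / 4) B H)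
    {k : {a : Fin d → ℤ // a ∈ A} → ℤ} (hk : k ≠ 0)
    {ι : Type} [Fintype ι] [DecidableEq ι] {f : ι → Site A}
    (hf : Function.Injective f) (m : ℝ) {σ : ℝ} (hσ : σ = 1 ∨ σ = -1) :
    Growth B (dir k) (C₄ / 4) (|C₂| + C₄ / 4)
      (shifted k m σ fun ω => (hamMat Ω H ω).submatrix f f) := by
  intro x hx y hy hxy u
  -- The displacement is split along and across `k`: transversality governs the first part, the
  -- bound `|C₂|` on the gradient of `Ω_a` the second.
  have hscal : ∀ a : Site A, C₄ / 2 * inner ℝ (dir k) (x - y) -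
      |C₂| * ‖x - y - (inner ℝ (dir k) (x - y) : ℝ) • dir k‖ ≤
      ‖vec k‖ * inner ℝ (dir k) (x - y) / 2 + σ * (Ω x a - Ω y a) := by
    intro a
    have hd : ∀ ω ∈ B, HasFDerivWithinAt (fun w => Ω w a) (fderiv ℝ (fun w => Ω w a) ω) B ω :=
      fun ω hω => ((((hΩ a).differentiableOn one_ne_zero).differentiableAt
        (hB.mem_nhds hω)).hasFDerivAt).hasFDerivWithinAt
    obtain ⟨z, hz, hzeq⟩ := domain_mvt hd hBc hy hx
    have hzB : z ∈ B := hBc.segment_subset hy hx hz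
    have h1 := hT.half_le hB hΩ hk hzB a
    have h2 := (hcl a z hzB).2
    rw [fderiv_sub_const] at h2
    have h3 : ‖fderiv ℝ (fun w => Ω w a) z‖ ≤ |C₂| := by
      refine h2.trans ?_
      have h4 : Real.exp (-C₃ * ‖vec a.1‖) ≤ 1 := by
        rw [Real.exp_le_one_iff]
        have := mul_nonneg hC₃.le (norm_nonneg (vec a.1))
        linarith
      calc _ ≤ |C₂| * Real.exp (-C₃ * ‖vec a.1‖) := by gcongr; exact le_abs_self _
        _ ≤ |C₂| * 1 := by gcongr
        _ = _ := mul_one _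
    rw [hzeq]
    change _ ≤ ‖vec k‖ / 2 + fderiv ℝ (fun w => Ω w a) z (dir k) ∧
      _ ≤ ‖vec k‖ / 2 - fderiv ℝ (fun w => Ω w a) z (dir k) at h1
    have h5 : fderiv ℝ (fun w => Ω w a) z (x - y) =
        inner ℝ (dir k) (x - y) * fderiv ℝ (fun w => Ω w a) z (dir k) +
        fderiv ℝ (fun w => Ω w a) z (x - y - (inner ℝ (dir k) (x - y) : ℝ) • dir k) := by
      rw [map_sub _ (x - y) (_ • _), map_smul, smul_eq_mul]; ring
    have h6 : |fderiv ℝ (fun w => Ω w a) z (x - y - (inner ℝ (dir k) (x - y) : ℝ) • dir k)| ≤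
        |C₂| * ‖x - y - (inner ℝ (dir k) (x - y) : ℝ) • dir k‖ :=
      (ContinuousLinearMap.le_opNorm _ _).trans (mul_le_mul_of_nonneg_right h3 (norm_nonneg _))
    have h7 := abs_sign_mul_le hσ h6
    rw [h5]
    generalize fderiv ℝ (fun w => Ω w a) z (dir k) = p at *
    have h8 : C₄ / 2 ≤ ‖vec k‖ / 2 + σ * p := by
      rcases hσ with rfl | rfl <;> linarith [h1.1, h1.2]
    have h9 := mul_le_mul_of_nonneg_right h8 hxy
    linarith
  have hform : form ((hamMat Ω H x).submatrix f f) u - form ((hamMat Ω H y).submatrix f f) u =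
      ∑ i, (Ω x (f i) - Ω y (f i)) * ‖u i‖ ^ 2 +
      (form ((H x).submatrix f f) u - form ((H y).submatrix f f) u) := by
    have : ∀ ω, (hamMat Ω H ω).submatrix f f =
        Matrix.diagonal (fun i => ((Ω ω (f i) : ℝ) : ℂ)) + (H ω).submatrix f f := by
      intro ω
      ext i j
      simp [hamMat, Matrix.diagonal_apply, hf.eq_iff]
    rw [this, this, form_add, form_add, form_diagonal, form_diagonal]
    simp only [sub_mul, Finset.sum_sub_distrib]
    ring
  rw [form_shifted_sub, ← norm_mul_inner_dir hk, hform]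
  have h1 := abs_sign_mul_le hσ (hH x hx y hy ι f hf u)
  have h2 := norm_le_inner_dir_add hk _ hxy
  generalize inner ℝ (dir k) (x - y) = s at *
  have hu := nsq_nonneg u
  have h3 : C₄ / 4 * ‖x - y‖ * nsq u ≤ C₄ / 4 * (s + ‖x - y - s • dir k‖) * nsq u := by gcongr
  have h4 : (C₄ / 2 * s - |C₂| * ‖x - y - s • dir k‖) * nsq u ≤
      ‖vec k‖ * s / 2 * nsq u + σ * ∑ i, (Ω x (f i) - Ω y (f i)) * ‖u i‖ ^ 2 := by
    simp only [nsq, Finset.mul_sum, ← Finset.sum_add_distrib]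
    refine Finset.sum_le_sum fun i _ => ?_
    have := mul_le_mul_of_nonneg_right (hscal (f i)) (sq_nonneg ‖u i‖)
    linarith
  linarith

/-- The geometric constant in the measure estimates. -/
noncomputable def slabConst (n : ℕ) (C₂ C₄ : ℝ) : ℝ :=
  (1 / (C₄ / 4) + (4 * ((|C₂| + C₄ / 4) / (C₄ / 4)) + 2)) * 4 ^ (n - 1)

theorem slabConst_pos (n : ℕ) (C₂ : ℝ) {C₄ : ℝ} (h : 0 < C₄) : 0 < slabConst n C₂ C₄ := by
  unfold slabConst; positivity

/-- The parameters for which two families of matrices are nearly resonant. -/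
def resonantSet {ι ι' : Type} [Fintype ι] [Fintype ι'] [DecidableEq ι] [DecidableEq ι']
    (U : Set (Param A)) (k : {a : Fin d → ℤ // a ∈ A} → ℤ) (m θ : ℝ)
    (M : Param A → Matrix ι ι ℂ) (M' : Param A → Matrix ι' ι' ℂ) : Set (Param A) :=
  {ω | ω ∈ U ∧ ∃ α ∈ spectrum ℂ (M ω), ∃ β ∈ spectrum ℂ (M' ω),
    ‖((inner ℝ (vec k) ω + m : ℝ) : ℂ) + α - β‖ < θ}

/-- The quantity `⟨k,ω⟩ + m + α - β` is an eigenvalue of `½⟨k,ω⟩ + m + M` plus one of `½⟨k,ω⟩ - M'`.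
Splitting `⟨k,ω⟩` evenly turns a difference of spectra into a sum of two growing ones. -/
theorem volume_thickening_resonantSet_le {U : Set (Param A)} {C₁ C₂ C₄ κ θ : ℝ} (hκ : 0 ≤ κ)
    (hκ1 : κ ≤ 1) (hC₁ : 1 ≤ C₁) (hκθ : κ ≤ θ) (hC₄ : 0 < C₄) (hU : ∀ x ∈ U, ‖x‖ ≤ C₁)
    {k : {a : Fin d → ℤ // a ∈ A} → ℤ} (hk : k ≠ 0) (m : ℝ)
    {ι ι' : Type} [Fintype ι] [Fintype ι'] [DecidableEq ι] [DecidableEq ι']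
    {M : Param A → Matrix ι ι ℂ} {M' : Param A → Matrix ι' ι' ℂ}
    (hM : ∀ ω ∈ U, (M ω).IsHermitian) (hM' : ∀ ω ∈ U, (M' ω).IsHermitian)
    (gM : Growth U (dir k) (C₄ / 4) (|C₂| + C₄ / 4) (shifted k m 1 M))
    (gM' : Growth U (dir k) (C₄ / 4) (|C₂| + C₄ / 4) (shifted k 0 (-1) M'))
    {N : ℝ} (hN : (Fintype.card ι : ℝ) ≤ N) (hN' : (Fintype.card ι' : ℝ) ≤ N) :
    volume (Metric.thickening κ (resonantSet U k m θ M M')) ≤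
      ENNReal.ofReal (N ^ 2 * slabConst A.card C₂ C₄ * θ) * ENNReal.ofReal C₁ ^ (A.card - 1) := by
  have hsh : ∀ {η : Type} [Fintype η] [DecidableEq η] (m σ : ℝ) (M : Param A → Matrix η η ℂ),
      ∀ ω, (M ω).IsHermitian → (shifted k m σ M ω).IsHermitian := by
    intro η _ _ m σ M ω h
    refine Matrix.IsHermitian.add ?_ ?_
    · ext i j
      rcases eq_or_ne i j with rfl | hij
      · simp
      · simp [Matrix.diagonal_apply_ne _ hij, Matrix.diagonal_apply_ne _ hij.symm]
    · rw [Matrix.IsHermitian, Matrix.conjTranspose_smul, h.eq]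
      simp
  have hsub : resonantSet U k m θ M M' ⊆ {x | x ∈ U ∧ ∃ α ∈ spectrum ℂ (shifted k m 1 M x),
      ∃ β ∈ spectrum ℂ (shifted k 0 (-1) M' x), ‖α + β‖ < θ} := by
    rintro ω ⟨hω, α, hα, β, hβ, h⟩
    refine ⟨hω, ((inner ℝ (vec k) ω / 2 + m : ℝ) : ℂ) + α, ?_,
      ((inner ℝ (vec k) ω / 2 + 0 : ℝ) : ℂ) + -β, ?_, ?_⟩
    · have : shifted k m 1 M ω =
          algebraMap ℂ _ ((inner ℝ (vec k) ω / 2 + m : ℝ) : ℂ) + M ω := by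
        simp [shifted, Matrix.algebraMap_eq_diagonal, Pi.algebraMap_def]
      rw [this, add_comm _ α]
      exact (spectrum.add_mem_add_iff).mpr hα
    · have : shifted k 0 (-1) M' ω =
          algebraMap ℂ _ ((inner ℝ (vec k) ω / 2 + 0 : ℝ) : ℂ) + -M' ω := by
        simp [shifted, Matrix.algebraMap_eq_diagonal, Pi.algebraMap_def]
      rw [this, add_comm _ (-β)]
      refine (spectrum.add_mem_add_iff).mpr ?_
      rw [← spectrum.neg_eq]
      simpa using hβ
    · convert h using 2
      push_cast
      ring
  refine (measure_mono (Metric.thickening_subset_of_subset κ hsub)).trans ?_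
  refine (volume_thickening_resonant_le hκ (by positivity) (by positivity) hU (norm_dir hk)
    (fun ω hω => hsh m 1 M ω (hM ω hω)) (fun ω hω => hsh 0 (-1) M' ω (hM' ω hω)) gM gM').trans ?_
  have hcard : Fintype.card {a : Fin d → ℤ // a ∈ A} = A.card := Fintype.card_coe A
  have hN0 : 0 ≤ N := (Nat.cast_nonneg _).trans hN
  have hθ : 0 ≤ θ := hκ.trans hκθ
  rw [hcard]
  have e1 : (Fintype.card ι : ℝ≥0∞) ≤ ENNReal.ofReal N := by
    rw [← ENNReal.ofReal_natCast]; exact ENNReal.ofReal_le_ofReal hN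
  have e2 : (Fintype.card ι' : ℝ≥0∞) ≤ ENNReal.ofReal N := by
    rw [← ENNReal.ofReal_natCast]; exact ENNReal.ofReal_le_ofReal hN'
  set L := |C₂| + C₄ / 4 with hL
  have hLpos : 0 ≤ L := by positivity
  -- As `κ ≤ θ`, the cost of passing to the neighbourhood is absorbed in the width `θ`; below, `κ ≤
  -- 1 ≤ C₁` gives `2(C₁ + κ) ≤ 4C₁`.
  have e3 : θ / (C₄ / 4) + (4 * (L / (C₄ / 4)) + 2) * κ ≤
      (1 / (C₄ / 4) + (4 * (L / (C₄ / 4)) + 2)) * θ := by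
    have : (4 * (L / (C₄ / 4)) + 2) * κ ≤ (4 * (L / (C₄ / 4)) + 2) * θ := by gcongr
    have h' : θ / (C₄ / 4) = 1 / (C₄ / 4) * θ := by ring
    linarith
  have e4 : ENNReal.ofReal (2 * (C₁ + κ)) ^ (A.card - 1) ≤
      ENNReal.ofReal (4 ^ (A.card - 1)) * ENNReal.ofReal C₁ ^ (A.card - 1) := by
    rw [ENNReal.ofReal_pow (by norm_num), ← mul_pow, ← ENNReal.ofReal_mul (by norm_num)]
    exact pow_le_pow_left' (ENNReal.ofReal_le_ofReal (by linarith)) _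
  calc _ ≤ ENNReal.ofReal N * ENNReal.ofReal N *
        (ENNReal.ofReal ((1 / (C₄ / 4) + (4 * (L / (C₄ / 4)) + 2)) * θ) *
        (ENNReal.ofReal (4 ^ (A.card - 1)) * ENNReal.ofReal C₁ ^ (A.card - 1))) := by
        gcongr
    _ = _ := by
        rw [← mul_assoc, ← mul_assoc, ← ENNReal.ofReal_mul hN0, ← ENNReal.ofReal_mul (by positivity),
          ← ENNReal.ofReal_mul (by positivity)]
        congr 2
        rw [slabConst, ← hL]
        ring

end PairMeasure

/-! ### Integer vectors and Diophantine approximation -/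

section Lattice

variable {ι : Type*}

theorem vec_add (a b : ι → ℤ) : vec (a + b) = vec a + vec b := by
  ext i; simp [vec]

theorem vec_sub (a b : ι → ℤ) : vec (a - b) = vec a - vec b := by
  ext i; simp [vec]

theorem vec_neg (a : ι → ℤ) : vec (-a) = -vec a := by
  ext i; simp [vec]

theorem vec_zero : vec (0 : ι → ℤ) = 0 := by
  ext i; simp [vec]

theorem vec_zsmul (t : ℤ) (a : ι → ℤ) : vec (t • a) = (t : ℝ) • vec a := by
  ext i; simp [vec]

variable [Fintype ι]

theorem inner_vec (a b : ι → ℤ) : inner ℝ (vec a) (vec b) = ((∑ i, a i * b i : ℤ) : ℝ) := by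
  rw [PiLp.inner_apply]
  push_cast
  exact Finset.sum_congr rfl fun i _ => by simp [vec, mul_comm]

theorem one_le_abs_inner_vec {a b : ι → ℤ} (h : inner ℝ (vec a) (vec b) ≠ 0) :
    1 ≤ |inner ℝ (vec a) (vec b)| := by
  rw [inner_vec] at h ⊢
  rw [← Int.cast_abs, ← Int.cast_one, Int.cast_le]
  exact Int.one_le_abs (by exact_mod_cast h)

theorem one_le_norm_vec {a : ι → ℤ} (h : a ≠ 0) : 1 ≤ ‖vec a‖ := by
  have h1 := one_le_abs_inner_vec (a := a) (b := a) (inner_self_ne_zero.mpr (vec_ne_zero h))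
  rw [real_inner_self_eq_norm_sq, abs_of_nonneg (sq_nonneg _)] at h1
  exact (one_le_sq_iff₀ (norm_nonneg _)).mp h1

theorem abs_apply_le_norm_vec (a : ι → ℤ) (i : ι) : |(a i : ℝ)| ≤ ‖vec a‖ :=
  PiLp.norm_apply_le (vec a) i

theorem norm_vec_le_of_forall {a : ι → ℤ} {r : ℝ} (hr : 0 ≤ r) (h : ∀ i, |(a i : ℝ)| ≤ r) :
    ‖vec a‖ ≤ Fintype.card ι * r := by
  rcases isEmpty_or_nonempty ι with hι | hι
  · rw [Subsingleton.elim (vec a) 0]; simp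
  rw [EuclideanSpace.norm_eq]
  refine Real.sqrt_le_iff.mpr ⟨by positivity, ?_⟩
  calc ∑ i, ‖vec a i‖ ^ 2 ≤ ∑ _i : ι, r ^ 2 := by
        refine Finset.sum_le_sum fun i _ => pow_le_pow_left₀ (norm_nonneg _) (h i) 2
    _ = Fintype.card ι * r ^ 2 := by simp
    _ ≤ (Fintype.card ι : ℝ) ^ 2 * r ^ 2 := by
        gcongr
        exact_mod_cast Nat.le_self_pow two_ne_zero _
    _ = _ := by ring

/-- The integer points of the cube of radius `ρ` about the origin. -/
noncomputable def cube (ι : Type*) [Fintype ι] (ρ : ℝ) : Finset (ι → ℤ) := by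
  classical exact Fintype.piFinset fun _ => Finset.Icc (-⌊ρ⌋) ⌊ρ⌋

theorem mem_cube {ρ : ℝ} {a : ι → ℤ} (h : ‖vec a‖ ≤ ρ) : a ∈ cube ι ρ := by
  classical
  rw [cube, Fintype.mem_piFinset]
  intro i
  have h1 := abs_le.mp ((abs_apply_le_norm_vec a i).trans h)
  rw [Finset.mem_Icc]
  constructor
  · rw [neg_le, Int.le_floor]; push_cast; linarith
  · rw [Int.le_floor]; exact h1.2

theorem card_cube_le {ρ : ℝ} (hρ : 1 ≤ ρ) : ((cube ι ρ).card : ℝ) ≤ (3 * ρ) ^ Fintype.card ι := by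
  classical
  rw [cube, Fintype.card_piFinset, Finset.prod_const, Finset.card_univ, Int.card_Icc]
  push_cast
  gcongr
  have h0 : 0 ≤ ⌊ρ⌋ := Int.floor_nonneg.mpr (by linarith)
  have h1 : ((⌊ρ⌋ + 1 - -⌊ρ⌋).toNat : ℤ) = 2 * ⌊ρ⌋ + 1 := by omega
  have h2 : (((⌊ρ⌋ + 1 - -⌊ρ⌋).toNat : ℤ) : ℝ) = 2 * ⌊ρ⌋ + 1 := by rw [h1]; push_cast; ring
  rw [Int.cast_natCast] at h2
  rw [h2]
  have := Int.floor_le ρ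
  linarith

/-- Simultaneous Diophantine approximation. -/
theorem exists_simultaneous_approx (x : ι → ℝ) {N : ℕ} (hN : 0 < N) :
    ∃ q : ℕ, 0 < q ∧ q ≤ N ^ Fintype.card ι ∧ ∃ c : ι → ℤ, ∀ i, |q * x i - c i| ≤ 1 / N := by
  classical
  have hNr : (0 : ℝ) < N := by exact_mod_cast hN
  -- Dirichlet's pigeonhole: `N^card + 1` multiples of `x` fall into `N^card` boxes of side `1/N`
  -- modulo `1`.
  let f : ℕ → ι → ℤ := fun q i => ⌊N * Int.fract (q * x i)⌋
  have hmaps : ∀ q ∈ Finset.range (N ^ Fintype.card ι + 1),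
      f q ∈ Fintype.piFinset fun _ : ι => Finset.Ico (0 : ℤ) N := by
    intro q _
    rw [Fintype.mem_piFinset]
    intro i
    rw [Finset.mem_Ico]
    refine ⟨Int.floor_nonneg.mpr (mul_nonneg hNr.le (Int.fract_nonneg _)), ?_⟩
    rw [Int.floor_lt]
    have := Int.fract_lt_one (q * x i)
    push_cast
    nlinarith
  obtain ⟨p, hp, q, hq, hpq, hf⟩ := Finset.exists_ne_map_eq_of_card_lt_of_maps_to
    (by rw [Fintype.card_piFinset]; simp) hmaps
  wlog hlt : p < q generalizing p q
  · exact this q hq p hp hpq.symm hf.symm (by omega)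
  refine ⟨q - p, by omega, by simp at hq; omega, fun i => ⌊q * x i⌋ - ⌊p * x i⌋, fun i => ?_⟩
  have h1 : (((q - p : ℕ) : ℝ) * x i - ((⌊q * x i⌋ - ⌊p * x i⌋ : ℤ) : ℝ)) =
      Int.fract (q * x i) - Int.fract (p * x i) := by
    rw [Nat.cast_sub hlt.le]
    simp only [Int.fract]
    push_cast
    ring
  rw [h1, le_div_iff₀ hNr]
  have h2 : ⌊N * Int.fract (p * x i)⌋ = ⌊N * Int.fract (q * x i)⌋ := congrFun hf i
  have h3 := Int.abs_sub_lt_one_of_floor_eq_floor h2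
  rw [← mul_sub, abs_mul, Nat.abs_cast, abs_sub_comm] at h3
  linarith

/-- The constant in `exists_direction_approx`. -/
def approxConst (d : ℕ) : ℝ := 16 * d ^ 3 * (5 * d ^ 2) ^ (2 * d)

/-- Every long integer vector is nearly a multiple of a short one. -/
theorem exists_direction_approx {d : ℕ} (hd : 1 ≤ d) {T : ℝ} (hT : 1 ≤ T) {a : Fin d → ℤ}
    (ha : approxConst d * T ^ (2 * d + 1) ≤ ‖vec a‖) :
    ∃ (c a' : Fin d → ℤ) (t : ℕ), c ≠ 0 ∧ ‖vec c‖ ≤ approxConst d * T ^ d ∧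
      a = a' + (t : ℤ) • c ∧ T * (‖vec a'‖ + ‖vec c‖) * ‖vec c‖ ≤ ‖vec a‖ := by
  have : NeZero d := ⟨by omega⟩
  have hdr : (1 : ℝ) ≤ d := by exact_mod_cast hd
  have hapos : 0 < approxConst d := by unfold approxConst; positivity
  obtain ⟨i₀, hi₀⟩ := Finite.exists_max fun i => |a i|
  set M : ℤ := |a i₀| with hM
  have hMle : ∀ i, |(a i : ℝ)| ≤ M := fun i => by
    rw [← Int.cast_abs]; exact_mod_cast hi₀ i
  have hM0 : (0 : ℝ) ≤ M := (abs_nonneg _).trans (hMle i₀)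
  have haM : ‖vec a‖ ≤ d * M := by
    simpa using norm_vec_le_of_forall hM0 hMle
  have hMa : (M : ℝ) ≤ ‖vec a‖ := by
    rw [hM, Int.cast_abs]; exact abs_apply_le_norm_vec a i₀
  have hMpos : (0 : ℝ) < M := by
    have h1 : 0 < ‖vec a‖ := lt_of_lt_of_le (by positivity) ha
    by_contra hneg
    nlinarith
  -- This `N` keeps the contribution `2Td²M/N` of the approximation error below `M/2`. The
  -- contribution `8Td²q²`, due to the length of `c` and the rounding of `t`, is also at most `M/2`
  -- because `q ≤ N^d`; this last requirement dictates `approxConst`.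
  set N : ℕ := ⌈4 * T * d ^ 2⌉₊ with hNdef
  have hN1 : 4 * T * d ^ 2 ≤ N := Nat.le_ceil _
  have hd2 : (1 : ℝ) ≤ (d : ℝ) ^ 2 := one_le_pow₀ hdr
  have hTd : 1 ≤ T * (d : ℝ) ^ 2 := one_le_mul_of_one_le_of_one_le hT hd2
  have hN2 : (N : ℝ) ≤ 5 * d ^ 2 * T := by
    have := (Nat.ceil_lt_add_one (show 0 ≤ 4 * T * (d : ℝ) ^ 2 by positivity)).le
    linarith
  have hNpos : (0 : ℝ) < N := by linarith
  obtain ⟨q, hq0, hqN, c, hc⟩ := exists_simultaneous_approx (fun i => (a i : ℝ) / M)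
    (N := N) (by exact_mod_cast hNpos)
  rw [Fintype.card_fin] at hqN
  have hq1 : (1 : ℝ) ≤ q := by exact_mod_cast hq0
  have hqN' : (q : ℝ) ≤ (5 * d ^ 2 * T) ^ d := by
    calc (q : ℝ) ≤ (N : ℝ) ^ d := by exact_mod_cast hqN
      _ ≤ _ := by gcongr
  have hNinv : 1 / (N : ℝ) ≤ 1 / 4 := by
    apply one_div_le_one_div_of_le <;> linarith
  have hci : ∀ i, |(c i : ℝ)| ≤ 2 * q := by
    intro i
    have h1 := abs_le.mp (hc i)
    have h2 : |(q : ℝ) * (a i / M)| ≤ q := by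
      rw [abs_mul, abs_div, Nat.abs_cast, abs_of_pos hMpos]
      have : |(a i : ℝ)| / M ≤ 1 := div_le_one_of_le₀ (hMle i) hM0
      nlinarith
    have h3 := abs_le.mp h2
    exact abs_le.mpr ⟨by linarith, by linarith⟩
  have hcn : ‖vec c‖ ≤ 2 * d * q := by
    have := norm_vec_le_of_forall (by positivity) hci
    rw [Fintype.card_fin] at this
    linarith
  -- At the largest coordinate `q a/M` has absolute value `q ≥ 1`, so it is not within `1/4` of
  -- zero.
  have hc0 : c ≠ 0 := by
    intro h0
    have h1 := hc i₀
    rw [h0] at h1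
    simp only [Pi.zero_apply, Int.cast_zero, sub_zero, abs_mul, abs_div, Nat.abs_cast,
      abs_of_pos hMpos] at h1
    rw [← Int.cast_abs, ← hM, div_self hMpos.ne'] at h1
    linarith
  set t : ℕ := ⌊(M : ℝ) / q⌋₊ with ht
  have ht1 : (t : ℝ) ≤ M / q := Nat.floor_le (by positivity)
  have ht2 : (M : ℝ) / q < t + 1 := Nat.lt_floor_add_one _
  refine ⟨c, a - (t : ℤ) • c, t, hc0, ?_, by abel, ?_⟩
  · refine hcn.trans ?_
    unfold approxConst
    have h1 : (5 * (d : ℝ) ^ 2) ^ d ≤ (5 * (d : ℝ) ^ 2) ^ (2 * d) :=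
      pow_le_pow_right₀ (by linarith) (by omega)
    calc 2 * (d : ℝ) * q ≤ 2 * d * (5 * d ^ 2 * T) ^ d := by gcongr
      _ = 2 * d * (5 * d ^ 2) ^ d * T ^ d := by rw [mul_pow]; ring
      _ ≤ 16 * d ^ 3 * (5 * d ^ 2) ^ (2 * d) * T ^ d := by
        gcongr
        · norm_num
        · calc (d : ℝ) = d ^ 1 := (pow_one _).symm
            _ ≤ d ^ 3 := pow_le_pow_right₀ hdr (by norm_num)
  · have ha'i : ∀ i, |((a - (t : ℤ) • c) i : ℝ)| ≤ 2 * q + M / q / N := by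
      intro i
      have h1 : ((a - (t : ℤ) • c) i : ℝ) = (M / q - t) * c i + M / q * (q * (a i / M) - c i) := by
        simp only [Pi.sub_apply, Pi.smul_apply, smul_eq_mul]
        push_cast
        have : (q : ℝ) ≠ 0 := by positivity
        field_simp
        ring
      rw [h1]
      refine (abs_add_le _ _).trans (add_le_add ?_ ?_)
      · rw [abs_mul, abs_of_nonneg (sub_nonneg.mpr ht1)]
        exact (mul_le_of_le_one_left (abs_nonneg _) (by linarith only [ht2])).trans (hci i)
      · rw [abs_mul, abs_of_nonneg (show (0 : ℝ) ≤ M / q by positivity), div_eq_mul_one_div _ (N : ℝ)]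
        exact mul_le_mul_of_nonneg_left (hc i) (by positivity)
    have ha'n : ‖vec (a - (t : ℤ) • c)‖ ≤ d * (2 * q + M / q / N) := by
      have := norm_vec_le_of_forall (by positivity) ha'i
      rwa [Fintype.card_fin] at this
    have hq2 : 16 * T * d ^ 2 * (q : ℝ) ^ 2 ≤ M := by
      have h1 : 16 * T * d ^ 3 * (q : ℝ) ^ 2 ≤ ‖vec a‖ := by
        refine le_trans ?_ ha
        unfold approxConst
        calc 16 * T * d ^ 3 * (q : ℝ) ^ 2 ≤ 16 * T * d ^ 3 * ((5 * d ^ 2 * T) ^ d) ^ 2 := by gcongr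
          _ = _ := by rw [mul_pow]; ring
      have h2 : (d : ℝ) * (16 * T * d ^ 2 * (q : ℝ) ^ 2) ≤ d * M := by
        calc _ = 16 * T * d ^ 3 * (q : ℝ) ^ 2 := by ring
          _ ≤ _ := h1.trans haM
      exact le_of_mul_le_mul_left h2 (by linarith)
    have h3 : 4 * T * d ^ 2 * ((M : ℝ) / N) ≤ M := by
      rw [mul_div_assoc', div_le_iff₀ hNpos]
      nlinarith
    calc T * (‖vec (a - (t : ℤ) • c)‖ + ‖vec c‖) * ‖vec c‖
        ≤ T * (d * (2 * q + M / q / N) + 2 * d * q) * (2 * d * q) := by gcongr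
      _ = 8 * T * d ^ 2 * q ^ 2 + 2 * T * d ^ 2 * (M / N) := by
        have : (q : ℝ) ≠ 0 := by positivity
        field_simp
        ring
      _ ≤ M := by linarith
      _ ≤ ‖vec a‖ := hMa

end Lattice

/-! ### Consequences of being nearly a multiple of a short vector -/

section Direction

variable {d : ℕ}

/-- `a` is nearly the multiple `t c` of the short vector `c`. -/
def NearMultiple (T : ℝ) (a a' c : Fin d → ℤ) (t : ℕ) : Prop :=
  c ≠ 0 ∧ a = a' + (t : ℤ) • c ∧ T * (‖vec a'‖ + ‖vec c‖) * ‖vec c‖ ≤ ‖vec a‖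

variable {T ρ : ℝ} {a a' c : Fin d → ℤ} {t : ℕ}

theorem NearMultiple.norm_le (h : NearMultiple T a a' c t) : ‖vec a‖ ≤ ‖vec a'‖ + t * ‖vec c‖ := by
  rw [h.2.1, vec_add, vec_zsmul]
  refine (norm_add_le _ _).trans ?_
  rw [norm_smul]
  simp

theorem NearMultiple.mul_norm_rest_le (hT : 0 ≤ T) (h : NearMultiple T a a' c t) :
    T * ‖vec a'‖ * ‖vec c‖ ≤ ‖vec a‖ := by
  refine le_trans ?_ h.2.2
  have := norm_nonneg (vec c)
  gcongr
  linarith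

theorem NearMultiple.mul_norm_dir_le (hT : 0 ≤ T) (h : NearMultiple T a a' c t) :
    T * ‖vec c‖ ≤ ‖vec a‖ := by
  refine le_trans ?_ h.2.2
  have h1 := one_le_norm_vec h.1
  have h2 := norm_nonneg (vec a')
  have h3 : ‖vec c‖ ≤ (‖vec a'‖ + ‖vec c‖) * ‖vec c‖ := by nlinarith
  rw [mul_assoc]
  gcongr

/-- If the integer `⟨c,z⟩` were nonzero, then `t ≤ |⟨a,z⟩| + |⟨a',z⟩| ≤ K + ρ|a'|`, so `|a| ≤ |a'| +
t|c|` would be too small for the two lower bounds on `|a|`. -/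
theorem NearMultiple.inner_eq_zero (h : NearMultiple T a a' c t) (hT : 2 * (1 + ρ) ≤ T)
    {z : Fin d → ℤ} (hz : ‖vec z‖ ≤ ρ) {K : ℝ} (hK : |inner ℝ (vec a) (vec z)| ≤ K)
    (hKa : 2 * K * ‖vec c‖ < ‖vec a‖) : inner ℝ (vec c) (vec z) = 0 := by
  by_contra hne
  have hρ : 0 ≤ ρ := (norm_nonneg _).trans hz
  have hT0 : 0 ≤ T := by linarith
  have h1 := one_le_abs_inner_vec hne
  have h2 : (t : ℝ) * inner ℝ (vec c) (vec z) =
      inner ℝ (vec a) (vec z) - inner ℝ (vec a') (vec z) := by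
    conv_rhs => rw [h.2.1]
    rw [vec_add, vec_zsmul, inner_add_left, real_inner_smul_left]
    push_cast
    ring
  have h3 : (t : ℝ) ≤ K + ‖vec a'‖ * ρ := by
    calc (t : ℝ) ≤ t * |inner ℝ (vec c) (vec z)| := le_mul_of_one_le_right (Nat.cast_nonneg _) h1
      _ = |inner ℝ (vec a) (vec z) - inner ℝ (vec a') (vec z)| := by
        rw [← h2, abs_mul, Nat.abs_cast]
      _ ≤ |inner ℝ (vec a) (vec z)| + |inner ℝ (vec a') (vec z)| := abs_sub _ _
      _ ≤ K + ‖vec a'‖ * ρ := by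
        gcongr
        exact (abs_real_inner_le_norm _ _).trans (by gcongr)
  have h4 := h.norm_le
  have h5 : ‖vec a'‖ * (1 + ρ) * ‖vec c‖ * 2 ≤ ‖vec a‖ := by
    have := h.mul_norm_rest_le hT0
    refine le_trans ?_ this
    have := mul_nonneg (norm_nonneg (vec a')) (norm_nonneg (vec c))
    nlinarith
  have h6 := one_le_norm_vec h.1
  have h7 := mul_le_mul_of_nonneg_right h3 (norm_nonneg (vec c))
  have h8 := mul_le_mul_of_nonneg_left h6 (norm_nonneg (vec a'))
  nlinarith

/-- A vector `a` nearly orthogonal to `V` cannot be long and nearly parallel to an element of `V`: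
from `t|c|² = ⟨a,c⟩ - ⟨a',c⟩` one gets `|a| ≤ M + 2|a'| ≤ M + |a|/2`. This makes successive
directions independent. -/
theorem NearMultiple.notMem_of_inner_le (h : NearMultiple T a a' c t) (hT : 4 ≤ T)
    {V : Submodule ℝ (EuclideanSpace ℝ (Fin d))} {M : ℝ}
    (hV : ∀ w ∈ V, |inner ℝ (vec a) w| ≤ M * ‖w‖) (hMa : 2 * M < ‖vec a‖) : vec c ∉ V := by
  intro hc
  have h1 := hV _ hc
  have hcpos := one_le_norm_vec h.1
  have h2 : (t : ℝ) * ‖vec c‖ ^ 2 = inner ℝ (vec a) (vec c) - inner ℝ (vec a') (vec c) := by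
    conv_rhs => rw [h.2.1]
    rw [vec_add, vec_zsmul, inner_add_left, real_inner_smul_left, real_inner_self_eq_norm_sq]
    push_cast
    ring
  have h3 := (abs_le.mp h1).2
  have h4 := (abs_le.mp (abs_real_inner_le_norm (vec a') (vec c))).1
  have h5 : t * ‖vec c‖ * ‖vec c‖ ≤ (M + ‖vec a'‖) * ‖vec c‖ := by nlinarith
  have h6 : t * ‖vec c‖ ≤ M + ‖vec a'‖ := le_of_mul_le_mul_right h5 (by linarith)
  have h7 := h.norm_le
  have h8 := h.mul_norm_rest_le (by linarith)
  have h9 : 4 * ‖vec a'‖ ≤ ‖vec a‖ := by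
    refine le_trans ?_ h8
    have h10 : 4 * ‖vec a'‖ ≤ T * ‖vec a'‖ := by gcongr
    exact h10.trans (le_mul_of_one_le_right (by positivity) hcpos)
  linarith

theorem NearMultiple.half_norm_le (h : NearMultiple T a a' c t) (hρ : 0 ≤ ρ) (hT : 2 * (1 + ρ) ≤ T)
    {x : Fin d → ℤ} (hx : ‖vec (x - a)‖ ≤ ρ) : ‖vec a‖ / 2 ≤ ‖vec x‖ := by
  have h1 := h.mul_norm_dir_le (by linarith)
  have h2 := one_le_norm_vec h.1
  have h3 : ‖vec a‖ ≤ ‖vec x‖ + ‖vec (x - a)‖ := by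
    rw [vec_sub, ← norm_neg (vec x - vec a)]
    calc ‖vec a‖ = ‖vec x + -(vec x - vec a)‖ := by congr 1; abel
      _ ≤ _ := norm_add_le _ _
  have h4 : 2 * (1 + ρ) * 1 ≤ T * ‖vec c‖ := by gcongr; linarith
  linarith

/-- Points within `ρ` of `a` have the same `t` and `c`, with `a'` changed by at most `ρ`, and norm
at least `|a|/2`; the largeness of `T` absorbs both losses. -/
theorem NearMultiple.mem_lipDomain (h : NearMultiple T a a' c t) {A : Finset (Fin d → ℤ)} {Λ : ℝ}
    (hΛ : 0 ≤ Λ) (hρ : 0 ≤ ρ) (hT : 2 * (1 + ρ) ≤ T) (hT1 : 2 * Λ * (1 + ρ) ≤ T)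
    (hT2 : 4 * Λ ^ 2 ≤ T) {x y : Site A} (hx : ‖vec (x.1 - a)‖ ≤ ρ) (hy : ‖vec (y.1 - a)‖ ≤ ρ) :
    (x, y) ∈ lipDomain A Λ c := by
  have hcpos := one_le_norm_vec h.1
  have key : ∀ z : Fin d → ℤ, ‖vec (z - a)‖ ≤ ρ →
      z = (a' + (z - a)) + (t : ℤ) • c ∧
      Λ * (‖vec (a' + (z - a))‖ + ‖vec c‖) * ‖vec c‖ ≤ ‖vec z‖ ∧ 2 * Λ ^ 2 ≤ ‖vec z‖ / ‖vec c‖ := by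
    intro z hz
    have hhalf := h.half_norm_le hρ hT hz
    refine ⟨?_, ?_, ?_⟩
    · rw [show a' + (z - a) + (t : ℤ) • c = (a' + (t : ℤ) • c) + (z - a) by abel, ← h.2.1]
      abel
    · have h1 : ‖vec (a' + (z - a))‖ ≤ ‖vec a'‖ + ρ := by
        rw [vec_add]; exact (norm_add_le _ _).trans (by gcongr)
      have h2 : ‖vec a'‖ + ρ + ‖vec c‖ ≤ (1 + ρ) * (‖vec a'‖ + ‖vec c‖) := by
        have := norm_nonneg (vec a')
        nlinarith
      have h3 : 2 * Λ * (1 + ρ) * ((‖vec a'‖ + ‖vec c‖) * ‖vec c‖) ≤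
          T * ((‖vec a'‖ + ‖vec c‖) * ‖vec c‖) := by gcongr
      have h4 : Λ * (‖vec (a' + (z - a))‖ + ‖vec c‖) * ‖vec c‖ ≤
          Λ * ((1 + ρ) * (‖vec a'‖ + ‖vec c‖)) * ‖vec c‖ := by
        gcongr
        linarith
      have h5 := h.2.2
      linarith
    · rw [le_div_iff₀ (by linarith)]
      have h1 := h.mul_norm_dir_le (by linarith)
      have h2 : 4 * Λ ^ 2 * ‖vec c‖ ≤ T * ‖vec c‖ := by gcongr
      linarith
  obtain ⟨hx1, hx2, hx3⟩ := key x.1 hx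
  obtain ⟨hy1, hy2, hy3⟩ := key y.1 hy
  exact ⟨⟨_, _, t, hx1, hy1, hx2, hy2⟩, hx3, hy3⟩

end Direction

/-! ### Translations by integer combinations of the directions -/

section Translates

variable {d : ℕ}

/-- The real span of a list of integer vectors. -/
def realSpan (C : List (Fin d → ℤ)) : Submodule ℝ (EuclideanSpace ℝ (Fin d)) :=
  Submodule.span ℝ {v | ∃ c ∈ C, v = vec c}

/-- The group of integer combinations of a list of integer vectors. -/
def intSpan (C : List (Fin d → ℤ)) : AddSubgroup (Fin d → ℤ) :=
  AddSubgroup.closure {c | c ∈ C}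

theorem realSpan_cons (c : Fin d → ℤ) (C : List (Fin d → ℤ)) :
    realSpan (c :: C) = Submodule.span ℝ {vec c} ⊔ realSpan C := by
  rw [realSpan, realSpan, ← Submodule.span_union]
  congr 1
  ext v
  simp

theorem mem_intSpan {c : Fin d → ℤ} {C : List (Fin d → ℤ)} (h : c ∈ C) : c ∈ intSpan C :=
  AddSubgroup.subset_closure h

theorem intSpan_le_cons (c : Fin d → ℤ) (C : List (Fin d → ℤ)) : intSpan C ≤ intSpan (c :: C) :=
  AddSubgroup.closure_mono fun _ h => List.mem_cons_of_mem _ h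

theorem vec_mem_realSpan {C : List (Fin d → ℤ)} {v : Fin d → ℤ} (hv : v ∈ intSpan C) :
    vec v ∈ realSpan C := by
  induction hv using AddSubgroup.closure_induction with
  | mem x hx => exact Submodule.subset_span ⟨x, hx, rfl⟩
  | zero => rw [vec_zero]; exact zero_mem _
  | add x y _ _ hx hy => rw [vec_add]; exact add_mem hx hy
  | neg x _ hx => rw [vec_neg]; exact neg_mem hx

theorem inner_eq_zero_of_mem_realSpan {C : List (Fin d → ℤ)} {z : EuclideanSpace ℝ (Fin d)}
    (h : ∀ c ∈ C, inner ℝ (vec c) z = 0) {w : EuclideanSpace ℝ (Fin d)} (hw : w ∈ realSpan C) :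
    inner ℝ w z = 0 := by
  induction hw using Submodule.span_induction with
  | mem x hx => obtain ⟨c, hc, rfl⟩ := hx; exact h c hc
  | zero => exact inner_zero_left _
  | add x y _ _ hx hy => rw [inner_add_left, hx, hy, add_zero]
  | smul r x _ hx => rw [real_inner_smul_left, hx, mul_zero]

/-- Round the coefficients down; each vector leaves a fractional multiple of itself. -/
theorem exists_intSpan_near (C : List (Fin d → ℤ)) {p : EuclideanSpace ℝ (Fin d)}
    (hp : p ∈ realSpan C) : ∃ v ∈ intSpan C, ‖p + vec v‖ ≤ (C.map fun c => ‖vec c‖).sum := by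
  induction C generalizing p with
  | nil =>
    refine ⟨0, zero_mem _, ?_⟩
    have : p = 0 := by simpa [realSpan] using hp
    simp [this, vec_zero]
  | cons c C ih =>
    rw [realSpan_cons, Submodule.mem_sup] at hp
    obtain ⟨y, hy, z, hz, rfl⟩ := hp
    obtain ⟨r, rfl⟩ := Submodule.mem_span_singleton.mp hy
    obtain ⟨v, hv, hvn⟩ := ih hz
    refine ⟨(-⌊r⌋) • c + v, add_mem (zsmul_mem (mem_intSpan List.mem_cons_self) _)
      (intSpan_le_cons c C hv), ?_⟩
    rw [List.map_cons, List.sum_cons, vec_add, vec_zsmul]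
    have h1 : r • vec c + z + (((-⌊r⌋ : ℤ) : ℝ) • vec c + vec v) =
        Int.fract r • vec c + (z + vec v) := by
      rw [Int.fract]; push_cast; module
    rw [h1]
    refine (norm_add_le _ _).trans (add_le_add ?_ hvn)
    rw [norm_smul, Real.norm_of_nonneg (Int.fract_nonneg r)]
    exact mul_le_of_le_one_left (norm_nonneg _) (Int.fract_lt_one r).le

/-- Each pair in `S × A` excludes at most one `s`, because `c ≠ 0`. -/
theorem exists_shift_avoiding (S A : Finset (Fin d → ℤ)) {c : Fin d → ℤ} (hc : c ≠ 0) :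
    ∃ s : ℕ, s ≤ S.card * A.card ∧ ∀ x ∈ S, x + (s : ℤ) • c ∉ A := by
  classical
  by_contra! hcon
  have hinj : ∀ x ∈ S, ∀ s s' : ℕ, x + (s : ℤ) • c = x + (s' : ℤ) • c → s = s' := by
    intro x _ s s' h
    have h1 : (s : ℤ) • c = (s' : ℤ) • c := add_left_cancel h
    have := smul_left_injective ℤ hc h1
    exact_mod_cast this
  choose! f hfS hfA using hcon
  have hmaps : ∀ s ∈ Finset.range (S.card * A.card + 1),
      (f s, f s + (s : ℤ) • c) ∈ S ×ˢ A := by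
    intro s hs
    have hs' : s ≤ S.card * A.card := by simp at hs; omega
    exact Finset.mem_product.mpr ⟨hfS s hs', hfA s hs'⟩
  obtain ⟨s, hs, s', hs', hne, heq⟩ := Finset.exists_ne_map_eq_of_card_lt_of_maps_to
    (by rw [Finset.card_product]; simp) hmaps
  rw [Prod.mk.injEq] at heq
  refine hne (hinj (f s) (hfS s (by simp at hs; omega)) s s' ?_)
  rw [heq.2, heq.1]

/-- A translate of a finite set by an integer combination of `c :: C` that avoids `A` and lies
near the orthogonal complement of these vectors. -/
theorem exists_reduced_translate (S A : Finset (Fin d → ℤ)) {c : Fin d → ℤ} (hc : c ≠ 0)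
    (C : List (Fin d → ℤ)) (a : Fin d → ℤ) :
    ∃ v ∈ intSpan (c :: C), (∀ x ∈ S, x + v ∉ A) ∧ ∀ w ∈ realSpan (c :: C),
      |inner ℝ (vec (a + v)) w| ≤
        (((c :: C).map fun c => ‖vec c‖).sum + S.card * A.card * ‖vec c‖) * ‖w‖ := by
  classical
  set V := realSpan (c :: C)
  -- The translation `v` cancels the projection of `a` on the span up to rounding; a bounded further
  -- multiple of `c` removes collisions with `A`.
  obtain ⟨v, hv, hvn⟩ := exists_intSpan_near (c :: C) (V.starProjection_apply_mem (vec a))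
  obtain ⟨s, hs, hsA⟩ := exists_shift_avoiding (S.image fun x => x + v) A hc
  have hs' : s ≤ S.card * A.card :=
    hs.trans (Nat.mul_le_mul_right _ Finset.card_image_le)
  refine ⟨v + (s : ℤ) • c, add_mem hv (zsmul_mem (mem_intSpan List.mem_cons_self) _), ?_, ?_⟩
  · intro x hx
    rw [← add_assoc]
    exact hsA _ (Finset.mem_image_of_mem _ hx)
  · intro w hw
    have h1 : vec (a + (v + (s : ℤ) • c)) =
        (vec a - V.starProjection (vec a)) + ((V.starProjection (vec a) + vec v) +
          (s : ℝ) • vec c) := by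
      rw [vec_add, vec_add, vec_zsmul]; push_cast; abel
    have h2 : inner ℝ (vec a - V.starProjection (vec a)) w = 0 :=
      Submodule.starProjection_inner_eq_zero _ w hw
    rw [h1, inner_add_left, h2, zero_add]
    refine (abs_real_inner_le_norm _ _).trans ?_
    gcongr
    refine (norm_add_le _ _).trans (add_le_add hvn ?_)
    rw [norm_smul, Real.norm_natCast]
    gcongr
    exact_mod_cast hs'

end Translates

/-! ### Töplitz limits and their iterates -/

section Limits

variable {d : ℕ} {A : Finset (Fin d → ℤ)}

theorem entry_site (Q : Mat A) (x y : Site A) : entry Q x.1 y.1 = Q x y := by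
  rw [entry, dif_pos ⟨x.2, y.2⟩]

theorem IsToplitzLimit.toplitzLimit_eq {s : ℤˣ} {c : Fin d → ℤ} {Q P : Mat A}
    (h : IsToplitzLimit s c Q P) : toplitzLimit s c Q = P := by
  funext a b
  exact (h a b).limUnder_eq

theorem IsNToplitz.isToplitzLimit {n : ℕ} {Q : Mat A} (h : IsNToplitz (n + 1) Q) (s : ℤˣ)
    (c : Fin d → ℤ) : IsToplitzLimit s c Q (toplitzLimit s c Q) ∧
      IsNToplitz n (toplitzLimit s c Q) := by
  obtain ⟨P, hP, hn⟩ := h s c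
  rw [hP.toplitzLimit_eq]
  exact ⟨hP, hn⟩

theorem toplitzLimit_zero (s : ℤˣ) (Q : Mat A) : toplitzLimit s 0 Q = Q := by
  refine IsToplitzLimit.toplitzLimit_eq fun a b => ?_
  simp only [smul_zero, add_zero, entry_site]
  exact tendsto_const_nhds

theorem lipNormN_toplitzLimit_le (Λ : ℝ) (n : ℕ) (s : ℤˣ) (c : Fin d → ℤ) (Q : Mat A) :
    lipNormN Λ (n + 1) (toplitzLimit s c Q) ≤ lipNormN Λ (n + 2) Q :=
  le_iSup₂ (f := fun (s : ℤˣ) (c : Fin d → ℤ) => lipNormN Λ (n + 1) (toplitzLimit s c Q)) s c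

/-- The direction `c = 0` is admitted in the supremum and `Q(+,0) = Q`, so the norms increase with
the order. -/
theorem lipNormN_one_le (Λ : ℝ) (n : ℕ) (Q : Mat A) :
    lipConst Λ Q + supNorm Q ≤ lipNormN Λ (n + 1) Q := by
  induction n with
  | zero => exact le_rfl
  | succ n ih =>
    refine ih.trans ?_
    have := lipNormN_toplitzLimit_le Λ n 1 0 Q
    rwa [toplitzLimit_zero] at this

theorem norm_apply_le_of_lipNormN_le {Λ : ℝ} {n : ℕ} {Q : Mat A} {h : ℝ} (h0 : 0 ≤ h)
    (hQ : lipNormN Λ (n + 1) Q ≤ ENNReal.ofReal h) (x y : Site A) : ‖Q x y‖ ≤ h := by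
  have h1 : ‖Q x y‖ₑ ≤ ENNReal.ofReal h :=
    (le_iSup₂ (f := fun x y => ‖Q x y‖ₑ) x y).trans
      ((le_add_self.trans (lipNormN_one_le Λ n Q)).trans hQ)
  rw [← ofReal_norm] at h1
  exact (ENNReal.ofReal_le_ofReal_iff h0).mp h1

theorem norm_sub_toplitzLimit_le {Λ : ℝ} {n : ℕ} {Q : Mat A} {h : ℝ} (h0 : 0 ≤ h)
    (hQ : lipNormN Λ (n + 1) Q ≤ ENNReal.ofReal h) {c : Fin d → ℤ} (hc : c ≠ 0) {x y : Site A}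
    (hxy : (x, y) ∈ lipDomain A Λ c) :
    ‖vec x.1‖ * ‖Q x y - toplitzLimit 1 c Q x y‖ ≤ h * ‖vec c‖ := by
  have h1 : ENNReal.ofReal (max (‖vec x.1‖ / ‖vec c‖) (‖vec y.1‖ / ‖vec c‖) + 1) *
      ‖Q x y - toplitzLimit 1 c Q x y‖ₑ ≤ ENNReal.ofReal h := by
    refine le_trans ?_ ((le_self_add.trans (lipNormN_one_le Λ n Q)).trans hQ)
    exact le_iSup₂_of_le c hc (le_iSup₂_of_le (x, y) hxy le_rfl)
  have hcpos := one_le_norm_vec hc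
  have hmax : ‖vec x.1‖ / ‖vec c‖ ≤ max (‖vec x.1‖ / ‖vec c‖) (‖vec y.1‖ / ‖vec c‖) + 1 :=
    (le_max_left _ _).trans (by linarith)
  have hdiv : 0 ≤ ‖vec x.1‖ / ‖vec c‖ := by positivity
  rw [← ofReal_norm, ← ENNReal.ofReal_mul (by linarith), ENNReal.ofReal_le_ofReal_iff h0] at h1
  have h2 := (mul_le_mul_of_nonneg_right hmax (norm_nonneg _)).trans h1
  rw [div_mul_eq_mul_div, div_le_iff₀ (by linarith)] at h2
  exact h2

/-- Sites escape every finite set along a nonzero direction. -/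
theorem eventually_add_smul_notMem (A : Finset (Fin d → ℤ)) {c : Fin d → ℤ} (hc : c ≠ 0)
    (x : Fin d → ℤ) : ∀ᶠ t : ℕ in atTop, x + (t : ℤ) • c ∉ A := by
  have hinj : Function.Injective fun t : ℕ => x + (t : ℤ) • c := by
    intro s t h
    have := smul_left_injective ℤ hc (add_left_cancel h)
    exact_mod_cast this
  have := hinj.tendsto_cofinite.eventually A.finite_toSet.eventually_cofinite_notMem
  rw [Nat.cofinite_eq_atTop] at this
  simpa using this

/-- `Q` is invariant under the simultaneous translation of both indices by `v`. -/
def Invariant (Q : Mat A) (v : Fin d → ℤ) : Prop :=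
  ∀ x y x' y' : Site A, x'.1 = x.1 + v → y'.1 = y.1 + v → Q x' y' = Q x y

theorem IsToplitzLimit.tendsto {c : Fin d → ℤ} {Q P : Mat A}
    (h : IsToplitzLimit 1 c Q P) (x y : Site A) : Tendsto
      (fun t : ℕ => entry Q (x.1 + (t : ℤ) • c) (y.1 + (t : ℤ) • c)) atTop (𝓝 (P x y)) := by
  simpa using h x y

/-- Since `x + v + sc + tc = (x + (t+s)c) + v`, the invariance of `Q` under `v` identifies the
entries at `x' + tc` with those at `x + (t+s)c` once `A` is avoided, and a shifted sequence has the
same limit. A limit therefore keeps old invariances and gains `c`. -/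
theorem IsToplitzLimit.invariant_add_smul {c v : Fin d → ℤ} (hc : c ≠ 0) {Q P : Mat A}
    (h : IsToplitzLimit 1 c Q P) (hv : Invariant Q v) (s : ℕ) : Invariant P (v + (s : ℤ) • c) := by
  intro x y x' y' hx hy
  have htend := (h.tendsto x y).comp (tendsto_add_atTop_nat s)
  refine tendsto_nhds_unique (h.tendsto x' y') (htend.congr' ?_)
  have hsh := tendsto_add_atTop_nat s
  filter_upwards [hsh.eventually (eventually_add_smul_notMem A hc x.1),
    hsh.eventually (eventually_add_smul_notMem A hc y.1),
    eventually_add_smul_notMem A hc x'.1, eventually_add_smul_notMem A hc y'.1] with t h1 h2 h3 h4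
  rw [Function.comp, entry, dif_pos ⟨h1, h2⟩, entry, dif_pos ⟨h3, h4⟩]
  refine (hv _ _ _ _ ?_ ?_).symm
  · simp only [hx]; push_cast; module
  · simp only [hy]; push_cast; module

theorem Invariant.neg {Q : Mat A} {v : Fin d → ℤ} (h : Invariant Q v) : Invariant Q (-v) := by
  intro x y x' y' hx hy
  exact (h x' y' x y (by rw [hx]; abel) (by rw [hy]; abel)).symm

/-- Iterated Töplitz limits, in the directions of a list of integer vectors. -/
noncomputable def iterLimit : List (Fin d → ℤ) → Mat A → Mat A
  | [], Q => Q
  | c :: C, Q => toplitzLimit 1 c (iterLimit C Q)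

theorem isNToplitz_iterLimit {n : ℕ} (C : List (Fin d → ℤ)) {Q : Mat A}
    (h : IsNToplitz (n + C.length) Q) : IsNToplitz n (iterLimit C Q) := by
  induction C generalizing n with
  | nil => exact h
  | cons c C ih =>
    have h1 : IsNToplitz (n + 1 + C.length) Q := by
      rw [List.length_cons] at h; convert h using 1; ring
    exact ((ih h1).isToplitzLimit 1 c).2

theorem isToplitzLimit_iterLimit {c : Fin d → ℤ} (C : List (Fin d → ℤ)) {Q : Mat A} {n : ℕ}
    (hn : C.length < n) (h : IsNToplitz n Q) :
    IsToplitzLimit 1 c (iterLimit C Q) (iterLimit (c :: C) Q) := by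
  obtain ⟨m, rfl⟩ := Nat.exists_eq_add_of_lt hn
  have h1 : IsNToplitz (m + 1 + C.length) Q := by convert h using 1; ring
  exact ((isNToplitz_iterLimit C h1).isToplitzLimit 1 c).1

theorem lipNormN_iterLimit_le {Λ : ℝ} {n : ℕ} (C : List (Fin d → ℤ)) {Q : Mat A} :
    lipNormN Λ (n + 1) (iterLimit C Q) ≤ lipNormN Λ (n + 1 + C.length) Q := by
  induction C generalizing n with
  | nil => exact le_rfl
  | cons c C ih =>
    refine (lipNormN_toplitzLimit_le Λ n 1 c _).trans (ih.trans (le_of_eq ?_))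
    rw [List.length_cons]
    congr 1
    ring

/-- A property of matrices that is closed under Töplitz limits passes to iterated limits. -/
theorem iterLimit_induction {n : ℕ} {Q : Mat A} {p : Mat A → Prop} (hQ : p Q)
    (hp : ∀ (c : Fin d → ℤ) (P P' : Mat A), c ≠ 0 → IsToplitzLimit 1 c P P' → p P → p P')
    {C : List (Fin d → ℤ)} (hC : ∀ c ∈ C, c ≠ 0) (hn : C.length ≤ n) (h : IsNToplitz n Q) :
    p (iterLimit C Q) := by
  induction C with
  | nil => exact hQ
  | cons c C ih =>
    rw [List.length_cons] at hn
    exact hp c _ _ (hC c List.mem_cons_self) (isToplitzLimit_iterLimit C (by omega) h)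
      (ih (fun c hc => hC c (List.mem_cons_of_mem _ hc)) (by omega))

theorem mem_intSpan_cons {c : Fin d → ℤ} {C : List (Fin d → ℤ)} {v : Fin d → ℤ}
    (hv : v ∈ intSpan (c :: C)) : ∃ w ∈ intSpan C, ∃ s : ℤ, v = w + s • c := by
  induction hv using AddSubgroup.closure_induction with
  | mem x hx =>
    rcases List.mem_cons.mp hx with rfl | hx
    · exact ⟨0, zero_mem _, 1, by simp⟩
    · exact ⟨x, mem_intSpan hx, 0, by simp⟩
  | zero => exact ⟨0, zero_mem _, 0, by simp⟩
  | add x y _ _ hx hy =>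
    obtain ⟨w, hw, s, rfl⟩ := hx
    obtain ⟨w', hw', s', rfl⟩ := hy
    exact ⟨w + w', add_mem hw hw', s + s', by module⟩
  | neg x _ hx =>
    obtain ⟨w, hw, s, rfl⟩ := hx
    exact ⟨-w, neg_mem hw, -s, by module⟩

theorem invariant_iterLimit {n : ℕ} {Q : Mat A} (h : IsNToplitz n Q) {C : List (Fin d → ℤ)}
    (hC : ∀ c ∈ C, c ≠ 0) (hn : C.length ≤ n) {v : Fin d → ℤ} (hv : v ∈ intSpan C) :
    Invariant (iterLimit C Q) v := by
  induction C generalizing v with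
  | nil =>
    have : v = 0 := by simpa [intSpan] using hv
    subst this
    intro x y x' y' hx hy
    rw [add_zero] at hx hy
    rw [Subtype.ext hx, Subtype.ext hy]
  | cons c C ih =>
    rw [List.length_cons] at hn
    have hlim := isToplitzLimit_iterLimit (c := c) C (by omega) h
    have ih' := fun v => ih (fun c hc => hC c (List.mem_cons_of_mem _ hc)) (by omega) (v := v)
    have hc := hC c List.mem_cons_self
    obtain ⟨w, hw, s, rfl⟩ := mem_intSpan_cons hv
    -- A limit gives only nonnegative multiples of `c`; negative ones come from inverting the
    -- invariance under `-w + mc`.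
    obtain ⟨m, rfl | rfl⟩ := s.eq_nat_or_neg
    · exact hlim.invariant_add_smul hc (ih' w hw) m
    · have := (hlim.invariant_add_smul hc (ih' (-w) (neg_mem hw)) m).neg
      convert this using 1
      module

theorem IsToplitzLimit.isHermitian {c : Fin d → ℤ} (hc : c ≠ 0) {Q P : Mat A}
    (h : IsToplitzLimit 1 c Q P) (hQ : Q.IsHermitian) : P.IsHermitian := by
  ext x y
  rw [Matrix.conjTranspose_apply]
  refine tendsto_nhds_unique ((continuous_star.tendsto _).comp (h.tendsto y x))
    ((h.tendsto x y).congr' ?_)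
  filter_upwards [eventually_add_smul_notMem A hc x.1, eventually_add_smul_notMem A hc y.1]
    with t h1 h2
  rw [Function.comp, entry, dif_pos ⟨h1, h2⟩, entry, dif_pos ⟨h2, h1⟩]
  exact (hQ.apply _ _).symm

theorem isHermitian_iterLimit {n : ℕ} {Q : Mat A} (h : IsNToplitz n Q) (hQ : Q.IsHermitian)
    {C : List (Fin d → ℤ)} (hC : ∀ c ∈ C, c ≠ 0) (hn : C.length ≤ n) :
    (iterLimit C Q).IsHermitian :=
  iterLimit_induction (p := Matrix.IsHermitian) hQ (fun _ _ _ hc hl hP => hl.isHermitian hc hP)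
    hC hn h

/-- The translate of a site, wherever it is one. -/
noncomputable def translateSite (x : Site A) (v : Fin d → ℤ) : Site A := by
  classical exact if h : x.1 + v ∉ A then ⟨x.1 + v, h⟩ else x

theorem translateSite_val {x : Site A} {v : Fin d → ℤ} (h : x.1 + v ∉ A) :
    (translateSite x v).1 = x.1 + v := by
  rw [translateSite, dif_pos h]

theorem IsToplitzLimit.tendsto_form {c : Fin d → ℤ} (hc : c ≠ 0) {Q P : Mat A}
    (h : IsToplitzLimit 1 c Q P) {ι : Type*} [Fintype ι] (f : ι → Site A) (u : ι → ℂ) :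
    Tendsto (fun t : ℕ => form (Q.submatrix (fun i => translateSite (f i) ((t : ℤ) • c))
      fun i => translateSite (f i) ((t : ℤ) • c)) u) atTop (𝓝 (form (P.submatrix f f) u)) := by
  refine (Complex.continuous_re.tendsto _).comp (tendsto_finsetSum _ fun i _ =>
    tendsto_finsetSum _ fun j _ => ?_)
  refine ((tendsto_const_nhds.mul ((h.tendsto (f i) (f j)).congr' ?_)).mul tendsto_const_nhds)
  filter_upwards [eventually_add_smul_notMem A hc (f i).1,
    eventually_add_smul_notMem A hc (f j).1] with t h1 h2
  rw [Matrix.submatrix_apply, ← entry_site (A := A) Q, translateSite_val h1, translateSite_val h2]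

/-- The form of the limit is a limit of forms at translated sites. Translation keeps `f` injective
and `FormLip` is uniform in `f`, so the bound passes to the limit with the same constant. -/
theorem formLip_iterLimit {c : ℝ} {U : Set (Param A)} {H : Param A → Mat A}
    (hH : FormLip c U H) {n : ℕ} (hT : ∀ ω ∈ U, IsNToplitz n (H ω)) {C : List (Fin d → ℤ)}
    (hC : ∀ c ∈ C, c ≠ 0) (hn : C.length ≤ n) : FormLip c U fun ω => iterLimit C (H ω) := by
  induction C with
  | nil => exact hH
  | cons b C ih =>
    rw [List.length_cons] at hn
    have hb := hC b List.mem_cons_self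
    have ih' := ih (fun c hc => hC c (List.mem_cons_of_mem _ hc)) (by omega)
    intro x hx y hy ι _ f hf u
    have hlx := (isToplitzLimit_iterLimit (c := b) C (by omega) (hT x hx)).tendsto_form hb f u
    have hly := (isToplitzLimit_iterLimit (c := b) C (by omega) (hT y hy)).tendsto_form hb f u
    refine le_of_tendsto (hlx.sub hly).abs ?_
    have hev : ∀ᶠ t : ℕ in atTop, ∀ i, (f i).1 + (t : ℤ) • b ∉ A :=
      eventually_all.mpr fun i => eventually_add_smul_notMem A hb (f i).1
    filter_upwards [hev] with t ht
    refine ih' x hx y hy ι _ (fun i j hij => hf (Subtype.ext ?_)) u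
    have := congrArg Subtype.val hij
    rw [translateSite_val (ht i), translateSite_val (ht j)] at this
    exact add_right_cancel this

end Limits

/-! ### One step of the reduction at infinity -/

section Descent

variable {d : ℕ} {A : Finset (Fin d → ℤ)}

/-- A stage of the reduction at infinity of a resonance between two finite sets of sites
`p, p'`: after Töplitz limits in the directions `C` and translation by `v` the resonance
persists with tolerance `θ`. -/
structure Stage (Q : Mat A) {ι ι' : Type} [Fintype ι] [Fintype ι'] [DecidableEq ι] [DecidableEq ι']
    (p : ι → Fin d → ℤ) (p' : ι' → Fin d → ℤ) (S : Finset (Fin d → ℤ)) (a : Fin d → ℤ) (z : ℂ)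
    (cm M : ℝ) (C : List (Fin d → ℤ)) (v : Fin d → ℤ) (θ : ℝ) : Prop where
  ne_zero : ∀ c ∈ C, c ≠ 0
  short : ∀ c ∈ C, ‖vec c‖ ≤ cm
  length_le : C.length ≤ Module.finrank ℝ (realSpan C)
  orth : ∀ c ∈ C, ∀ x ∈ S, ∀ y ∈ S, inner ℝ (vec c) (vec (x - y)) = 0
  mem : v ∈ intSpan C
  avoid : ∀ x ∈ S, x + v ∉ A
  reduced : ∀ w ∈ realSpan C, |inner ℝ (vec (a + v)) w| ≤ M * ‖w‖
  resonant : ∀ (f : ι → Site A) (f' : ι' → Site A), (∀ i, (f i).1 = p i + v) →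
    (∀ i, (f' i).1 = p' i + v) → ∃ α ∈ spectrum ℂ ((iterLimit C Q).submatrix f f),
      ∃ β ∈ spectrum ℂ ((iterLimit C Q).submatrix f' f'), ‖z + α - β‖ < θ

theorem sum_norm_le {C : List (Fin d → ℤ)} {cm : ℝ} (h : ∀ c ∈ C, ‖vec c‖ ≤ cm) :
    (C.map fun c => ‖vec c‖).sum ≤ C.length * cm := by
  have := List.sum_le_card_nsmul (C.map fun c => ‖vec c‖) cm (by
    intro x hx
    obtain ⟨c, hc, rfl⟩ := List.mem_map.mp hx
    exact h c hc)
  simpa using this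

/-- Eigenvalues of finite submatrices in the Lipschitz domain are close to those of the limit. -/
theorem exists_mem_spectrum_toplitzLimit {Λ : ℝ} {n : ℕ} {P P' : Mat A} {h : ℝ} (h0 : 0 ≤ h)
    (hP : lipNormN Λ (n + 1) P ≤ ENNReal.ofReal h) (hPh : P.IsHermitian) {c : Fin d → ℤ}
    (hc : c ≠ 0) (hlim : IsToplitzLimit 1 c P P') {ι : Type} [Fintype ι] [DecidableEq ι]
    {f : ι → Site A} (hf : ∀ i j, (f i, f j) ∈ lipDomain A Λ c) {cm R ε : ℝ} (hR : 0 < R)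
    (hcm : ‖vec c‖ ≤ cm) (hfR : ∀ i, R / 2 ≤ ‖vec (f i).1‖)
    (hε : Fintype.card ι * (2 * h * cm) ≤ ε * R) {α : ℂ}
    (hα : α ∈ spectrum ℂ (P.submatrix f f)) :
    ∃ β ∈ spectrum ℂ (P'.submatrix f f), ‖α - β‖ ≤ ε := by
  refine exists_mem_spectrum_near (hPh.submatrix f) ((hlim.isHermitian hc hPh).submatrix f)
    (fun u => ?_) hα
  rw [← form_sub]
  -- The Lipschitz weight gives entries of size at most `h|c|/|x|`, with `|x| ≥ R/2`.
  have hentry : ∀ i j, ‖(P.submatrix f f - P'.submatrix f f) i j‖ ≤ 2 * h * cm / R := by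
    intro i j
    have h1 := norm_sub_toplitzLimit_le h0 hP hc (hf i j)
    rw [hlim.toplitzLimit_eq] at h1
    rw [Matrix.sub_apply, Matrix.submatrix_apply, Matrix.submatrix_apply, le_div_iff₀ hR]
    have h2 := mul_le_mul_of_nonneg_right (hfR i) (norm_nonneg (P (f i) (f j) - P' (f i) (f j)))
    have h3 : h * ‖vec c‖ ≤ h * cm := by gcongr
    linarith
  refine (abs_form_le hentry u).trans (mul_le_mul_of_nonneg_right ?_ (nsq_nonneg u))
  rw [mul_div_assoc', div_le_iff₀ hR]
  exact hε

theorem norm_add_sub_lt {z α β α' β' : ℂ} {θ ε : ℝ} (h : ‖z + α - β‖ < θ) (hα : ‖α - α'‖ ≤ ε / 2)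
    (hβ : ‖β - β'‖ ≤ ε / 2) : ‖z + α' - β'‖ < θ + ε := by
  have : z + α' - β' = (z + α - β) - (α - α') + (β - β') := by ring
  rw [this]
  refine (norm_add_le _ _).trans_lt ?_
  have := norm_sub_le (z + α - β) (α - α')
  linarith

/-- While `a + v` is long, approximate it by a multiple of a short `c`. The bound `K` forces `c` to
be orthogonal to all differences in `S`; the field `reduced` forces `c` outside the span of `C`; the
Lipschitz domain allows the limit in direction `c`; and the invariance of that limit allows the
configuration to be translated until `reduced` holds for `c :: C`. -/
theorem Stage.step (hd : 1 ≤ d) {Q : Mat A} {ι ι' : Type} [Fintype ι] [Fintype ι'] [DecidableEq ι]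
    [DecidableEq ι'] {p : ι → Fin d → ℤ} {p' : ι' → Fin d → ℤ} {S : Finset (Fin d → ℤ)}
    {a : Fin d → ℤ} {z : ℂ} {T ρ Λ h K M R ε θ Nc cm : ℝ} {C : List (Fin d → ℤ)} {v : Fin d → ℤ}
    (hQ : IsNToplitz (d - 1) Q) (hQh : Q.IsHermitian) (h0 : 0 ≤ h)
    (hQn : lipNormN Λ (d - 1) Q ≤ ENNReal.ofReal h)
    (hp : ∀ i, p i ∈ S) (hp' : ∀ i, p' i ∈ S) (hSa : ∀ x ∈ S, ‖vec (x - a)‖ ≤ ρ)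
    (hSd : ∀ x ∈ S, ∀ y ∈ S, ‖vec (x - y)‖ ≤ ρ) (hSn : ∃ x ∈ S, ∃ y ∈ S, x ≠ y)
    (hK : ∀ x ∈ S, ∀ y ∈ S, |inner ℝ (vec a) (vec (x - y))| ≤ K)
    (hΛ : 0 ≤ Λ) (hρ : 0 ≤ ρ) (hT4 : 4 ≤ T) (hT : 2 * (1 + ρ) ≤ T) (hT1 : 2 * Λ * (1 + ρ) ≤ T)
    (hT2 : 4 * Λ ^ 2 ≤ T) (hcm : approxConst d * T ^ d ≤ cm) (hM : (d + S.card * A.card) * cm ≤ M)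
    (hR1 : approxConst d * T ^ (2 * d + 1) ≤ R) (hR2 : 2 * K * cm ≤ R)
    (hR3 : 2 * M ≤ R) (hRpos : 0 < R) (hNc : (Fintype.card ι : ℝ) ≤ Nc)
    (hNc' : (Fintype.card ι' : ℝ) ≤ Nc)
    (hR4 : Nc * (2 * h * cm) ≤ ε / 2 * R)
    (hst : Stage Q p p' S a z cm M C v θ) (hC : C.length ≤ d - 1)
    (hav : R < ‖vec (a + v)‖) :
    C.length + 1 ≤ d - 1 ∧
      ∃ c v', Stage Q p p' S a z cm M (c :: C) v' (θ + ε) := by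
  classical
  have hcm0 : 0 ≤ cm := le_trans (by unfold approxConst; positivity) hcm
  obtain ⟨c, a', t, hc0, hccm', hac, hTc⟩ := exists_direction_approx hd (T := T) (by linarith)
    (a := a + v) (hR1.trans hav.le)
  have hccm := hccm'.trans hcm
  have hnear : NearMultiple T (a + v) a' c t := ⟨hc0, hac, hTc⟩
  -- Earlier translations are orthogonal to the differences, so `⟨a + v, x - y⟩ = ⟨a, x - y⟩` and
  -- `K` never deteriorates.
  have horthv : ∀ x ∈ S, ∀ y ∈ S, inner ℝ (vec v) (vec (x - y)) = 0 := fun x hx y hy =>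
    inner_eq_zero_of_mem_realSpan (fun c hc => hst.orth c hc x hx y hy) (vec_mem_realSpan hst.mem)
  have hcorth : ∀ x ∈ S, ∀ y ∈ S, inner ℝ (vec c) (vec (x - y)) = 0 := by
    intro x hx y hy
    refine hnear.inner_eq_zero hT (hSd x hx y hy) (K := K) ?_ ?_
    · rw [vec_add, inner_add_left, horthv x hx y hy, add_zero]
      exact hK x hx y hy
    · have hK0 : 0 ≤ K := (abs_nonneg _).trans (hK x hx y hy)
      have : 2 * K * ‖vec c‖ ≤ 2 * K * cm :=
        mul_le_mul_of_nonneg_left hccm (mul_nonneg zero_le_two hK0)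
      linarith
  have hcnot : vec c ∉ realSpan C := hnear.notMem_of_inner_le hT4 hst.reduced (by linarith)
  have hlt : realSpan C < realSpan (c :: C) := by
    rw [realSpan_cons]
    refine lt_of_le_of_ne le_sup_right fun heq => hcnot ?_
    rw [heq]
    exact (le_sup_left : Submodule.span ℝ {vec c} ≤ _) (Submodule.mem_span_singleton_self _)
  have hrank := Submodule.finrank_lt_finrank_of_lt hlt
  have horth' : ∀ b ∈ c :: C, ∀ x ∈ S, ∀ y ∈ S, inner ℝ (vec b) (vec (x - y)) = 0 := by
    intro b hb
    rcases List.mem_cons.mp hb with rfl | hb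
    · exact hcorth
    · exact hst.orth b hb
  -- The independent directions lie in the hyperplane orthogonal to some `x - y ≠ 0`. Without two
  -- distinct points in `S` the bound would be `d`, one more than the available Töplitz order.
  have hlen : C.length + 1 ≤ d - 1 := by
    obtain ⟨x, hx, y, hy, hxy⟩ := hSn
    have hle : realSpan (c :: C) ≤ (Submodule.span ℝ {vec (x - y)})ᗮ := by
      intro w hw
      rw [Submodule.mem_orthogonal_singleton_iff_inner_left]
      exact inner_eq_zero_of_mem_realSpan (fun b hb => horth' b hb x hx y hy) hw
    have h1 := Submodule.finrank_mono hle
    have h2 := Submodule.finrank_add_finrank_orthogonal (Submodule.span ℝ {vec (x - y)})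
    rw [finrank_span_singleton (vec_ne_zero (sub_ne_zero.mpr hxy)), finrank_euclideanSpace,
      Fintype.card_fin] at h2
    have h3 := hst.length_le
    omega
  refine ⟨hlen, c, ?_⟩
  have hne' : ∀ b ∈ c :: C, b ≠ 0 := by
    intro b hb
    rcases List.mem_cons.mp hb with rfl | hb
    · exact hc0
    · exact hst.ne_zero b hb
  have hshort' : ∀ b ∈ c :: C, ‖vec b‖ ≤ cm := by
    intro b hb
    rcases List.mem_cons.mp hb with rfl | hb
    · exact hccm
    · exact hst.short b hb
  obtain ⟨u, hu, huA, hured⟩ := exists_reduced_translate (S.image fun x => x + v) A hc0 C (a + v)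
  have hinv := invariant_iterLimit hQ hne' (by simpa using hlen) hu
  have hlim := isToplitzLimit_iterLimit (c := c) C (by omega) hQ
  have hherm := isHermitian_iterLimit hQ hQh hst.ne_zero (by omega)
  obtain ⟨n, hn⟩ : ∃ n, d - 1 = n + 1 + C.length := ⟨d - 1 - 1 - C.length, by omega⟩
  have hnorm : lipNormN Λ (n + 1) (iterLimit C Q) ≤ ENNReal.ofReal h := by
    refine (lipNormN_iterLimit_le C).trans ?_
    rw [← hn]
    exact hQn
  refine ⟨v + u, hne', hshort', ?_, horth', add_mem (intSpan_le_cons c C hst.mem) hu, ?_, ?_, ?_⟩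
  · rw [List.length_cons]
    have := hst.length_le
    omega
  · intro x hx
    rw [← add_assoc]
    exact huA _ (Finset.mem_image_of_mem _ hx)
  · intro w hw
    rw [← add_assoc]
    refine (hured w hw).trans (mul_le_mul_of_nonneg_right ?_ (norm_nonneg w))
    refine le_trans ?_ hM
    have h1 := sum_norm_le hshort'
    have h2 : ((c :: C).length : ℝ) ≤ d := by
      rw [List.length_cons]; exact_mod_cast (by omega : C.length + 1 ≤ d)
    have h3 : ((S.image fun x => x + v).card : ℝ) ≤ S.card := by exact_mod_cast Finset.card_image_le
    have h4 : ((c :: C).length : ℝ) * cm ≤ d * cm :=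
      mul_le_mul_of_nonneg_right h2 hcm0
    have h5 : ((S.image fun x => x + v).card : ℝ) * A.card * ‖vec c‖ ≤ S.card * A.card * cm :=
      mul_le_mul (mul_le_mul_of_nonneg_right h3 (Nat.cast_nonneg _)) hccm (norm_nonneg _)
        (mul_nonneg (Nat.cast_nonneg _) (Nat.cast_nonneg _))
    rw [add_mul]
    linarith
  · intro f f' hf hf'
    let g : ι → Site A := fun i => ⟨p i + v, hst.avoid _ (hp i)⟩
    let g' : ι' → Site A := fun i => ⟨p' i + v, hst.avoid _ (hp' i)⟩
    obtain ⟨α, hα, β, hβ, hαβ⟩ := hst.resonant g g' (fun _ => rfl) (fun _ => rfl)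
    have hclose : ∀ x ∈ S, ‖vec (x + v - (a + v))‖ ≤ ρ := by
      intro x hx
      rw [add_sub_add_right_eq_sub]
      exact hSa x hx
    have hbig : ∀ x ∈ S, R / 2 ≤ ‖vec (x + v)‖ := by
      intro x hx
      have := hnear.half_norm_le hρ hT (hclose x hx)
      linarith
    have hcard : ∀ {N : ℝ}, N ≤ Nc → N * (2 * h * cm) ≤ ε / 2 * R := fun hN =>
      le_trans (mul_le_mul_of_nonneg_right hN (mul_nonneg (mul_nonneg zero_le_two h0) hcm0)) hR4
    obtain ⟨α', hα', hαα'⟩ := exists_mem_spectrum_toplitzLimit h0 hnorm hherm hc0 hlim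
      (f := g) (fun i j => hnear.mem_lipDomain hΛ hρ hT hT1 hT2 (hclose _ (hp i)) (hclose _ (hp j)))
      hRpos hccm (fun i => hbig _ (hp i)) (hcard hNc) hα
    obtain ⟨β', hβ', hββ'⟩ := exists_mem_spectrum_toplitzLimit h0 hnorm hherm hc0 hlim
      (f := g') (fun i j => hnear.mem_lipDomain hΛ hρ hT hT1 hT2 (hclose _ (hp' i))
        (hclose _ (hp' j)))
      hRpos hccm (fun i => hbig _ (hp' i)) (hcard hNc') hβ
    -- The sites of `f` are those of `g` translated by `u`, under which the new limit is invariant.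
    have e1 : (iterLimit (c :: C) Q).submatrix f f = (iterLimit (c :: C) Q).submatrix g g := by
      ext i j
      exact hinv _ _ _ _ (by rw [hf]; simp only [g]; abel) (by rw [hf]; simp only [g]; abel)
    have e2 : (iterLimit (c :: C) Q).submatrix f' f' = (iterLimit (c :: C) Q).submatrix g' g' := by
      ext i j
      exact hinv _ _ _ _ (by rw [hf']; simp only [g']; abel) (by rw [hf']; simp only [g']; abel)
    rw [e1, e2]
    exact ⟨α', hα', β', hβ', norm_add_sub_lt hαβ hαα' hββ'⟩

theorem Stage.mono {Q : Mat A} {ι ι' : Type} [Fintype ι] [Fintype ι'] [DecidableEq ι]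
    [DecidableEq ι'] {p : ι → Fin d → ℤ} {p' : ι' → Fin d → ℤ} {S : Finset (Fin d → ℤ)}
    {a : Fin d → ℤ} {z : ℂ} {cm M θ θ' : ℝ} {C : List (Fin d → ℤ)} {v : Fin d → ℤ}
    (h : Stage Q p p' S a z cm M C v θ) (hθ : θ ≤ θ') : Stage Q p p' S a z cm M C v θ' :=
  { h with
    resonant := fun f f' hf hf' => by
      obtain ⟨α, hα, β, hβ, hαβ⟩ := h.resonant f f' hf hf'
      exact ⟨α, hα, β, hβ, hαβ.trans_le hθ⟩ }

end Descent

/-! ### Blocks as components of the lattice -/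

section Components

variable {d : ℕ} {A : Finset (Fin d → ℤ)}

/-- A predicate on lists that can be extended as long as a bound is exceeded holds for some list
for which the bound is met. -/
theorem exists_maximal_extension {α β : Type*} {m : ℕ} {P : List α → β → Prop}
    {big : ℕ → β → Prop}
    (hstep : ∀ C v, C.length ≤ m → P C v → big C.length v →
      C.length + 1 ≤ m ∧ ∃ c v', P (c :: C) v') {C : List α} {v : β} (hC : C.length ≤ m)
    (hP : P C v) : ∃ C' v', C.length ≤ C'.length ∧ C'.length ≤ m ∧ P C' v' ∧ ¬ big C'.length v' := by
  induction hn : m - C.length generalizing C v with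
  | zero =>
    refine ⟨C, v, le_rfl, hC, hP, fun hbig => ?_⟩
    have := (hstep C v hC hP hbig).1
    omega
  | succ n ih =>
    by_cases hbig : big C.length v
    · obtain ⟨hlen, c, v', hP'⟩ := hstep C v hC hP hbig
      obtain ⟨C', w, h1, h2, h3⟩ := ih (C := c :: C) (by simpa using hlen) hP' (by simp; omega)
      exact ⟨C', w, by simp at h1; omega, h2, h3⟩
    · exact ⟨C, v, le_rfl, hC, hP, hbig⟩

/-- Integer vectors of equal length at distance at most `Δ`, with difference orthogonal to `C`. -/
def Linked (Δ : ℕ) (C : List (Fin d → ℤ)) (x y : Fin d → ℤ) : Prop :=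
  ‖vec x‖ ^ 2 = ‖vec y‖ ^ 2 ∧ ‖vec (x - y)‖ ≤ Δ ∧ ∀ c ∈ C, inner ℝ (vec c) (vec (x - y)) = 0

/-- The component of `a` for the relation `Linked Δ C`. -/
def component (Δ : ℕ) (C : List (Fin d → ℤ)) (a : Fin d → ℤ) : Set (Fin d → ℤ) :=
  {x | Relation.ReflTransGen (Linked Δ C) a x}

theorem norm_eq_of_mem_component {Δ : ℕ} {C : List (Fin d → ℤ)} {a x : Fin d → ℤ}
    (h : x ∈ component Δ C a) : ‖vec x‖ = ‖vec a‖ := by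
  have h' : Relation.ReflTransGen (Linked Δ C) a x := h
  induction h' with
  | refl => rfl
  | tail _ hyz ih =>
    rw [← ih ‹_›, ← sq_eq_sq₀ (norm_nonneg _) (norm_nonneg _)]
    exact hyz.1.symm

variable (A) in
/-- The sites in the component of `a`. -/
abbrev CompSite (Δ : ℕ) (C : List (Fin d → ℤ)) (a : Fin d → ℤ) : Type :=
  {x : Site A // x.1 ∈ component Δ C a}

noncomputable instance (Δ : ℕ) (C : List (Fin d → ℤ)) (a : Fin d → ℤ) :
    Fintype (CompSite A Δ C a) := by
  have : Finite (CompSite A Δ C a) := by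
    refine Finite.of_injective (β := {x // x ∈ cube (Fin d) ‖vec a‖})
      (fun x => ⟨x.1.1, mem_cube (norm_eq_of_mem_component x.2).le⟩) fun x y h => ?_
    have h' := congrArg Subtype.val h
    exact Subtype.ext (Subtype.ext h')
  exact Fintype.ofFinite _

/-- Because `x - y` is orthogonal to `v`, adding `v` changes `|x|²` and `|y|²` by the same amount.
-/
theorem Linked.translate {Δ : ℕ} {C : List (Fin d → ℤ)} {x y v : Fin d → ℤ}
    (h : Linked Δ C x y) (hv : v ∈ intSpan C) : Linked Δ C (x + v) (y + v) := by
  refine ⟨?_, by rw [add_sub_add_right_eq_sub]; exact h.2.1,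
    by rw [add_sub_add_right_eq_sub]; exact h.2.2⟩
  have h1 := inner_eq_zero_of_mem_realSpan h.2.2 (vec_mem_realSpan hv)
  rw [vec_sub, inner_sub_right] at h1
  rw [vec_add, vec_add, norm_add_sq_real, norm_add_sq_real, h.1, real_inner_comm (vec v) (vec x),
    real_inner_comm (vec v) (vec y)]
  linarith

/-- A translated block need not be a block, but it is recovered from `C` and its base point `a + v`
alone. Limit resonances are thereby indexed by finitely many data near the origin, with no memory of
the original block. -/
theorem mem_component_translate {Δ : ℕ} {C : List (Fin d → ℤ)} {a y v : Fin d → ℤ}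
    (hv : v ∈ intSpan C)
    (horth : ∀ c ∈ C, ∀ x ∈ component Δ [] a, ∀ y ∈ component Δ [] a,
      inner ℝ (vec c) (vec (x - y)) = 0) :
    y + v ∈ component Δ C (a + v) ↔ y ∈ component Δ [] a := by
  constructor
  · intro h
    have h1 : ∀ z, Relation.ReflTransGen (Linked Δ C) (a + v) z →
        Relation.ReflTransGen (Linked Δ []) a (z - v) := by
      intro z hz
      induction hz with
      | refl => rw [add_sub_cancel_right]
      | tail _ hyz ih =>
        refine ih.tail ?_
        have := hyz.translate (neg_mem hv)
        rw [← sub_eq_add_neg, ← sub_eq_add_neg] at this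
        exact ⟨this.1, this.2.1, by simp⟩
    have := h1 _ h
    rwa [add_sub_cancel_right] at this
  · intro h
    have h' : Relation.ReflTransGen (Linked Δ []) a y := h
    induction h' with
    | refl => exact Relation.ReflTransGen.refl
    | @tail y z hay hyz ih =>
      refine (ih hay).tail (Linked.translate ⟨hyz.1, hyz.2.1, fun c hc => ?_⟩ hv)
      exact horth c hc y hay z h

/-- Components live in all of `ℤ^d`, blocks only off `A`. A link leaving the block ends within `δ +
Δ` of `a`, so it cannot enter `A`. -/
theorem mem_component_iff_mem_block {Δ : ℕ} {a : Site A} {δ : ℝ}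
    (hδ : ∀ x ∈ block Δ a, ‖vec (x.1 - a.1)‖ ≤ δ) (hfar : ∀ p ∈ A, δ + Δ < ‖vec (p - a.1)‖)
    (x : Fin d → ℤ) : x ∈ component Δ [] a.1 ↔ ∃ h : x ∉ A, (⟨x, h⟩ : Site A) ∈ block Δ a := by
  constructor
  · intro h
    have h' : Relation.ReflTransGen (Linked Δ []) a.1 x := h
    induction h' with
    | refl => exact ⟨a.2, Relation.EqvGen.refl _⟩
    | @tail y z hay hyz ih =>
      obtain ⟨hyA, hy⟩ := ih hay
      have hzA : z ∉ A := by
        intro hz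
        have h1 := hfar z hz
        have h2 : vec (z - a.1) = vec (y - a.1) - vec (y - z) := by
          rw [← vec_sub]; congr 1; abel
        have h3 := norm_sub_le (vec (y - a.1)) (vec (y - z))
        have h4 := hδ _ hy
        have h5 := hyz.2.1
        rw [← h2] at h3
        simp only at h4
        linarith
      exact ⟨hzA, Relation.EqvGen.trans _ _ _ hy (Relation.EqvGen.rel _ _ ⟨hyz.1, hyz.2.1⟩)⟩
  · rintro ⟨hx, h⟩
    have hsymm : Std.Symm (Linked (d := d) Δ []) := ⟨fun x y h =>
      ⟨h.1.symm, by rw [vec_sub, norm_sub_rev, ← vec_sub]; exact h.2.1, by simp⟩⟩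
    have key : ∀ u w : Site A, Relation.EqvGen (PreEquiv Δ) u w →
        Relation.ReflTransGen (Linked Δ []) u.1 w.1 := by
      intro u w huw
      induction huw with
      | rel u w h => exact Relation.ReflTransGen.single ⟨h.1, h.2, by simp⟩
      | refl u => exact Relation.ReflTransGen.refl
      | symm u w _ ih => exact Relation.ReflTransGen.stdSymm.symm _ _ ih
      | trans u w z _ _ h1 h2 => exact h1.trans h2
    exact key _ _ h

theorem norm_sub_le_blockDiam {Δ : ℕ} (hfin : blockDiam A Δ ≠ ⊤) {a x y : Site A}
    (hx : x ∈ block Δ a) (hy : y ∈ block Δ a) : ‖vec (x.1 - y.1)‖ ≤ (blockDiam A Δ).toReal := by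
  have h1 : edist (vec x.1) (vec y.1) ≤ blockDiam A Δ :=
    (Metric.edist_le_ediam_of_mem (Set.mem_image_of_mem _ hx) (Set.mem_image_of_mem _ hy)).trans
      (le_iSup (fun a : Site A => Metric.ediam ((fun b : Site A => vec b.1) '' block Δ a)) a)
  rw [vec_sub, ← dist_eq_norm, dist_edist]
  exact ENNReal.toReal_mono hfin h1

theorem exists_mem_block_near {Δ : ℕ} {a b : Site A} {Δ' : ℝ} (hΔ' : 0 ≤ Δ')
    (h : setDist (block Δ a) (block Δ b) ≤ ENNReal.ofReal Δ') :
    ∃ x ∈ block Δ a, ∃ y ∈ block Δ b, ‖vec (x.1 - y.1)‖ ≤ Δ' := by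
  obtain ⟨⟨x, y⟩, hxy, hmin⟩ := Set.exists_min_image (block Δ a ×ˢ block Δ b)
    (fun q => edist (vec q.1.1) (vec q.2.1)) ((finite_block Δ a).prod (finite_block Δ b))
    ⟨(a, b), Relation.EqvGen.refl _, Relation.EqvGen.refl _⟩
  refine ⟨x, hxy.1, y, hxy.2, ?_⟩
  have h1 : edist (vec x.1) (vec y.1) ≤ ENNReal.ofReal Δ' :=
    le_trans (le_iInf₂ fun u hu => le_iInf₂ fun w hw => hmin (u, w) ⟨hu, hw⟩) h
  rw [edist_dist, ENNReal.ofReal_le_ofReal_iff hΔ', dist_eq_norm, ← vec_sub] at h1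
  exact h1

/-- The range `Δ` of the block relation exceeds the block diameter by at most one. -/
theorem le_blockDiam_add_one (hd : 2 ≤ d) {Δ : ℕ} (hfin : blockDiam A Δ ≠ ⊤) :
    (Δ : ℝ) ≤ (blockDiam A Δ).toReal + 1 := by
  classical
  obtain ⟨e, rfl⟩ : ∃ e, d = e + 2 := ⟨d - 2, by omega⟩
  -- The points `(±m, t, 0, …)`, with `t` chosen to avoid `A`, have equal norms and distance `2m ≤
  -- Δ`, so they share a block; the parity of `Δ` accounts for the extra one.
  set m : ℕ := Δ / 2
  let w : ℤ → (Fin (e + 2) → ℤ) := fun s => Pi.single 0 s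
  let c : Fin (e + 2) → ℤ := Pi.single 1 1
  have hc : c ≠ 0 := fun h => by simpa [c] using congrFun h 1
  obtain ⟨t, ht1, ht2⟩ := ((eventually_add_smul_notMem A hc (w m)).and
    (eventually_add_smul_notMem A hc (w (-m)))).exists
  have hnorm : ∀ s : ℤ, ‖vec (w s + (t : ℤ) • c)‖ ^ 2 = (s : ℝ) ^ 2 + (t : ℝ) ^ 2 := by
    intro s
    rw [EuclideanSpace.norm_sq_eq, Fin.sum_univ_succ, Fin.sum_univ_succ]
    have h3 : ∀ i : Fin e, (vec (w s + (t : ℤ) • c)) i.succ.succ = 0 := by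
      intro i
      have h5 : i.succ.succ ≠ (1 : Fin (e + 2)) := Fin.succ_succ_ne_one i
      simp [vec, w, c, Pi.single_eq_of_ne h5]
    simp only [h3]
    simp [vec, w, c]
  have hdiff : ‖vec ((w m + (t : ℤ) • c) - (w (-m) + (t : ℤ) • c))‖ = 2 * m := by
    have : (w m + (t : ℤ) • c) - (w (-m) + (t : ℤ) • c) = (m : ℤ) • Pi.single 0 2 := by
      ext i
      simp only [w, Pi.add_apply, Pi.sub_apply, Pi.smul_apply, Pi.single_apply]
      split_ifs <;> simp; ring
    have h2 : vec (Pi.single 0 2 : Fin (e + 2) → ℤ) = EuclideanSpace.single 0 (2 : ℝ) := by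
      ext i
      simp only [vec, Pi.single_apply, PiLp.single_apply]
      split_ifs <;> simp
    rw [this, vec_zsmul, norm_smul, h2]
    simp
    ring
  have hm : 2 * (m : ℝ) ≤ Δ := by exact_mod_cast (by omega : 2 * (Δ / 2) ≤ Δ)
  have hmem : (⟨_, ht2⟩ : Site A) ∈ block Δ (⟨_, ht1⟩ : Site A) := by
    refine Relation.EqvGen.rel _ _ ⟨?_, ?_⟩
    · simp only [hnorm]; push_cast; ring
    · simp only [hdiff]; exact hm
  have := norm_sub_le_blockDiam hfin (Relation.EqvGen.refl _ : (⟨_, ht1⟩ : Site A) ∈ block Δ _) hmem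
  simp only [hdiff] at this
  have h4 : (Δ : ℝ) ≤ 2 * m + 1 := by exact_mod_cast (by omega : Δ ≤ 2 * (Δ / 2) + 1)
  linarith

theorem card_le_of_pairwise_norm_sub_le {d : ℕ} {ι : Type*} [Fintype ι] {p : ι → Fin d → ℤ}
    (hp : Function.Injective p) {a : Fin d → ℤ} {r : ℝ} (hr : 1 ≤ r)
    (h : ∀ i, ‖vec (p i - a)‖ ≤ r) : (Fintype.card ι : ℝ) ≤ (3 * r) ^ d := by
  have h1 : Fintype.card ι ≤ (cube (Fin d) r).card := by
    rw [← Finset.card_univ]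
    refine Finset.card_le_card_of_injOn (fun i => p i - a) (fun i _ => mem_cube (h i)) ?_
    intro i _ j _ hij
    exact hp (sub_left_injective hij)
  have h2 := card_cube_le (ι := Fin d) hr
  rw [Fintype.card_fin] at h2
  exact le_trans (by exact_mod_cast h1) h2

end Components

/-! ### Resonant sets of blocks and of limit components -/

section Cover

variable {d : ℕ} {A : Finset (Fin d → ℤ)}

/-- The parameters with a resonance between the limits at infinity of two components. -/
noncomputable def limitResonantSet (U : Set (Param A)) (H : Param A → Mat A) (Δ : ℕ)
    (k : {a : Fin d → ℤ // a ∈ A} → ℤ) (C : List (Fin d → ℤ)) (a b : Fin d → ℤ) (θ : ℝ) :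
    Set (Param A) :=
  resonantSet U k (‖vec a‖ ^ 2 - ‖vec b‖ ^ 2) θ
    (fun ω => (iterLimit C (H ω)).submatrix (fun x : CompSite A Δ C a => x.1) fun x => x.1)
    (fun ω => (iterLimit C (H ω)).submatrix (fun x : CompSite A Δ C b => x.1) fun x => x.1)

/-- The parameters with a resonance between two blocks. -/
noncomputable def blockResonantSet (U : Set (Param A)) (Ω : Param A → Site A → ℝ)
    (H : Param A → Mat A) (Δ : ℕ) (k : {a : Fin d → ℤ // a ∈ A} → ℤ) (a b : Site A) (θ : ℝ) :
    Set (Param A) :=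
  resonantSet U k 0 θ (fun ω => blockRestrict (hamMat Ω H ω) Δ a)
    fun ω => blockRestrict (hamMat Ω H ω) Δ b

/-- The parameters with `⟨k,ω⟩` small. -/
noncomputable def scalarResonantSet (U : Set (Param A)) (k : {a : Fin d → ℤ // a ∈ A} → ℤ)
    (θ : ℝ) : Set (Param A) :=
  resonantSet U k 0 θ (fun _ => (0 : Matrix Unit Unit ℂ)) fun _ => (0 : Matrix Unit Unit ℂ)

/-- On sites where `Ω` is within `η` of the constant `r`, the form of `Ω + H` is within `η` of that
of `r + H`. With `r = |a|²` on a block, this removes `Ω` at infinity. -/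
theorem exists_mem_spectrum_of_hamMat {Ω : Param A → Site A → ℝ} {H : Param A → Mat A}
    {ω : Param A} (hH : (H ω).IsHermitian) {ι : Type} [Fintype ι] [DecidableEq ι] {f : ι → Site A}
    (hf : Function.Injective f) {r η : ℝ} (hΩ : ∀ i, |Ω ω (f i) - r| ≤ η) {α : ℂ}
    (hα : α ∈ spectrum ℂ ((hamMat Ω H ω).submatrix f f)) :
    ∃ β ∈ spectrum ℂ ((H ω).submatrix f f), ‖α - (r + β)‖ ≤ η := by
  have h1 : (hamMat Ω H ω).submatrix f f =
      Matrix.diagonal (fun i => ((Ω ω (f i) : ℝ) : ℂ)) + (H ω).submatrix f f := by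
    ext i j
    simp [hamMat, Matrix.diagonal_apply, hf.eq_iff]
  have hdiag : ∀ g : ι → ℝ, (Matrix.diagonal fun i => (g i : ℂ)).IsHermitian := fun g => by
    rw [Matrix.isHermitian_diagonal_iff]
    intro i
    simp [isSelfAdjoint_iff]
  have hform : ∀ u, |form ((hamMat Ω H ω).submatrix f f) u -
      form (Matrix.diagonal (fun _ : ι => ((r : ℝ) : ℂ)) + (H ω).submatrix f f) u| ≤
      η * nsq u := by
    intro u
    rw [h1, form_add, form_add, form_diagonal, form_diagonal, add_sub_add_right_eq_sub,
      ← Finset.sum_sub_distrib, nsq, Finset.mul_sum]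
    refine (Finset.abs_sum_le_sum_abs _ _).trans (Finset.sum_le_sum fun i _ => ?_)
    rw [← sub_mul, abs_mul, abs_of_nonneg (sq_nonneg ‖u i‖)]
    exact mul_le_mul_of_nonneg_right (hΩ i) (sq_nonneg _)
  obtain ⟨β, hβ, hαβ⟩ := exists_mem_spectrum_near
    (by rw [h1]; exact (hdiag _).add (hH.submatrix f)) ((hdiag fun _ => r).add (hH.submatrix f))
    hform hα
  refine ⟨β - r, ?_, by simpa using hαβ⟩
  have h2 : (H ω).submatrix f f = algebraMap ℂ _ (-r : ℂ) +
      (Matrix.diagonal (fun _ : ι => ((r : ℝ) : ℂ)) + (H ω).submatrix f f) := by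
    rw [Matrix.algebraMap_eq_diagonal, ← add_assoc, Matrix.diagonal_add]
    simp
  rw [h2, sub_eq_add_neg]
  exact spectrum.add_mem_add_iff.mpr hβ

theorem norm_le_of_mem_spectrum {ι : Type} [Fintype ι] [DecidableEq ι] {M : Matrix ι ι ℂ}
    (hM : M.IsHermitian) {h : ℝ} (hh : ∀ i j, ‖M i j‖ ≤ h) {α : ℂ} (hα : α ∈ spectrum ℂ M) :
    ‖α‖ ≤ Fintype.card ι * h := by
  obtain ⟨β, hβ, hαβ⟩ := exists_mem_spectrum_near hM (N := 0) Matrix.isHermitian_zero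
    (ε := Fintype.card ι * h) (fun u => by
      rw [← form_sub, sub_zero]
      exact abs_form_le hh u) hα
  rcases isEmpty_or_nonempty ι with hι | hι
  · rw [spectrum.of_subsingleton] at hβ
    exact absurd hβ (Set.notMem_empty _)
  · rw [spectrum.zero_eq, Set.mem_singleton_iff] at hβ
    rwa [hβ, sub_zero] at hαβ

theorem eq_of_mem_spectrum_of_subsingleton {ι : Type} [Fintype ι] [DecidableEq ι] [Subsingleton ι]
    {M : Matrix ι ι ℂ} {α β : ℂ} (hα : α ∈ spectrum ℂ M) (hβ : β ∈ spectrum ℂ M) : α = β := by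
  rcases isEmpty_or_nonempty ι with hι | ⟨⟨i⟩⟩
  · rw [spectrum.of_subsingleton] at hβ
    exact absurd hβ (Set.notMem_empty _)
  · have : Nonempty ι := ⟨i⟩
    have h1 : M = algebraMap ℂ _ (M i i) := by
      ext x y
      rw [Subsingleton.elim x i, Subsingleton.elim y i]
      simp [Matrix.algebraMap_matrix_apply]
    rw [h1, spectrum.scalar_eq, Set.mem_singleton_iff] at hα hβ
    rw [hα, hβ]

/-- The relations between the scales in one step of the reduction at infinity. -/
structure Scales (d n : ℕ) (C₁ C₂ C₃ Λ h D T K M Nc cm R ε : ℝ) : Prop where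
  one_le : 1 ≤ D
  cutoff_nonneg : 0 ≤ Λ
  four_le : 4 ≤ T
  le_T : 2 * (1 + 3 * D) ≤ T
  cutoff_le_T : 2 * Λ * (1 + 3 * D) ≤ T
  sq_le_T : 4 * Λ ^ 2 ≤ T
  le_cm : approxConst d * T ^ d ≤ cm
  le_Nc : (9 * D) ^ d ≤ Nc
  le_M : (d + 2 * Nc * n) * cm ≤ M
  le_K : 1 + D * C₁ + 2 * |C₂| + 2 * (Nc * h) + 18 * D ^ 2 ≤ K
  pos_R : 0 < R
  le_R : 6 * D ≤ R
  approx_le_R : approxConst d * T ^ (2 * d + 1) ≤ R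
  K_le_R : 2 * K * cm ≤ R
  M_le_R : 2 * M ≤ R
  error_le : Nc * (2 * h * cm) ≤ ε / 2 * R
  exp_le : 2 * |C₂| / C₃ ≤ ε / 2 * R

/-- From `exp(C₃x) ≥ C₃x`: decay of order `1/x` is enough, as it matches the Lipschitz error. -/
theorem mul_exp_neg_le {C₂ C₃ x η : ℝ} (hC₃ : 0 < C₃) (hx : 0 < x) (h : |C₂| / C₃ ≤ η * x) :
    C₂ * Real.exp (-C₃ * x) ≤ η := by
  have h1 : C₃ * x ≤ Real.exp (C₃ * x) := (le_add_of_nonneg_right zero_le_one).trans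
    (Real.add_one_le_exp _)
  have hpos : 0 < C₃ * x := mul_pos hC₃ hx
  rw [neg_mul, Real.exp_neg]
  calc C₂ * (Real.exp (C₃ * x))⁻¹ ≤ |C₂| * (C₃ * x)⁻¹ := by
        gcongr
        exact le_abs_self _
    _ = |C₂| / C₃ / x := by rw [mul_inv]; ring
    _ ≤ η := by rwa [div_le_iff₀ hx]

/-- A stage of the reduction gives a resonance between limit components. -/
theorem Stage.mem_limitResonantSet {U : Set (Param A)} {H : Param A → Mat A} {Δ : ℕ}
    {k : {a : Fin d → ℤ // a ∈ A} → ℤ} {ω : Param A} (hω : ω ∈ U) {a b : Site A}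
    {S : Finset (Fin d → ℤ)} {cm M θ : ℝ} {C : List (Fin d → ℤ)} {v : Fin d → ℤ}
    (haS : ∀ x ∈ block Δ a, x.1 ∈ S) (hbS : ∀ x ∈ block Δ b, x.1 ∈ S)
    (ha : ∀ x, x ∈ component Δ [] a.1 ↔ ∃ h : x ∉ A, (⟨x, h⟩ : Site A) ∈ block Δ a)
    (hb : ∀ x, x ∈ component Δ [] b.1 ↔ ∃ h : x ∉ A, (⟨x, h⟩ : Site A) ∈ block Δ b)
    (hst : Stage (H ω) (fun i : block Δ a => i.1.1) (fun i : block Δ b => i.1.1) S a.1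
      ((inner ℝ (vec k) ω + (‖vec a.1‖ ^ 2 - ‖vec b.1‖ ^ 2) : ℝ) : ℂ) cm M C v θ) :
    ω ∈ limitResonantSet U H Δ k C (a.1 + v) (b.1 + v) θ ∧
      Fintype.card (CompSite A Δ C (a.1 + v)) = Fintype.card (block Δ a) ∧
      Fintype.card (CompSite A Δ C (b.1 + v)) = Fintype.card (block Δ b) := by
  have key : ∀ b : Site A, (∀ x ∈ block Δ b, x.1 ∈ S) →
      (∀ x, x ∈ component Δ [] b.1 ↔ ∃ h : x ∉ A, (⟨x, h⟩ : Site A) ∈ block Δ b) →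
      ∃ e : block Δ b ≃ CompSite A Δ C (b.1 + v), ∀ i, (e i).1.1 = i.1.1 + v := by
    intro b hbS hb
    have horth : ∀ c ∈ C, ∀ x ∈ component Δ [] b.1, ∀ y ∈ component Δ [] b.1,
        inner ℝ (vec c) (vec (x - y)) = 0 := by
      intro c hc x hx y hy
      obtain ⟨hxA, hx⟩ := (hb x).mp hx
      obtain ⟨hyA, hy⟩ := (hb y).mp hy
      exact hst.orth c hc x (hbS _ hx) y (hbS _ hy)
    let g : block Δ b → CompSite A Δ C (b.1 + v) := fun i =>
      ⟨⟨i.1.1 + v, hst.avoid _ (hbS _ i.2)⟩,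
        (mem_component_translate hst.mem horth).mpr ((hb _).mpr ⟨i.1.2, i.2⟩)⟩
    refine ⟨Equiv.ofBijective g ⟨fun i j hij => ?_, fun y => ?_⟩, fun i => rfl⟩
    · have h1 : i.1.1 + v = j.1.1 + v := congrArg (fun y => y.1.1) hij
      exact Subtype.ext (Subtype.ext (add_right_cancel h1))
    · have h1 : (y.1.1 - v) + v ∈ component Δ C (b.1 + v) := by
        rw [sub_add_cancel]; exact y.2
      obtain ⟨hA, hmem⟩ := (hb _).mp ((mem_component_translate hst.mem horth).mp h1)
      refine ⟨⟨⟨_, hA⟩, hmem⟩, Subtype.ext (Subtype.ext ?_)⟩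
      exact sub_add_cancel _ _
  obtain ⟨e, he⟩ := key a haS ha
  obtain ⟨e', he'⟩ := key b hbS hb
  refine ⟨⟨hω, ?_⟩, (Fintype.card_congr e).symm, (Fintype.card_congr e').symm⟩
  obtain ⟨α, hα, β, hβ, hαβ⟩ := hst.resonant (fun i => (e i).1) (fun i => (e' i).1) he he'
  have e1 : (iterLimit C (H ω)).submatrix (fun i => (e i).1) (fun i => (e i).1) =
      ((iterLimit C (H ω)).submatrix (fun x : CompSite A Δ C (a.1 + v) => x.1)
        fun x => x.1).submatrix e e := rfl
  have e2 : (iterLimit C (H ω)).submatrix (fun i => (e' i).1) (fun i => (e' i).1) =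
      ((iterLimit C (H ω)).submatrix (fun x : CompSite A Δ C (b.1 + v) => x.1)
        fun x => x.1).submatrix e' e' := rfl
  rw [e1, spectrum_submatrix_equiv] at hα
  rw [e2, spectrum_submatrix_equiv] at hβ
  refine ⟨α, hα, β, hβ, ?_⟩
  -- The translation is orthogonal to `a - b`, so the constant in the resonance can be read off the
  -- new base points.
  have hsq : ‖vec (a.1 + v)‖ ^ 2 - ‖vec (b.1 + v)‖ ^ 2 = ‖vec a.1‖ ^ 2 - ‖vec b.1‖ ^ 2 := by
    have h1 := inner_eq_zero_of_mem_realSpan (fun c hc => hst.orth c hc a.1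
      (haS a (Relation.EqvGen.refl _)) b.1 (hbS b (Relation.EqvGen.refl _)))
      (vec_mem_realSpan hst.mem)
    rw [vec_sub, inner_sub_right] at h1
    rw [vec_add, vec_add, norm_add_sq_real, norm_add_sq_real, real_inner_comm (vec v) (vec a.1),
      real_inner_comm (vec v) (vec b.1)]
    linarith
  rw [hsq]
  exact hαβ

end Cover

/-! ### Classification of a single resonance -/

section Pointwise

variable {d : ℕ} {A : Finset (Fin d → ℤ)}

theorem norm_vec_sub_comm (x y : Fin d → ℤ) : ‖vec (x - y)‖ = ‖vec (y - x)‖ := by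
  rw [vec_sub, vec_sub, norm_sub_rev]

theorem norm_vec_sub_le (x y z : Fin d → ℤ) :
    ‖vec (x - z)‖ ≤ ‖vec (x - y)‖ + ‖vec (y - z)‖ := by
  have : vec (x - z) = vec (x - y) + vec (y - z) := by rw [← vec_add]; congr 1; abel
  rw [this]
  exact norm_add_le _ _

/-- Points of two nearby blocks are close to each other. -/
theorem norm_sub_le_of_near_blocks {Δ : ℕ} (hfin : blockDiam A Δ ≠ ⊤) {D Δ' : ℝ}
    (hδ : (blockDiam A Δ).toReal ≤ D) (hΔ' : 0 ≤ Δ') (hΔ'D : Δ' ≤ D) {a b : Site A}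
    (hab : setDist (block Δ a) (block Δ b) ≤ ENNReal.ofReal Δ') {x y : Site A}
    (hx : x ∈ block Δ a ∨ x ∈ block Δ b) (hy : y ∈ block Δ a ∨ y ∈ block Δ b) :
    ‖vec (x.1 - y.1)‖ ≤ 3 * D := by
  have hD : 0 ≤ D := ENNReal.toReal_nonneg.trans hδ
  obtain ⟨u, hu, w, hw, huw⟩ := exists_mem_block_near hΔ' hab
  have key : ∀ x ∈ block Δ a, ∀ y ∈ block Δ b, ‖vec (x.1 - y.1)‖ ≤ 3 * D := by
    intro x hx y hy
    have h1 := norm_sub_le_blockDiam hfin hx hu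
    have h2 := norm_sub_le_blockDiam hfin hw hy
    have h3 := norm_vec_sub_le x.1 u.1 y.1
    have h4 := norm_vec_sub_le u.1 w.1 y.1
    linarith
  rcases hx with hx | hx <;> rcases hy with hy | hy
  · linarith [norm_sub_le_blockDiam hfin hx hy]
  · exact key x hx y hy
  · rw [norm_vec_sub_comm]; exact key y hy x hx
  · linarith [norm_sub_le_blockDiam hfin hx hy]

theorem norm_eq_of_mem_block {Δ : ℕ} {a x : Site A} (h : x ∈ block Δ a) : ‖vec x.1‖ = ‖vec a.1‖ :=
  ((sq_eq_sq₀ (norm_nonneg _) (norm_nonneg _)).mp (norm_vec_eq_of_mem_block h)).symm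

/-- A resonance of `(Ω + H)(ω)` bounds the difference of the squared norms. -/
theorem abs_sq_sub_sq_le_of_resonance {Ω : Param A → Site A → ℝ} {H : Param A → Mat A}
    {ω : Param A} (hH : (H ω).IsHermitian) {Δ : ℕ} {a b : Site A} {h C₁ c₂ D Nc κ : ℝ}
    (hh : ∀ x y, ‖H ω x y‖ ≤ h) (hh0 : 0 ≤ h) (hω : ‖ω‖ ≤ C₁)
    (hΩ : ∀ x : Site A, |Ω ω x - ‖vec x.1‖ ^ 2| ≤ c₂)
    {k : {a : Fin d → ℤ // a ∈ A} → ℤ} (hk : ‖vec k‖ ≤ D) (hκ : κ ≤ 1)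
    (ha : (Fintype.card (block Δ a) : ℝ) ≤ Nc) (hb : (Fintype.card (block Δ b) : ℝ) ≤ Nc)
    {α β : ℂ} (hα : α ∈ spectrum ℂ (blockRestrict (hamMat Ω H ω) Δ a))
    (hβ : β ∈ spectrum ℂ (blockRestrict (hamMat Ω H ω) Δ b))
    (hres : ‖((inner ℝ (vec k) ω : ℝ) : ℂ) + α - β‖ < κ) :
    |‖vec a.1‖ ^ 2 - ‖vec b.1‖ ^ 2| ≤ 1 + D * C₁ + 2 * c₂ + 2 * (Nc * h) := by
  have key : ∀ b : Site A, (Fintype.card (block Δ b) : ℝ) ≤ Nc →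
      ∀ β ∈ spectrum ℂ (blockRestrict (hamMat Ω H ω) Δ b),
        ‖β - ((‖vec b.1‖ ^ 2 : ℝ) : ℂ)‖ ≤ c₂ + Nc * h := by
    intro b hb β hβ
    obtain ⟨γ, hγ, hβγ⟩ := exists_mem_spectrum_of_hamMat hH (f := fun i : block Δ b => i.1)
      Subtype.val_injective (r := ‖vec b.1‖ ^ 2) (η := c₂)
      (fun i => by rw [← norm_eq_of_mem_block i.2]; exact hΩ i.1) hβ
    have h1 := norm_le_of_mem_spectrum (hH.submatrix Subtype.val) (fun i j => hh _ _) hγ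
    have h2 : (Fintype.card (block Δ b) : ℝ) * h ≤ Nc * h := by gcongr
    have h3 : β - ((‖vec b.1‖ ^ 2 : ℝ) : ℂ) = (β - (((‖vec b.1‖ ^ 2 : ℝ) : ℂ) + γ)) + γ := by ring
    rw [h3]
    exact (norm_add_le _ _).trans (by linarith)
  have hin : |inner ℝ (vec k) ω| ≤ D * C₁ :=
    (abs_real_inner_le_norm _ _).trans (mul_le_mul hk hω (norm_nonneg _)
      ((norm_nonneg _).trans hk))
  have h1 := key a ha α hα
  have h2 := key b hb β hβ
  have h3 : ((‖vec a.1‖ ^ 2 - ‖vec b.1‖ ^ 2 : ℝ) : ℂ) = (((inner ℝ (vec k) ω : ℝ) : ℂ) + α - β) -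
      ((inner ℝ (vec k) ω : ℝ) : ℂ) - (α - ((‖vec a.1‖ ^ 2 : ℝ) : ℂ)) +
      (β - ((‖vec b.1‖ ^ 2 : ℝ) : ℂ)) := by push_cast; ring
  rw [← Real.norm_eq_abs, ← Complex.norm_real, h3]
  refine (norm_add_le _ _).trans ?_
  have h4 := norm_sub_le ((((inner ℝ (vec k) ω : ℝ) : ℂ) + α - β) -
      ((inner ℝ (vec k) ω : ℝ) : ℂ)) (α - ((‖vec a.1‖ ^ 2 : ℝ) : ℂ))
  have h5 := norm_sub_le (((inner ℝ (vec k) ω : ℝ) : ℂ) + α - β) ((inner ℝ (vec k) ω : ℝ) : ℂ)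
  rw [Complex.norm_real ((inner ℝ (vec k) ω : ℝ)), Real.norm_eq_abs] at h5
  linarith

/-- Expand `⟨x, x - y⟩ = (|x|² - |y|² + |x - y|²)/2` and replace `x` by `a` at the cost of `⟨x - a,
x - y⟩`. -/
theorem abs_inner_sub_le {a x y : Fin d → ℤ} {m ρ : ℝ} (hρ : 0 ≤ ρ)
    (hm : |‖vec x‖ ^ 2 - ‖vec y‖ ^ 2| ≤ m) (hxy : ‖vec (x - y)‖ ≤ ρ) (hxa : ‖vec (x - a)‖ ≤ ρ) :
    |inner ℝ (vec a) (vec (x - y))| ≤ m + 2 * ρ ^ 2 := by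
  have h1 : inner ℝ (vec a) (vec (x - y)) =
      (‖vec x‖ ^ 2 - ‖vec y‖ ^ 2 + ‖vec (x - y)‖ ^ 2) / 2 -
        inner ℝ (vec (x - a)) (vec (x - y)) := by
    have h2 : vec y = vec x - vec (x - y) := by rw [vec_sub]; abel
    have h3 : vec a = vec x - vec (x - a) := by rw [vec_sub]; abel
    rw [h2, norm_sub_sq_real, h3, inner_sub_left]
    simp only [vec_sub]
    ring
  have h2 : |inner ℝ (vec (x - a)) (vec (x - y))| ≤ ρ * ρ :=
    (abs_real_inner_le_norm _ _).trans (mul_le_mul hxa hxy (norm_nonneg _) hρ)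
  have h3 : ‖vec (x - y)‖ ^ 2 ≤ ρ ^ 2 := pow_le_pow_left₀ (norm_nonneg _) hxy 2
  have h4 := abs_le.mp hm
  have h5 := abs_le.mp h2
  have h6 := sq_nonneg ‖vec (x - y)‖
  rw [h1]
  exact abs_le.mpr ⟨by nlinarith, by nlinarith⟩

/-- A failure of the second Melnikov condition either is one of finitely many resonances near the
origin, or persists for a limit at infinity with a representative near the origin. -/
theorem resonance_cases (hd : 2 ≤ d) {B U : Set (Param A)} (hUB : U ⊆ B)
    {Ω : Param A → Site A → ℝ} {H : Param A → Mat A} {Δ n : ℕ}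
    {C₁ C₂ C₃ Λ h D T K M Nc cm Δ' κ : ℝ} {R ε θ : ℕ → ℝ}
    (hn : A.card = n) (hC₃ : 0 < C₃) (hcl : CloseToSquares C₂ C₃ B Ω) (hh0 : 0 ≤ h)
    (hfin : blockDiam A Δ ≠ ⊤) (hδ : (blockDiam A Δ).toReal ≤ D) (hΔ' : 0 ≤ Δ') (hΔ'D : Δ' ≤ D)
    (hκ : κ ≤ 1)
    (hsc : ∀ j < d, Scales d n C₁ C₂ C₃ Λ h D T K M Nc cm (R (j + 1)) (ε (j + 1)))
    (hθ0 : κ + ε 1 ≤ θ 0) (hθ : ∀ j < d, θ j + ε (j + 1) ≤ θ (j + 1))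
    {ω : Param A} (hω : ω ∈ U) (hωC : ‖ω‖ ≤ C₁) (hT : IsNToplitz (d - 1) (H ω))
    (hHerm : (H ω).IsHermitian) (hnorm : lipNormN Λ (d - 1) (H ω) ≤ ENNReal.ofReal h)
    (hbad : ¬ SecondMelnikov Δ Δ' κ Ω H ω) :
    ∃ k : {a : Fin d → ℤ // a ∈ A} → ℤ, k ≠ 0 ∧ ‖vec k‖ ≤ D ∧
      (ω ∈ scalarResonantSet U k κ ∨
      (∃ a b : Site A, (‖vec a.1‖ ≤ R 1 ∨ ∃ p ∈ A, ‖vec (a.1 - p)‖ ≤ 6 * D) ∧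
        ‖vec (b.1 - a.1)‖ ≤ 3 * D ∧ (Fintype.card (block Δ a) : ℝ) ≤ Nc ∧
        (Fintype.card (block Δ b) : ℝ) ≤ Nc ∧ ω ∈ blockResonantSet U Ω H Δ k a b κ) ∨
      ∃ (C : List (Fin d → ℤ)) (a b : Fin d → ℤ), 1 ≤ C.length ∧ C.length ≤ d - 1 ∧
        (∀ c ∈ C, c ≠ 0 ∧ ‖vec c‖ ≤ cm) ∧ ‖vec a‖ ≤ R (C.length + 1) ∧ ‖vec (b - a)‖ ≤ 3 * D ∧
        (Fintype.card (CompSite A Δ C a) : ℝ) ≤ Nc ∧ (Fintype.card (CompSite A Δ C b) : ℝ) ≤ Nc ∧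
        ω ∈ limitResonantSet U H Δ k C a b (θ C.length)) := by
  classical
  unfold SecondMelnikov at hbad
  push Not at hbad
  obtain ⟨k, hk0, hkΔ, a, b, hab, α, hα, β, hβ, hres⟩ := hbad
  have hkne : k ≠ 0 := by
    rintro rfl
    rw [vec_zero, norm_zero] at hk0
    exact lt_irrefl _ hk0
  have hkD : ‖vec k‖ ≤ D := hkΔ.trans hΔ'D
  refine ⟨k, hkne, hkD, ?_⟩
  have sc1 := hsc 0 (by omega)
  have hD1 := sc1.one_le
  have hρ : 0 ≤ 3 * D := by linarith
  have hclose := fun {x y : Site A} => norm_sub_le_of_near_blocks hfin hδ hΔ' hΔ'D hab (x := x) (y := y)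
  have haa : a ∈ block Δ a := Relation.EqvGen.refl _
  have hbb : b ∈ block Δ b := Relation.EqvGen.refl _
  have hinjval : ∀ b : Site A, Function.Injective fun i : block Δ b => i.1.1 :=
    fun b i j hij => Subtype.ext (Subtype.ext hij)
  have hNc : ∀ c : Site A, (c = a ∨ c = b) → (Fintype.card (block Δ c) : ℝ) ≤ Nc := by
    intro c hc
    refine le_trans ?_ sc1.le_Nc
    have h1 : (3 * (3 * D)) = 9 * D := by ring
    rw [← h1]
    refine card_le_of_pairwise_norm_sub_le (hinjval c) (a := a.1) (by linarith) fun i => ?_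
    rcases hc with rfl | rfl
    · exact hclose (Or.inl i.2) (Or.inl haa)
    · exact hclose (Or.inr i.2) (Or.inl haa)
  have hNa := hNc a (Or.inl rfl)
  have hNb := hNc b (Or.inr rfl)
  -- If the two blocks reduce to one point, there is no difference to constrain the directions; but
  -- then `α = β`, and all such points give the same condition on `⟨k,ω⟩`.
  by_cases hsing : ∀ x y : Site A, (x ∈ block Δ a ∨ x ∈ block Δ b) →
      (y ∈ block Δ a ∨ y ∈ block Δ b) → x = y
  · left
    obtain rfl : a = b := hsing a b (Or.inl haa) (Or.inr hbb)
    have hsub : Subsingleton (block Δ a) :=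
      ⟨fun x y => Subtype.ext (hsing x.1 y.1 (Or.inl x.2) (Or.inl y.2))⟩
    have hαβ := eq_of_mem_spectrum_of_subsingleton hα hβ
    refine ⟨hω, 0, by rw [spectrum.zero_eq]; rfl, 0, by rw [spectrum.zero_eq]; rfl, ?_⟩
    rw [hαβ, add_sub_cancel_right] at hres
    simpa using hres
  -- The base points with `a` short or close to `A` are finite in number and need no limit.
  -- Otherwise `6D` leaves at least `3D ≥ δ + Δ` between `A` and both `a` and `b`, so that both
  -- blocks are components.
  by_cases hnear : ‖vec a.1‖ ≤ R 1 ∨ ∃ p ∈ A, ‖vec (a.1 - p)‖ ≤ 6 * D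
  · right; left
    refine ⟨a, b, hnear, hclose (Or.inr hbb) (Or.inl haa), hNa, hNb, hω, α, hα, β, hβ, ?_⟩
    simpa using hres
  right; right
  push Not at hsing hnear
  obtain ⟨hfar, hfarA⟩ := hnear
  have hba : ‖vec (b.1 - a.1)‖ ≤ 3 * D := hclose (Or.inr hbb) (Or.inl haa)
  have hΔδ := le_blockDiam_add_one hd hfin
  -- components
  have hcompa := mem_component_iff_mem_block (Δ := Δ) (a := a)
    (fun x hx => norm_sub_le_blockDiam hfin hx haa) (fun p hp => by
      have := hfarA p hp
      rw [norm_vec_sub_comm] at this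
      linarith)
  have hcompb := mem_component_iff_mem_block (Δ := Δ) (a := b)
    (fun x hx => norm_sub_le_blockDiam hfin hx hbb) (fun p hp => by
      have h1 := hfarA p hp
      have h2 := norm_vec_sub_le a.1 b.1 p
      rw [norm_vec_sub_comm a.1 b.1, norm_vec_sub_comm b.1 p] at h2
      linarith)
  -- the set of points involved
  let S : Finset (Fin d → ℤ) := Finset.univ.image (fun i : block Δ a => i.1.1) ∪
    Finset.univ.image fun i : block Δ b => i.1.1
  have hS : ∀ x, x ∈ S → ∃ y : Site A, y.1 = x ∧ (y ∈ block Δ a ∨ y ∈ block Δ b) := by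
    intro x hx
    rcases Finset.mem_union.mp hx with hx | hx
    · obtain ⟨i, _, rfl⟩ := Finset.mem_image.mp hx
      exact ⟨i.1, rfl, Or.inl i.2⟩
    · obtain ⟨i, _, rfl⟩ := Finset.mem_image.mp hx
      exact ⟨i.1, rfl, Or.inr i.2⟩
  have haS : ∀ x ∈ block Δ a, x.1 ∈ S := fun x hx => Finset.mem_union_left _
    (Finset.mem_image.mpr ⟨⟨x, hx⟩, Finset.mem_univ _, rfl⟩)
  have hbS : ∀ x ∈ block Δ b, x.1 ∈ S := fun x hx => Finset.mem_union_right _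
    (Finset.mem_image.mpr ⟨⟨x, hx⟩, Finset.mem_univ _, rfl⟩)
  have hScard : (S.card : ℝ) ≤ 2 * Nc := by
    have h1 : S.card ≤ Fintype.card (block Δ a) + Fintype.card (block Δ b) :=
      (Finset.card_union_le _ _).trans (add_le_add Finset.card_image_le Finset.card_image_le)
    have h2 : (S.card : ℝ) ≤ Fintype.card (block Δ a) + Fintype.card (block Δ b) := by
      exact_mod_cast h1
    linarith
  have hSd : ∀ x ∈ S, ∀ y ∈ S, ‖vec (x - y)‖ ≤ 3 * D := by
    intro x hx y hy
    obtain ⟨x', rfl, hx'⟩ := hS x hx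
    obtain ⟨y', rfl, hy'⟩ := hS y hy
    exact hclose hx' hy'
  have hSa : ∀ x ∈ S, ‖vec (x - a.1)‖ ≤ 3 * D := fun x hx => hSd x hx _ (haS a haa)
  have hSn : ∃ x ∈ S, ∃ y ∈ S, x ≠ y := by
    obtain ⟨x, y, hx, hy, hxy⟩ := hsing
    exact ⟨x.1, hx.elim (haS x) (hbS x), y.1, hy.elim (haS y) (hbS y),
      fun h => hxy (Subtype.ext h)⟩
  obtain ⟨n', hn'⟩ : ∃ n', d - 1 = n' + 1 := ⟨d - 2, by omega⟩
  have hentry : ∀ x y, ‖H ω x y‖ ≤ h := by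
    rw [hn'] at hnorm
    exact norm_apply_le_of_lipNormN_le hh0 hnorm
  have hΩ : ∀ x : Site A, |Ω ω x - ‖vec x.1‖ ^ 2| ≤ C₂ * Real.exp (-C₃ * ‖vec x.1‖) :=
    fun x => (hcl x ω (hUB hω)).1
  have hΩ' : ∀ x : Site A, |Ω ω x - ‖vec x.1‖ ^ 2| ≤ |C₂| := by
    intro x
    refine (hΩ x).trans ?_
    have h1 : Real.exp (-C₃ * ‖vec x.1‖) ≤ 1 := by
      rw [Real.exp_le_one_iff]
      have := mul_nonneg hC₃.le (norm_nonneg (vec x.1))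
      linarith
    calc C₂ * Real.exp (-C₃ * ‖vec x.1‖) ≤ |C₂| * 1 :=
          mul_le_mul (le_abs_self _) h1 (Real.exp_pos _).le (abs_nonneg _)
      _ = _ := mul_one _
  have hm := abs_sq_sub_sq_le_of_resonance hHerm hentry hh0 hωC hΩ' hkD hκ hNa hNb hα hβ hres
  have hm0 : 0 ≤ 1 + D * C₁ + 2 * |C₂| + 2 * (Nc * h) := (abs_nonneg _).trans hm
  have hK : ∀ x ∈ S, ∀ y ∈ S, |inner ℝ (vec a.1) (vec (x - y))| ≤ K := by
    intro x hx y hy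
    refine (abs_inner_sub_le hρ (m := 1 + D * C₁ + 2 * |C₂| + 2 * (Nc * h)) ?_ (hSd x hx y hy)
      (hSa x hx)).trans ?_
    · obtain ⟨x', rfl, hx'⟩ := hS x hx
      obtain ⟨y', rfl, hy'⟩ := hS y hy
      rcases hx' with hx' | hx' <;> rcases hy' with hy' | hy' <;>
        rw [norm_eq_of_mem_block hx', norm_eq_of_mem_block hy']
      · simpa using hm0
      · exact hm
      · rw [abs_sub_comm]; exact hm
      · simpa using hm0
    · refine le_trans (le_of_eq ?_) sc1.le_K
      ring
  -- the initial stage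
  have hRpos := sc1.pos_R
  have happrox : ∀ c : Site A, R 1 / 2 ≤ ‖vec c.1‖ → ∀ α ∈ spectrum ℂ
      (blockRestrict (hamMat Ω H ω) Δ c), ∃ β ∈ spectrum ℂ
        (blockRestrict (H ω) Δ c),
        ‖α - (((‖vec c.1‖ ^ 2 : ℝ) : ℂ) + β)‖ ≤ ε 1 / 2 := by
    intro c hc α hα
    refine exists_mem_spectrum_of_hamMat hHerm (f := fun i : block Δ c => i.1)
      Subtype.val_injective (fun i => ?_) hα
    rw [← norm_eq_of_mem_block i.2]
    refine (hΩ i.1).trans (mul_exp_neg_le hC₃ ?_ ?_) <;> rw [norm_eq_of_mem_block i.2]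
    · linarith
    · have h1 := sc1.exp_le
      have h2 : 0 ≤ |C₂| / C₃ := div_nonneg (abs_nonneg _) hC₃.le
      have h3 : 2 * |C₂| / C₃ = 2 * (|C₂| / C₃) := by ring
      rw [h3] at h1
      have h4 : 0 ≤ ε 1 / 2 := by
        by_contra hneg
        have := mul_neg_of_neg_of_pos (not_le.mp hneg) hRpos
        linarith
      have h5 := mul_le_mul_of_nonneg_left hc h4
      rw [show ((0 : ℕ) + 1) = 1 from rfl] at h1
      linarith
  have hbR : R 1 / 2 ≤ ‖vec b.1‖ := by
    have h1 := sc1.le_R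
    have h2 : ‖vec a.1‖ ≤ ‖vec b.1‖ + ‖vec (b.1 - a.1)‖ := by
      rw [norm_vec_sub_comm, vec_sub]
      exact norm_le_norm_add_norm_sub' _ _
    rw [show ((0 : ℕ) + 1) = 1 from rfl] at h1
    linarith
  obtain ⟨α', hα', hαα'⟩ := happrox a (by linarith) α hα
  obtain ⟨β', hβ', hββ'⟩ := happrox b hbR β hβ
  have hstage0 : Stage (H ω) (fun i : block Δ a => i.1.1) (fun i : block Δ b => i.1.1) S a.1
      ((inner ℝ (vec k) ω + (‖vec a.1‖ ^ 2 - ‖vec b.1‖ ^ 2) : ℝ) : ℂ) cm M [] 0 (θ 0) := by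
    refine ⟨by simp, by simp, by simp, by simp, zero_mem _, ?_, ?_, ?_⟩
    · intro x hx
      rw [add_zero]
      obtain ⟨y, rfl, _⟩ := hS x hx
      exact y.2
    · intro w hw
      have : w = 0 := by simpa [realSpan] using hw
      simp [this]
    · intro f f' hf hf'
      have e1 : f = fun i => i.1 := funext fun i => Subtype.ext (by rw [hf, add_zero])
      have e2 : f' = fun i => i.1 := funext fun i => Subtype.ext (by rw [hf', add_zero])
      rw [e1, e2]
      refine ⟨α', hα', β', hβ', lt_of_lt_of_le ?_ hθ0⟩
      have e3 : ((inner ℝ (vec k) ω + (‖vec a.1‖ ^ 2 - ‖vec b.1‖ ^ 2) : ℝ) : ℂ) + α' - β' =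
          ((inner ℝ (vec k) ω : ℝ) : ℂ) + (((‖vec a.1‖ ^ 2 : ℝ) : ℂ) + α') -
            (((‖vec b.1‖ ^ 2 : ℝ) : ℂ) + β') := by
        push_cast
        ring
      rw [e3]
      exact norm_add_sub_lt hres hαα' hββ'
  -- The reduction is continued until the translated base point lies within the radius attached to
  -- the number of limits taken.
  obtain ⟨C, v, -, hClen, hst, hbig⟩ := exists_maximal_extension (m := d - 1)
    (P := fun C v => Stage (H ω) (fun i : block Δ a => i.1.1) (fun i : block Δ b => i.1.1) S a.1
      ((inner ℝ (vec k) ω + (‖vec a.1‖ ^ 2 - ‖vec b.1‖ ^ 2) : ℝ) : ℂ) cm M C v (θ C.length))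
    (big := fun j v => R (j + 1) < ‖vec (a.1 + v)‖) (C := []) (v := 0)
    (fun C v hC hP hb => by
      have sc := hsc C.length (by omega)
      obtain ⟨h1, c, v', h2⟩ := hP.step (by omega) hT hHerm hh0 hnorm (fun i => haS i.1 i.2)
        (fun i => hbS i.1 i.2) hSa hSd hSn hK sc.cutoff_nonneg hρ sc.four_le sc.le_T
        sc.cutoff_le_T sc.sq_le_T sc.le_cm (M := M) (R := R (C.length + 1)) (Nc := Nc)
        (ε := ε (C.length + 1)) (by
          refine le_trans (mul_le_mul_of_nonneg_right ?_ ?_) sc.le_M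
          · rw [hn]
            have := mul_le_mul_of_nonneg_right hScard (Nat.cast_nonneg (α := ℝ) n)
            linarith
          · refine le_trans ?_ sc.le_cm
            have := sc.four_le
            unfold approxConst
            positivity)
        sc.approx_le_R sc.K_le_R sc.M_le_R sc.pos_R hNa hNb sc.error_le hC hb
      exact ⟨h1, c, v', h2.mono (hθ _ (by omega))⟩)
    (by simp) hstage0
  -- It does not stop at once: the original `a` lies beyond `R 1`.
  have hlen1 : 1 ≤ C.length := by
    by_contra hlt
    have hC0 : C = [] := List.length_eq_zero_iff.mp (by omega)
    subst hC0
    have hv : v = 0 := by simpa [intSpan] using hst.mem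
    subst hv
    apply hbig
    simpa using hfar
  obtain ⟨hmem, hca, hcb⟩ := hst.mem_limitResonantSet hω haS hbS hcompa hcompb
  refine ⟨C, a.1 + v, b.1 + v, hlen1, hClen, fun c hc => ⟨hst.ne_zero c hc, hst.short c hc⟩,
    not_lt.mp hbig, ?_, by rw [hca]; exact hNa, by rw [hcb]; exact hNb, hmem⟩
  rw [add_sub_add_right_eq_sub]
  exact hba

end Pointwise

/-! ### Measure of the union of all resonant sets -/

section MeasureCover

variable {d : ℕ} {A : Finset (Fin d → ℤ)}

theorem volume_thickening_biUnion_le {τ ι : Type*} [Fintype τ] (F : Finset ι)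
    (E : ι → Set (EuclideanSpace ℝ τ)) {κ c x : ℝ} {y : ℝ≥0∞} (hc : (F.card : ℝ) ≤ c)
    (h : ∀ i ∈ F, volume (Metric.thickening κ (E i)) ≤ ENNReal.ofReal x * y) :
    volume (Metric.thickening κ (⋃ i ∈ F, E i)) ≤ ENNReal.ofReal (c * x) * y := by
  simp only [Metric.thickening_iUnion]
  refine (measure_biUnion_finset_le _ _).trans ((Finset.sum_le_sum h).trans ?_)
  rw [Finset.sum_const, nsmul_eq_mul, ← mul_assoc, ENNReal.ofReal_mul ((Nat.cast_nonneg _).trans hc)]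
  gcongr
  rw [← ENNReal.ofReal_natCast]
  exact ENNReal.ofReal_le_ofReal hc

theorem volume_thickening_union_le {τ : Type*} [Fintype τ] {E E' : Set (EuclideanSpace ℝ τ)}
    {κ x x' : ℝ} {y : ℝ≥0∞} (hx : 0 ≤ x) (hx' : 0 ≤ x')
    (h : volume (Metric.thickening κ E) ≤ ENNReal.ofReal x * y)
    (h' : volume (Metric.thickening κ E') ≤ ENNReal.ofReal x' * y) :
    volume (Metric.thickening κ (E ∪ E')) ≤ ENNReal.ofReal (x + x') * y := by
  rw [Metric.thickening_union, ENNReal.ofReal_add hx hx', add_mul]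
  exact (measure_union_le _ _).trans (add_le_add h h')

theorem Growth.mono {τ ι : Type*} [Fintype τ] [Fintype ι] {U B : Set (EuclideanSpace ℝ τ)}
    {e : EuclideanSpace ℝ τ} {g L : ℝ} {N : EuclideanSpace ℝ τ → Matrix ι ι ℂ} (hUB : U ⊆ B)
    (h : Growth B e g L N) : Growth U e g L N :=
  fun x hx y hy => h x (hUB hx) y (hUB hy)

theorem FormLip.mono {c : ℝ} {U B : Set (Param A)} {P : Param A → Mat A} (hUB : U ⊆ B)
    (h : FormLip c B P) : FormLip c U P :=
  fun x hx y hy => h x (hUB hx) y (hUB hy)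

theorem isHermitian_hamMat {Ω : Param A → Site A → ℝ} {H : Param A → Mat A} {ω : Param A}
    (hH : (H ω).IsHermitian) : (hamMat Ω H ω).IsHermitian := by
  refine Matrix.IsHermitian.add ?_ hH
  rw [Matrix.isHermitian_diagonal_iff]
  intro i
  simp [isSelfAdjoint_iff]

variable {B U : Set (Param A)} {Ω : Param A → Site A → ℝ} {H : Param A → Mat A}
  {C₁ C₂ C₃ C₄ κ θ N : ℝ} {k : {a : Fin d → ℤ // a ∈ A} → ℤ}

theorem volume_scalarResonantSet_le (hκ : 0 ≤ κ) (hκ1 : κ ≤ 1) (hC₁ : 1 ≤ C₁) (hC₄ : 0 < C₄)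
    (hU : ∀ x ∈ U, ‖x‖ ≤ C₁) (hk : k ≠ 0) (hkC : C₄ ≤ ‖vec k‖) (hs : Nonempty (Site A))
    (hN : 1 ≤ N) : volume (Metric.thickening κ (scalarResonantSet U k κ)) ≤
      ENNReal.ofReal (N ^ 2 * slabConst A.card C₂ C₄ * κ) * ENNReal.ofReal C₁ ^ (A.card - 1) := by
  obtain ⟨a⟩ := hs
  have hP : FormLip (C₄ / 4) U (fun _ => (0 : Mat A)) := by
    intro x _ y _ ι _ f _ u
    rw [sub_self, abs_zero]
    exact mul_nonneg (mul_nonneg (by linarith) (norm_nonneg _)) (nsq_nonneg u)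
  have hf : Function.Injective fun _ : Unit => a := fun _ _ _ => rfl
  exact volume_thickening_resonantSet_le hκ hκ1 hC₁ le_rfl hC₄ hU hk 0
    (fun _ _ => Matrix.isHermitian_zero) (fun _ _ => Matrix.isHermitian_zero)
    (hP.growth hC₄ C₂ hk hkC hf 0 (Or.inl rfl)) (hP.growth hC₄ C₂ hk hkC hf 0 (Or.inr rfl))
    (by simpa using hN) (by simpa using hN)

theorem volume_blockResonantSet_le (hB : IsOpen B) (hBc : Convex ℝ B) (hUB : U ⊆ B)
    (hΩ : ∀ a, ContDiffOn ℝ 1 (fun ω => Ω ω a) B) (hC₃ : 0 < C₃)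
    (hcl : CloseToSquares C₂ C₃ B Ω) (hT : Transversal C₄ B Ω) (hH : FormLip (C₄ / 4) B H)
    (hHerm : ∀ ω ∈ U, (H ω).IsHermitian) (hκ : 0 ≤ κ) (hκ1 : κ ≤ 1) (hC₁ : 1 ≤ C₁) (hC₄ : 0 < C₄)
    (hU : ∀ x ∈ U, ‖x‖ ≤ C₁) (hk : k ≠ 0) (Δ : ℕ) {a b : Site A}
    (ha : (Fintype.card (block Δ a) : ℝ) ≤ N) (hb : (Fintype.card (block Δ b) : ℝ) ≤ N) :
    volume (Metric.thickening κ (blockResonantSet U Ω H Δ k a b κ)) ≤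
      ENNReal.ofReal (N ^ 2 * slabConst A.card C₂ C₄ * κ) * ENNReal.ofReal C₁ ^ (A.card - 1) :=
  volume_thickening_resonantSet_le hκ hκ1 hC₁ le_rfl hC₄ hU hk 0
    (fun ω hω => (isHermitian_hamMat (hHerm ω hω)).submatrix _)
    (fun ω hω => (isHermitian_hamMat (hHerm ω hω)).submatrix _)
    ((growth_hamMat hB hBc hΩ hC₃ hC₄ hcl hT hH hk (Subtype.val_injective) 0 (Or.inl rfl)).mono hUB)
    ((growth_hamMat hB hBc hΩ hC₃ hC₄ hcl hT hH hk (Subtype.val_injective) 0 (Or.inr rfl)).mono hUB)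
    ha hb

theorem volume_limitResonantSet_le (hH : FormLip (C₄ / 4) U H)
    (hHerm : ∀ ω ∈ U, (H ω).IsHermitian) (hT : ∀ ω ∈ U, IsNToplitz (d - 1) (H ω))
    (hκ : 0 ≤ κ) (hκ1 : κ ≤ 1) (hκθ : κ ≤ θ) (hC₁ : 1 ≤ C₁) (hC₄ : 0 < C₄)
    (hU : ∀ x ∈ U, ‖x‖ ≤ C₁) (hk : k ≠ 0) (hkC : C₄ ≤ ‖vec k‖) (Δ : ℕ) {C : List (Fin d → ℤ)}
    (hC : ∀ c ∈ C, c ≠ 0) (hlen : C.length ≤ d - 1) {a b : Fin d → ℤ}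
    (ha : (Fintype.card (CompSite A Δ C a) : ℝ) ≤ N)
    (hb : (Fintype.card (CompSite A Δ C b) : ℝ) ≤ N) :
    volume (Metric.thickening κ (limitResonantSet U H Δ k C a b θ)) ≤
      ENNReal.ofReal (N ^ 2 * slabConst A.card C₂ C₄ * θ) * ENNReal.ofReal C₁ ^ (A.card - 1) :=
  have hP := formLip_iterLimit hH hT hC hlen
  volume_thickening_resonantSet_le hκ hκ1 hC₁ hκθ hC₄ hU hk _
    (fun ω hω => (isHermitian_iterLimit (hT ω hω) (hHerm ω hω) hC hlen).submatrix _)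
    (fun ω hω => (isHermitian_iterLimit (hT ω hω) (hHerm ω hω) hC hlen).submatrix _)
    (hP.growth hC₄ C₂ hk hkC Subtype.val_injective _ (Or.inl rfl))
    (hP.growth hC₄ C₂ hk hkC Subtype.val_injective _ (Or.inr rfl)) ha hb

/-- Placing side conditions inside the set lets the unions run over plain cubes, whose cardinality
is immediate. -/
theorem thickening_subset_of_imp {τ : Type*} [Fintype τ] {p : Prop}
    {E : Set (EuclideanSpace ℝ τ)} {κ : ℝ} {w : ℝ≥0∞}
    (h : p → volume (Metric.thickening κ E) ≤ w) :
    volume (Metric.thickening κ {x | p ∧ x ∈ E}) ≤ w := by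
  by_cases hp : p
  · simpa [hp] using h hp
  · simp [hp, Metric.thickening_empty]

theorem mul_le_mul_card {a b : ℕ} {x y : ℝ} (ha : (a : ℝ) ≤ x) (hb : (b : ℝ) ≤ y) :
    ((a * b : ℕ) : ℝ) ≤ x * y := by
  rw [Nat.cast_mul]
  exact mul_le_mul ha hb (Nat.cast_nonneg _) ((Nat.cast_nonneg _).trans ha)

/-- Union bound over the three cases of `resonance_cases`. The factors count `k` by `(3D)^n`, each
short direction by `(3cm)^d`, the base point by `(3R)^d` (plus the points near `A` when no limit is
taken), and the second base point relative to the first by `(9D)^d`. -/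
theorem volume_thickening_compl_secondMelnikov_le (hd : 2 ≤ d) {Δ n : ℕ}
    {Λ h D T K M Nc cm Δ' : ℝ} {R ε θ : ℕ → ℝ}
    (hB : IsOpen B) (hBc : Convex ℝ B) (hUB : U ⊆ B) (hU : ∀ x ∈ U, ‖x‖ ≤ C₁)
    (hΩ : ∀ a, ContDiffOn ℝ 1 (fun ω => Ω ω a) B) (hn : A.card = n) (hC₃ : 0 < C₃) (hC₄ : 0 < C₄)
    (hcl : CloseToSquares C₂ C₃ B Ω) (hTr : Transversal C₄ B Ω) (hH : FormLip (C₄ / 4) B H)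
    (hHerm : ∀ ω ∈ U, (H ω).IsHermitian) (hT : ∀ ω ∈ U, IsNToplitz (d - 1) (H ω))
    (hnorm : ∀ ω ∈ U, lipNormN Λ (d - 1) (H ω) ≤ ENNReal.ofReal h)
    (hh0 : 0 ≤ h) (hC₁ : 1 ≤ C₁)
    (hfin : blockDiam A Δ ≠ ⊤) (hδ : (blockDiam A Δ).toReal ≤ D) (hΔ' : 0 ≤ Δ') (hΔ'D : Δ' ≤ D)
    (hκ0 : 0 ≤ κ) (hκ : κ ≤ 1) (hcm : 1 ≤ cm) (hNc : 1 ≤ Nc)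
    (hsc : ∀ j < d, Scales d n C₁ C₂ C₃ Λ h D T K M Nc cm (R (j + 1)) (ε (j + 1)))
    (hθ0 : κ + ε 1 ≤ θ 0) (hθ : ∀ j < d, θ j + ε (j + 1) ≤ θ (j + 1)) (hκθ : ∀ j, κ ≤ θ j) :
    volume (Metric.thickening κ (U \ {ω | ω ∈ U ∧ SecondMelnikov Δ Δ' κ Ω H ω})) ≤
      ENNReal.ofReal (Nc ^ 2 * slabConst n C₂ C₄ * ((3 * D) ^ n * κ +
        (3 * D) ^ n * (((3 * R 1) ^ d + n * (18 * D) ^ d) * (9 * D) ^ d) * κ +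
        ∑ j ∈ Finset.Icc 1 (d - 1), (3 * D) ^ n * (((3 * cm) ^ d) ^ j *
          ((3 * R (j + 1)) ^ d * (9 * D) ^ d)) * θ j)) * ENNReal.ofReal C₁ ^ (n - 1) := by
  classical
  subst hn
  have hs : Nonempty (Site A) := by
    obtain ⟨e, rfl⟩ : ∃ e, d = e + 1 := ⟨d - 1, by omega⟩
    obtain ⟨t, ht⟩ := (eventually_add_smul_notMem A (c := Pi.single 0 1)
      (fun h0 => by simpa using congrFun h0 0) 0).exists
    exact ⟨⟨_, ht⟩⟩
  have sc1 := hsc 0 (by omega)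
  have hD1 := sc1.one_le
  have hsl := slabConst_pos A.card C₂ hC₄
  set w := Nc ^ 2 * slabConst A.card C₂ C₄ with hw
  have hw0 : 0 ≤ w := by rw [hw]; exact mul_nonneg (sq_nonneg _) hsl.le
  have hR1 : ∀ j < d, 1 ≤ R (j + 1) := fun j hj => by
    have := (hsc j hj).le_R
    linarith
  rcases U.eq_empty_or_nonempty with rfl | ⟨ω₀, hω₀⟩
  · simp
  have hkC : ∀ k : {a : Fin d → ℤ // a ∈ A} → ℤ, k ≠ 0 → C₄ ≤ ‖vec k‖ := by
    intro k hk
    obtain ⟨a⟩ := hs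
    have := hTr.half_le hB hΩ hk (hUB hω₀) a
    linarith [this.1, this.2]
  have hKcard : ((cube {a : Fin d → ℤ // a ∈ A} D).card : ℝ) ≤ (3 * D) ^ A.card := by
    have := card_cube_le (ι := {a : Fin d → ℤ // a ∈ A}) hD1
    rwa [Fintype.card_coe] at this
  have hcube : ∀ {r : ℝ}, 1 ≤ r → ((cube (Fin d) r).card : ℝ) ≤ (3 * r) ^ d := fun hr => by
    have := card_cube_le (ι := Fin d) hr
    rwa [Fintype.card_fin] at this
  have hcube3 : ((cube (Fin d) (3 * D)).card : ℝ) ≤ (9 * D) ^ d := by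
    have := hcube (r := 3 * D) (by linarith)
    rwa [← mul_assoc, show (3 : ℝ) * 3 = 9 by norm_num] at this
  let Kset := cube {a : Fin d → ℤ // a ∈ A} D
  let Aset := cube (Fin d) (R 1) ∪ A.biUnion fun p => (cube (Fin d) (6 * D)).image fun z => z + p
  have hAcard : (Aset.card : ℝ) ≤ (3 * R 1) ^ d + A.card * (18 * D) ^ d := by
    have h1 : Aset.card ≤ (cube (Fin d) (R 1)).card + A.card * (cube (Fin d) (6 * D)).card :=
      (Finset.card_union_le _ _).trans (add_le_add le_rfl
        (Finset.card_biUnion_le_card_mul _ _ _ fun _ _ => Finset.card_image_le))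
    have h2 := hcube (hR1 0 (by omega))
    have h3 := hcube (r := 6 * D) (by linarith)
    rw [← mul_assoc, show (3 : ℝ) * 6 = 18 by norm_num] at h3
    calc (Aset.card : ℝ) ≤ (cube (Fin d) (R 1)).card + A.card * (cube (Fin d) (6 * D)).card := by
          exact_mod_cast h1
      _ ≤ _ := add_le_add h2 (mul_le_mul_of_nonneg_left h3 (Nat.cast_nonneg _))
  -- the three kinds of resonances
  let E₁ := ⋃ k ∈ Kset, {ω | k ≠ 0 ∧ ω ∈ scalarResonantSet U k κ}
  let E₂ := ⋃ q ∈ Kset ×ˢ (Aset ×ˢ cube (Fin d) (3 * D)), {ω | q.1 ≠ 0 ∧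
    ω ∈ ⋃ (a : Site A) (b : Site A), {ω | (a.1 = q.2.1 ∧ b.1 = q.2.2 + q.2.1 ∧
      (Fintype.card (block Δ a) : ℝ) ≤ Nc ∧ (Fintype.card (block Δ b) : ℝ) ≤ Nc) ∧
      ω ∈ blockResonantSet U Ω H Δ q.1 a b κ}}
  let F : ℕ → Set (Param A) := fun j => ⋃ q ∈ Kset ×ˢ
    (Fintype.piFinset (fun _ : Fin j => cube (Fin d) cm) ×ˢ
      (cube (Fin d) (R (j + 1)) ×ˢ cube (Fin d) (3 * D))),
    {ω | (q.1 ≠ 0 ∧ (∀ c ∈ List.ofFn q.2.1, c ≠ 0) ∧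
      (Fintype.card (CompSite A Δ (List.ofFn q.2.1) q.2.2.1) : ℝ) ≤ Nc ∧
      (Fintype.card (CompSite A Δ (List.ofFn q.2.1) (q.2.2.2 + q.2.2.1)) : ℝ) ≤ Nc) ∧
      ω ∈ limitResonantSet U H Δ q.1 (List.ofFn q.2.1) q.2.2.1 (q.2.2.2 + q.2.2.1) (θ j)}
  have hsub : U \ {ω | ω ∈ U ∧ SecondMelnikov Δ Δ' κ Ω H ω} ⊆
      (E₁ ∪ E₂) ∪ ⋃ j ∈ Finset.Icc 1 (d - 1), F j := by
    rintro ω ⟨hω, hbad⟩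
    obtain ⟨k, hk0, hkD, hcase⟩ := resonance_cases hd hUB rfl hC₃ hcl hh0 hfin hδ hΔ' hΔ'D hκ hsc
      hθ0 hθ hω (hU ω hω) (hT ω hω) (hHerm ω hω) (hnorm ω hω) (fun h => hbad ⟨hω, h⟩)
    have hkK : k ∈ Kset := mem_cube hkD
    rcases hcase with hcase | ⟨a, b, ha, hba, hca, hcb, hcase⟩ |
      ⟨C, a, b, hl1, hl2, hC, ha, hba, hca, hcb, hcase⟩
    · exact Or.inl (Or.inl (Set.mem_iUnion₂.mpr ⟨k, hkK, hk0, hcase⟩))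
    · refine Or.inl (Or.inr (Set.mem_iUnion₂.mpr ⟨(k, a.1, b.1 - a.1), ?_, hk0,
        Set.mem_iUnion₂.mpr ⟨a, b, ⟨rfl, (sub_add_cancel _ _).symm, hca, hcb⟩, hcase⟩⟩))
      refine Finset.mem_product.mpr ⟨hkK, Finset.mem_product.mpr ⟨?_, mem_cube hba⟩⟩
      rcases ha with ha | ⟨p, hp, ha⟩
      · exact Finset.mem_union_left _ (mem_cube ha)
      · exact Finset.mem_union_right _ (Finset.mem_biUnion.mpr ⟨p, hp, Finset.mem_image.mpr
          ⟨a.1 - p, mem_cube ha, sub_add_cancel _ _⟩⟩)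
    · refine Or.inr (Set.mem_iUnion₂.mpr ⟨C.length, Finset.mem_Icc.mpr ⟨hl1, hl2⟩,
        Set.mem_iUnion₂.mpr ⟨(k, fun i => C.get i, a, b - a), ?_, ?_⟩⟩)
      · refine Finset.mem_product.mpr ⟨hkK, Finset.mem_product.mpr ⟨?_,
          Finset.mem_product.mpr ⟨mem_cube ha, mem_cube hba⟩⟩⟩
        exact Fintype.mem_piFinset.mpr fun i => mem_cube (hC _ (List.get_mem C i)).2
      · simp only [List.ofFn_get, sub_add_cancel]
        exact ⟨⟨hk0, fun c hc => (hC c hc).1, hca, hcb⟩, hcase⟩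
  refine (measure_mono (Metric.thickening_subset_of_subset κ hsub)).trans ?_
  have hwκ : 0 ≤ w * κ := mul_nonneg hw0 hκ0
  have hD0 : (0 : ℝ) ≤ D := by linarith
  have hθj : ∀ j, 0 ≤ θ j := fun j => hκ0.trans (hκθ j)
  have v₁ : volume (Metric.thickening κ E₁) ≤ ENNReal.ofReal ((3 * D) ^ A.card * (w * κ)) *
      ENNReal.ofReal C₁ ^ (A.card - 1) :=
    volume_thickening_biUnion_le _ _ hKcard fun k _ => thickening_subset_of_imp fun hk =>
      volume_scalarResonantSet_le hκ0 hκ hC₁ hC₄ hU hk (hkC k hk) hs hNc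
  have v₂ : volume (Metric.thickening κ E₂) ≤ ENNReal.ofReal ((3 * D) ^ A.card *
      (((3 * R 1) ^ d + A.card * (18 * D) ^ d) * (9 * D) ^ d) * (w * κ)) *
      ENNReal.ofReal C₁ ^ (A.card - 1) := by
    refine volume_thickening_biUnion_le _ _ ?_ fun q _ => thickening_subset_of_imp fun hk => ?_
    · rw [Finset.card_product, Finset.card_product]
      exact mul_le_mul_card hKcard (mul_le_mul_card hAcard hcube3)
    · by_cases hq : q.2.1 ∉ A ∧ q.2.2 + q.2.1 ∉ A
      · refine le_trans (measure_mono (Metric.thickening_subset_of_subset κ ?_))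
          (thickening_subset_of_imp (p := (Fintype.card (block Δ (⟨_, hq.1⟩ : Site A)) : ℝ) ≤ Nc ∧
            (Fintype.card (block Δ (⟨_, hq.2⟩ : Site A)) : ℝ) ≤ Nc) fun hp =>
          volume_blockResonantSet_le hB hBc hUB hΩ hC₃ hcl hTr hH hHerm hκ0 hκ hC₁ hC₄ hU hk Δ
            (a := ⟨_, hq.1⟩) (b := ⟨_, hq.2⟩) hp.1 hp.2)
        intro ω hω
        obtain ⟨a, b, ⟨ha, hb, hca, hcb⟩, hmem⟩ := Set.mem_iUnion₂.mp hω
        obtain rfl : a = ⟨_, hq.1⟩ := Subtype.ext ha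
        obtain rfl : b = ⟨_, hq.2⟩ := Subtype.ext hb
        exact ⟨⟨hca, hcb⟩, hmem⟩
      · refine (measure_mono_null (Metric.thickening_subset_of_subset κ
          (E₂ := ∅) fun ω hω => ?_) ?_).trans_le bot_le
        · obtain ⟨a, b, ⟨ha, hb, _⟩, _⟩ := Set.mem_iUnion₂.mp hω
          exact hq ⟨ha ▸ a.2, hb ▸ b.2⟩
        · rw [Metric.thickening_empty, measure_empty]
  have v₃ : ∀ j ∈ Finset.Icc 1 (d - 1), volume (Metric.thickening κ (F j)) ≤
      ENNReal.ofReal ((3 * D) ^ A.card * (((3 * cm) ^ d) ^ j *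
        ((3 * R (j + 1)) ^ d * (9 * D) ^ d)) * (w * θ j)) * ENNReal.ofReal C₁ ^ (A.card - 1) := by
    intro j hj
    rw [Finset.mem_Icc] at hj
    refine volume_thickening_biUnion_le _ _ ?_ fun q _ =>
      thickening_subset_of_imp fun hq => volume_limitResonantSet_le (hH.mono hUB) hHerm hT hκ0 hκ
        (hκθ j) hC₁ hC₄ hU hq.1 (hkC _ hq.1) Δ hq.2.1 (by simpa using hj.2) hq.2.2.1 hq.2.2.2
    rw [Finset.card_product, Finset.card_product, Finset.card_product, Fintype.card_piFinset]
    refine mul_le_mul_card hKcard (mul_le_mul_card ?_ (mul_le_mul_card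
      (hcube (hR1 j (by omega))) hcube3))
    rw [Finset.prod_const, Finset.card_univ, Fintype.card_fin, Nat.cast_pow]
    exact pow_le_pow_left₀ (Nat.cast_nonneg _) (hcube hcm) j
  have v₃' : volume (Metric.thickening κ (⋃ j ∈ Finset.Icc 1 (d - 1), F j)) ≤
      ENNReal.ofReal (∑ j ∈ Finset.Icc 1 (d - 1), (3 * D) ^ A.card * (((3 * cm) ^ d) ^ j *
        ((3 * R (j + 1)) ^ d * (9 * D) ^ d)) * (w * θ j)) * ENNReal.ofReal C₁ ^ (A.card - 1) := by
    simp only [Metric.thickening_iUnion]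
    refine (measure_biUnion_finset_le _ _).trans ((Finset.sum_le_sum v₃).trans ?_)
    rw [← Finset.sum_mul, ENNReal.ofReal_sum_of_nonneg]
    intro j hj
    rw [Finset.mem_Icc] at hj
    have h1 := hR1 j (by omega)
    have h2 := mul_nonneg hw0 (hθj j)
    have h3 : 0 ≤ R (j + 1) := by linarith
    have h4 : 0 ≤ cm := by linarith
    positivity
  have hR10 : 0 ≤ R 1 := zero_le_one.trans (hR1 0 (by omega))
  refine (volume_thickening_union_le ?_ ?_ (volume_thickening_union_le ?_ ?_ v₁ v₂) v₃').trans
    (le_of_eq ?_)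
  · positivity
  · refine Finset.sum_nonneg fun j hj => ?_
    rw [Finset.mem_Icc] at hj
    have h1 := hR1 j (by omega)
    have h2 := mul_nonneg hw0 (hθj j)
    have h3 : 0 ≤ R (j + 1) := by linarith
    have h4 : 0 ≤ cm := by linarith
    positivity
  · positivity
  · positivity
  · congr 2
    rw [mul_add, mul_add, Finset.mul_sum]
    congr 1
    · ring
    · exact Finset.sum_congr rfl fun j _ => by ring

end MeasureCover

/-! ### Choice of the scales and power counting -/

section Parameters

/-- The constant in the length of the directions. -/
noncomputable def directionConst (d : ℕ) : ℝ := approxConst d * 8 ^ d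

/-- The constant in the radius outside of which the Töplitz limits are used. -/
noncomputable def radiusConst (d n : ℕ) (C₂ C₃ : ℝ) : ℝ :=
  approxConst d * 8 ^ (2 * d + 1) + 2 * (20 + 2 * |C₂| + 2 * 9 ^ d) * directionConst d +
    2 * ((d + 2 * 9 ^ d * n) * directionConst d) + 4 * 9 ^ d * directionConst d +
    4 * |C₂| / C₃ + 6

theorem one_le_directionConst {d : ℕ} (hd : 2 ≤ d) : 1 ≤ directionConst d := by
  have h2 : (2 : ℝ) ≤ d := by exact_mod_cast hd
  have h3 : (1 : ℝ) ≤ (5 * (d : ℝ) ^ 2) ^ (2 * d) := one_le_pow₀ (by nlinarith)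
  have h4 : (1 : ℝ) ≤ 16 * (d : ℝ) ^ 3 := by
    have := one_le_pow₀ (n := 3) (show (1 : ℝ) ≤ d by linarith)
    linarith
  unfold directionConst approxConst
  exact one_le_mul_of_one_le_of_one_le (one_le_mul_of_one_le_of_one_le h4 h3)
    (one_le_pow₀ (by norm_num))

theorem approxConst_nonneg (d : ℕ) : 0 ≤ approxConst d := by
  unfold approxConst
  positivity

theorem six_le_radiusConst {d : ℕ} (hd : 2 ≤ d) (n : ℕ) (C₂ : ℝ) {C₃ : ℝ} (hC₃ : 0 < C₃) :
    6 ≤ radiusConst d n C₂ C₃ := by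
  have h1 := approxConst_nonneg d
  have h2 : 0 ≤ directionConst d := zero_le_one.trans (one_le_directionConst hd)
  unfold radiusConst
  have h3 : 0 ≤ approxConst d * 8 ^ (2 * d + 1) + 2 * (20 + 2 * |C₂| + 2 * 9 ^ d) *
    directionConst d + 2 * ((d + 2 * 9 ^ d * n) * directionConst d) +
    4 * 9 ^ d * directionConst d + 4 * |C₂| / C₃ := by positivity
  linarith

/-- `T = 8D²` is the first choice, as `D` dominates `Λ`; the directions then have length of order
`T^d`. Each summand of `radiusConst` pays for one lower bound on `R`. The power `D^(4d+2)` is that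
of `T^(2d+1)`, the factor `C₁ + h` comes from `K` and the Töplitz error, and the division by `ε`
makes both the Töplitz and the exponential errors at most `ε`. -/
theorem scales_standard {d : ℕ} (hd : 2 ≤ d) (n : ℕ) {C₁ C₂ C₃ Λ h D ε : ℝ} (hC₃ : 0 < C₃)
    (hC₁ : 1 ≤ C₁) (hh : 0 ≤ h) (hD : 1 ≤ D) (hΛ : 0 ≤ Λ) (hΛD : Λ ≤ D) (hε0 : 0 < ε)
    (hε : ε ≤ 1) :
    Scales d n C₁ C₂ C₃ Λ h D (8 * D ^ 2)
      ((20 + 2 * |C₂| + 2 * 9 ^ d) * (D ^ (d + 2) * (C₁ + h)))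
      ((d + 2 * 9 ^ d * n) * directionConst d * D ^ (3 * d)) (9 ^ d * D ^ d)
      (directionConst d * D ^ (2 * d))
      (radiusConst d n C₂ C₃ * (D ^ (4 * d + 2) * (C₁ + h)) / ε) ε := by
  have ha := approxConst_nonneg d
  have hq1 := one_le_directionConst hd
  have hq := six_le_radiusConst hd n C₂ hC₃
  have hK0 : 1 ≤ C₁ + h := by linarith
  have hDp : ∀ k, (1 : ℝ) ≤ D ^ k := fun k => one_le_pow₀ hD
  have hDm : ∀ {k l}, k ≤ l → D ^ k ≤ D ^ l := fun hkl => pow_le_pow_right₀ hD hkl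
  have hDm' : ∀ {k l}, k ≤ l → D ^ k ≤ D ^ l * (C₁ + h) := fun hkl =>
    (hDm hkl).trans (le_mul_of_one_le_right (zero_le_one.trans (hDp _)) hK0)
  set Y := D ^ (4 * d + 2) * (C₁ + h) with hY
  set q := radiusConst d n C₂ C₃ with hqdef
  have hY1 : 1 ≤ Y := by simpa using hDm' (Nat.zero_le (4 * d + 2))
  have hqY : 0 < q * Y := by positivity
  have hqR : q * Y ≤ q * Y / ε := le_div_self hqY.le hε0 hε
  have hεR : ε / 2 * (q * Y / ε) = q * Y / 2 := by field_simp
  have hqexp : q * Y = approxConst d * 8 ^ (2 * d + 1) * Y +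
      2 * (20 + 2 * |C₂| + 2 * 9 ^ d) * directionConst d * Y +
      2 * ((d + 2 * 9 ^ d * n) * directionConst d) * Y + 4 * 9 ^ d * directionConst d * Y +
      4 * |C₂| / C₃ * Y + 6 * Y := by
    rw [hqdef, radiusConst]; ring
  have t1 : 0 ≤ approxConst d * 8 ^ (2 * d + 1) * Y := by positivity
  have t2 : 0 ≤ 2 * (20 + 2 * |C₂| + 2 * 9 ^ d) * directionConst d * Y := by positivity
  have t3 : 0 ≤ 2 * ((d + 2 * 9 ^ d * n) * directionConst d) * Y := by positivity
  have t4 : 0 ≤ 4 * 9 ^ d * directionConst d * Y := by positivity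
  have t5 : 0 ≤ 4 * |C₂| / C₃ * Y := by positivity
  have hD2 : D ≤ D ^ 2 := by simpa using hDm (show 1 ≤ 2 by norm_num)
  have hDd : ∀ k l : ℕ, D ^ k * D ^ l = D ^ (k + l) := fun k l => (pow_add D k l).symm
  refine ⟨hD, hΛ, ?_, ?_, ?_, ?_, ?_, ?_, ?_, ?_, ?_, ?_, ?_, ?_, ?_, ?_, ?_⟩
  · linarith [hDp 2]
  · linarith [hDp 2]
  · nlinarith
  · nlinarith
  · rw [directionConst, mul_pow, ← pow_mul, mul_assoc]
  · rw [mul_pow]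
  · have h1 : (d : ℝ) ≤ d * D ^ d := le_mul_of_one_le_right (Nat.cast_nonneg _) (hDp d)
    calc (d + 2 * (9 ^ d * D ^ d) * n) * (directionConst d * D ^ (2 * d))
        ≤ (d * D ^ d + 2 * (9 ^ d * D ^ d) * n) * (directionConst d * D ^ (2 * d)) := by gcongr
      _ = _ := by rw [show 3 * d = d + 2 * d by ring, pow_add]; ring
  · have e1 : 1 ≤ D ^ (d + 2) * (C₁ + h) := by simpa using hDm' (Nat.zero_le (d + 2))
    have e2 : D * C₁ ≤ D ^ (d + 2) * (C₁ + h) := by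
      have : D ≤ D ^ (d + 2) := by simpa using hDm (show 1 ≤ d + 2 by omega)
      exact mul_le_mul this (by linarith) (by linarith) (by linarith [hDp (d + 2)])
    have e3 : 2 * |C₂| * 1 ≤ 2 * |C₂| * (D ^ (d + 2) * (C₁ + h)) := by gcongr
    have e4 : 2 * 9 ^ d * (D ^ d * h) ≤ 2 * 9 ^ d * (D ^ (d + 2) * (C₁ + h)) := by
      exact mul_le_mul_of_nonneg_left (mul_le_mul (hDm (by omega)) (by linarith) hh
        (by positivity)) (by positivity)
    have e5 : D ^ 2 ≤ D ^ (d + 2) * (C₁ + h) := hDm' (by omega)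
    linarith
  · positivity
  · have : D ≤ Y := by simpa using hDm' (show 1 ≤ 4 * d + 2 by omega)
    linarith
  · have : approxConst d * (8 * D ^ 2) ^ (2 * d + 1) ≤ approxConst d * 8 ^ (2 * d + 1) * Y := by
      rw [mul_pow, ← pow_mul, mul_assoc]
      gcongr
      exact hDm' (by omega)
    linarith
  · have : 2 * ((20 + 2 * |C₂| + 2 * 9 ^ d) * (D ^ (d + 2) * (C₁ + h))) *
        (directionConst d * D ^ (2 * d)) ≤
        2 * (20 + 2 * |C₂| + 2 * 9 ^ d) * directionConst d * Y := by
      calc _ = 2 * (20 + 2 * |C₂| + 2 * 9 ^ d) * directionConst d *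
            (D ^ (d + 2 + 2 * d) * (C₁ + h)) := by rw [pow_add]; ring
        _ ≤ _ := by
          exact mul_le_mul_of_nonneg_left (mul_le_mul_of_nonneg_right (hDm (by omega))
            (by linarith)) (by positivity)
    linarith
  · have : 2 * ((d + 2 * 9 ^ d * n) * directionConst d * D ^ (3 * d)) ≤
        2 * ((d + 2 * 9 ^ d * n) * directionConst d) * Y := by
      rw [← mul_assoc]
      gcongr
      exact hDm' (by omega)
    linarith
  · have : 9 ^ d * D ^ d * (2 * h * (directionConst d * D ^ (2 * d))) * 2 ≤
        4 * 9 ^ d * directionConst d * Y := by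
      calc _ = 4 * 9 ^ d * directionConst d * (D ^ (d + 2 * d) * h) := by rw [pow_add]; ring
        _ ≤ _ := by
          exact mul_le_mul_of_nonneg_left (mul_le_mul (hDm (by omega)) (by linarith) hh
            (by positivity)) (by positivity)
    rw [hεR]
    linarith
  · have : 4 * |C₂| / C₃ * 1 ≤ 4 * |C₂| / C₃ * Y := by gcongr
    rw [hεR, mul_div_assoc]
    rw [mul_div_assoc] at this t5 hqexp
    linarith

/-- The thresholds `κ^{(1/(d+1))^j}`. -/
noncomputable def threshold (d : ℕ) (κ : ℝ) (j : ℕ) : ℝ := κ ^ ((1 / ((d : ℝ) + 1)) ^ j)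

theorem threshold_zero (d : ℕ) (κ : ℝ) : threshold d κ 0 = κ := by
  rw [threshold, pow_zero, Real.rpow_one]

theorem threshold_succ_pow (d : ℕ) {κ : ℝ} (hκ : 0 ≤ κ) (j : ℕ) :
    threshold d κ (j + 1) ^ (d + 1) = threshold d κ j := by
  have : (d : ℝ) + 1 ≠ 0 := by positivity
  rw [threshold, threshold, ← Real.rpow_mul_natCast hκ, pow_succ]
  congr 1
  push_cast
  field_simp

theorem threshold_pos (d : ℕ) {κ : ℝ} (hκ : 0 < κ) (j : ℕ) : 0 < threshold d κ j :=
  Real.rpow_pos_of_pos hκ _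

theorem threshold_le_one (d : ℕ) {κ : ℝ} (hκ : 0 ≤ κ) (hκ1 : κ ≤ 1) (j : ℕ) :
    threshold d κ j ≤ 1 :=
  Real.rpow_le_one hκ hκ1 (by positivity)

theorem threshold_mono (d : ℕ) {κ : ℝ} (hκ : 0 < κ) (hκ1 : κ ≤ 1) :
    Monotone (threshold d κ) := fun i j hij => by
  refine Real.rpow_le_rpow_of_exponent_ge hκ hκ1 (pow_le_pow_of_le_one (by positivity) ?_ hij)
  rw [div_le_one (by positivity)]
  linarith [(Nat.cast_nonneg d : (0 : ℝ) ≤ d)]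

/-- The radii are tuned to the thresholds: `R_{j+1}^d κ_j` is a constant times `κ_{j+1}^{-d}
κ_{j+1}^{d+1} = κ_{j+1}`, hence every term is bounded by a multiple of the last threshold `κ_d`. -/
theorem resonance_sum_le {d : ℕ} (hd : 2 ≤ d) {κ W X G P V : ℝ} (hκ : 0 < κ) (hκ1 : κ ≤ 1)
    (hW : 0 ≤ W) (hX : 1 ≤ X) (hG : 1 ≤ G) (hP : 0 ≤ P) (hV : 1 ≤ V) {R θ : ℕ → ℝ}
    (hR : ∀ j, 3 * R (j + 1) = G / threshold d κ (j + 1))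
    (hθ : ∀ j ∈ Finset.Icc 1 (d - 1), θ j ≤ (d + 1) * threshold d κ j) :
    W * κ + W * (((3 * R 1) ^ d + P) * V) * κ + ∑ j ∈ Finset.Icc 1 (d - 1),
      W * ((X ^ d) ^ j * ((3 * R (j + 1)) ^ d * V)) * θ j ≤
      (d + 1) ^ 2 * (W * ((X ^ d) ^ d * ((G ^ d + P) * V)) * threshold d κ d) := by
  have hV0 : 0 ≤ V := by linarith
  have hXd : 1 ≤ X ^ d := one_le_pow₀ hX
  have hXdd : 1 ≤ (X ^ d) ^ d := one_le_pow₀ hXd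
  have hGd : 1 ≤ G ^ d := one_le_pow₀ hG
  have hpos := threshold_pos d hκ
  have hmono := threshold_mono d hκ hκ1
  have hstep : ∀ j, j + 1 ≤ d → (3 * R (j + 1)) ^ d * threshold d κ j ≤ G ^ d * threshold d κ d := by
    intro j hj
    have h1 : (3 * R (j + 1)) ^ d * threshold d κ j = G ^ d * threshold d κ (j + 1) := by
      have := (hpos (j + 1)).ne'
      rw [hR, ← threshold_succ_pow d hκ.le j, div_pow, pow_succ]
      field_simp
    rw [h1]
    exact mul_le_mul_of_nonneg_left (hmono hj) (by linarith)
  have hR0 : ∀ j, 0 ≤ 3 * R (j + 1) := fun j => by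
    rw [hR]
    exact div_nonneg (by linarith) (hpos _).le
  have hκd : κ ≤ threshold d κ d := by
    simpa [threshold_zero] using hmono (Nat.zero_le d)
  set τ := threshold d κ d with hτ
  have hτ0 : 0 < τ := hpos d
  set S := W * ((X ^ d) ^ d * ((G ^ d + P) * V)) * τ with hS
  have hGV : 1 ≤ (G ^ d + P) * V := one_le_mul_of_one_le_of_one_le (by linarith) hV
  have hS0 : 0 ≤ S := by positivity
  have b1 : W * κ ≤ S := by
    have : 1 ≤ (X ^ d) ^ d * ((G ^ d + P) * V) := one_le_mul_of_one_le_of_one_le hXdd hGV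
    exact mul_le_mul (le_mul_of_one_le_right hW this) hκd hκ.le (by positivity)
  have b2 : W * (((3 * R 1) ^ d + P) * V) * κ ≤ S := by
    have h1 := hstep 0 (by omega)
    rw [threshold_zero, zero_add] at h1
    have h2 : P * κ ≤ P * τ := mul_le_mul_of_nonneg_left hκd hP
    calc W * (((3 * R 1) ^ d + P) * V) * κ = W * (1 * (((3 * R 1) ^ d * κ + P * κ) * V)) := by ring
      _ ≤ W * ((X ^ d) ^ d * ((G ^ d * τ + P * τ) * V)) := by
        have : 0 ≤ (3 * R 1) ^ d * κ + P * κ :=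
          add_nonneg (mul_nonneg (pow_nonneg (hR0 0) d) hκ.le) (by positivity)
        gcongr
      _ = S := by rw [hS]; ring
  have b3 : ∀ j ∈ Finset.Icc 1 (d - 1), W * ((X ^ d) ^ j * ((3 * R (j + 1)) ^ d * V)) * θ j ≤
      (d + 1) * S := by
    intro j hj
    have hj' := Finset.mem_Icc.mp hj
    have h1 := hstep j (by omega)
    have h2 : (X ^ d) ^ j ≤ (X ^ d) ^ d := pow_le_pow_right₀ hXd (by omega)
    have h3 : 0 ≤ (3 * R (j + 1)) ^ d := pow_nonneg (hR0 j) d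
    calc W * ((X ^ d) ^ j * ((3 * R (j + 1)) ^ d * V)) * θ j
        ≤ W * ((X ^ d) ^ j * ((3 * R (j + 1)) ^ d * V)) * ((d + 1) * threshold d κ j) :=
          mul_le_mul_of_nonneg_left (hθ j hj) (by positivity)
      _ = (d + 1) * (W * ((X ^ d) ^ j * (((3 * R (j + 1)) ^ d * threshold d κ j) * V))) := by ring
      _ ≤ (d + 1) * (W * ((X ^ d) ^ d * ((G ^ d * τ) * V))) := by
        have := mul_nonneg h3 (hpos j).le
        gcongr
      _ ≤ (d + 1) * (W * ((X ^ d) ^ d * (((G ^ d + P) * τ) * V))) := by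
        gcongr
        linarith
      _ = (d + 1) * S := by rw [hS]; ring
  -- In total `2 + (d - 1)(d + 1) ≤ (d + 1)²`.
  have b4 := Finset.sum_le_card_nsmul _ _ _ b3
  rw [Nat.card_Icc, nsmul_eq_mul] at b4
  have h5 : ((d - 1 + 1 - 1 : ℕ) : ℝ) * ((d + 1) * S) ≤ (d - 1) * ((d + 1) * S) := by
    rw [show d - 1 + 1 - 1 = d - 1 by omega, Nat.cast_sub (by omega), Nat.cast_one]
  have h6 : (0 : ℝ) ≤ d * S := by positivity
  linarith

/-- The constant in the measure estimate. -/
noncomputable def measureConst (d n : ℕ) (C₂ C₃ C₄ : ℝ) : ℝ :=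
  (9 ^ d) ^ 2 * slabConst n C₂ C₄ * ((d + 1) ^ 2 * (3 ^ n * (((3 * directionConst d) ^ d) ^ d *
    (((3 * radiusConst d n C₂ C₃) ^ d + n * 18 ^ d) * 9 ^ d))))

theorem measureConst_pos {d : ℕ} (hd : 2 ≤ d) (n : ℕ) (C₂ : ℝ) {C₃ C₄ : ℝ} (hC₃ : 0 < C₃)
    (hC₄ : 0 < C₄) : 0 < measureConst d n C₂ C₃ C₄ := by
  have h1 := one_le_directionConst hd
  have h2 := six_le_radiusConst hd n C₂ hC₃
  have h3 := slabConst_pos n C₂ hC₄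
  have h4 : 0 < radiusConst d n C₂ C₃ := by linarith
  unfold measureConst
  positivity

/-- Collection of the powers of `D`: `2d` from the block sizes, `n` from `k`, `2d³` from the
directions, `(4d+2)d` and `d` from the base points. The leading `1` in the exponent makes the
truncated subtraction exact even for `n = 0`. -/
theorem le_measureConst_mul {d : ℕ} (hd : 2 ≤ d) (n : ℕ) {C₂ C₃ C₄ D K τ : ℝ} (hC₃ : 0 < C₃)
    (hC₄ : 0 < C₄) (hD : 1 ≤ D) (hK : 1 ≤ K) (hτ : 0 ≤ τ) :
    (9 ^ d * D ^ d) ^ 2 * slabConst n C₂ C₄ * ((d + 1) ^ 2 * ((3 * D) ^ n *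
      (((3 * (directionConst d * D ^ (2 * d))) ^ d) ^ d *
        (((3 * (radiusConst d n C₂ C₃ * (D ^ (4 * d + 2) * K))) ^ d + n * (18 * D) ^ d) *
          (9 * D) ^ d)) * τ)) ≤
    measureConst d n C₂ C₃ C₄ * D ^ (1 + 2 * d ^ 3 + 4 * d ^ 2 + 5 * d + n - 1) * K ^ d * τ := by
  have h1 := one_le_directionConst hd
  have h2 := six_le_radiusConst hd n C₂ hC₃
  have h3 := slabConst_pos n C₂ hC₄
  have h4 : 0 < radiusConst d n C₂ C₃ := by linarith
  have hexp : 1 + 2 * d ^ 3 + 4 * d ^ 2 + 5 * d + n - 1 =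
      d * 2 + n + 2 * d * d * d + (4 * d + 2) * d + d := by
    rw [show 1 + 2 * d ^ 3 + 4 * d ^ 2 + 5 * d + n = (d * 2 + n + 2 * d * d * d +
      (4 * d + 2) * d + d) + 1 by ring, Nat.add_sub_cancel]
  have h5 : (3 * (radiusConst d n C₂ C₃ * (D ^ (4 * d + 2) * K))) ^ d + n * (18 * D) ^ d ≤
      ((3 * radiusConst d n C₂ C₃) ^ d + n * 18 ^ d) * (D ^ ((4 * d + 2) * d) * K ^ d) := by
    have : D ^ d ≤ D ^ ((4 * d + 2) * d) * K ^ d :=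
      (pow_le_pow_right₀ hD (by nlinarith)).trans
        (le_mul_of_one_le_right (by positivity) (one_le_pow₀ hK))
    have h6 : (n : ℝ) * 18 ^ d * D ^ d ≤ n * 18 ^ d * (D ^ ((4 * d + 2) * d) * K ^ d) := by
      gcongr
    have h7 : (3 * (radiusConst d n C₂ C₃ * (D ^ (4 * d + 2) * K))) ^ d =
        (3 * radiusConst d n C₂ C₃) ^ d * (D ^ ((4 * d + 2) * d) * K ^ d) := by
      rw [pow_mul, ← mul_pow, ← mul_pow]
      ring
    rw [h7, mul_pow 18, add_mul ((3 * radiusConst d n C₂ C₃) ^ d), ← mul_assoc (n : ℝ)]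
    exact add_le_add le_rfl h6
  calc _ ≤ (9 ^ d * D ^ d) ^ 2 * slabConst n C₂ C₄ * ((d + 1) ^ 2 * ((3 * D) ^ n *
      (((3 * (directionConst d * D ^ (2 * d))) ^ d) ^ d *
        ((((3 * radiusConst d n C₂ C₃) ^ d + n * 18 ^ d) * (D ^ ((4 * d + 2) * d) * K ^ d)) *
          (9 * D) ^ d)) * τ)) := by gcongr
    _ = _ := by
      rw [hexp, measureConst]
      simp only [mul_pow, pow_add, pow_mul]
      ring

end Parameters

/-! ### The final estimate -/

section Final

variable {d : ℕ} {A : Finset (Fin d → ℤ)}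

/-- No factor of the bound vanishes, so a single infinite one makes it infinite; this disposes of
unbounded blocks and of infinite norms. -/
theorem measureBound_eq_top {e : ℕ} {cte Δ' κ Λ C₁ : ℝ} {Δ : ℕ} {N : ℝ≥0∞} (hcte : 0 < cte)
    (hd : d ≠ 0) (he : e + A.card - 1 ≠ 0) (hΔ' : 0 < Δ') (hκ : 0 < κ) (hC₁ : 0 < C₁)
    (h : blockDiam A Δ = ⊤ ∨ N = ⊤) : measureBound A e cte Δ Δ' κ Λ C₁ N = ⊤ := by
  have h1 : ENNReal.ofReal cte ≠ 0 := (ENNReal.ofReal_pos.mpr hcte).ne'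
  have h2 : max (ENNReal.ofReal Δ') (max (blockDiam A Δ ^ 2) (ENNReal.ofReal Λ)) ≠ 0 :=
    (lt_max_of_lt_left (ENNReal.ofReal_pos.mpr hΔ')).ne'
  have h3 : ENNReal.ofReal C₁ ≠ 0 := (ENNReal.ofReal_pos.mpr hC₁).ne'
  have h4 : ENNReal.ofReal (κ ^ ((1 / ((d : ℝ) + 1)) ^ d)) ≠ 0 :=
    (ENNReal.ofReal_pos.mpr (Real.rpow_pos_of_pos hκ _)).ne'
  have h5 : ENNReal.ofReal C₁ + N ≠ 0 := fun h0 => h3 (add_eq_zero.mp h0).1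
  have h6 := pow_ne_zero (A.card - 1) h3
  have key : (max (ENNReal.ofReal Δ') (max (blockDiam A Δ ^ 2) (ENNReal.ofReal Λ)) ^
      (e + A.card - 1)) * (ENNReal.ofReal C₁ + N) ^ d = ⊤ := by
    rcases h with h | h
    · rw [h, ENNReal.top_pow two_ne_zero, max_top_left, max_top_right, ENNReal.top_pow he,
        ENNReal.top_mul (pow_ne_zero _ h5)]
    · rw [h, add_top, ENNReal.top_pow hd, ENNReal.mul_top (pow_ne_zero _ h2)]
  rw [measureBound, mul_assoc (ENNReal.ofReal cte), key, ENNReal.mul_top h1, ENNReal.top_mul h4,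
    ENNReal.top_mul h6]

theorem measureBound_eq_ofReal {e : ℕ} {cte Δ' κ Λ C₁ h : ℝ} {Δ : ℕ} (hcte : 0 ≤ cte)
    (hfin : blockDiam A Δ ≠ ⊤) (hΔ' : 0 ≤ Δ') (hC₁ : 0 ≤ C₁) (hh : 0 ≤ h) :
    measureBound A e cte Δ Δ' κ Λ C₁ (ENNReal.ofReal h) =
      ENNReal.ofReal (cte * max Δ' (max ((blockDiam A Δ).toReal ^ 2) Λ) ^ (e + A.card - 1) *
        (C₁ + h) ^ d * threshold d κ d) * ENNReal.ofReal C₁ ^ (A.card - 1) := by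
  have hM : 0 ≤ max Δ' (max ((blockDiam A Δ).toReal ^ 2) Λ) := hΔ'.trans (le_max_left _ _)
  rw [measureBound, ← threshold, ENNReal.ofReal_mul (by positivity),
    ENNReal.ofReal_mul (by positivity), ENNReal.ofReal_mul hcte, ENNReal.ofReal_pow hM,
    ENNReal.ofReal_pow (by positivity), ENNReal.ofReal_add hC₁ hh, ENNReal.ofReal_max,
    ENNReal.ofReal_max, ENNReal.ofReal_pow ENNReal.toReal_nonneg, ENNReal.ofReal_toReal hfin]

theorem volume_thickening_compl_le_measureBound (hd : 2 ≤ d) {Δ : ℕ}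
    {B U : Set (Param A)} {Ω : Param A → Site A → ℝ} {H : Param A → Mat A}
    {C₁ C₂ C₃ C₄ κ Λ h Δ' : ℝ}
    (hB : IsOpen B) (hBc : Convex ℝ B) (hUB : U ⊆ B) (hU : ∀ x ∈ U, ‖x‖ ≤ C₁)
    (hΩ : ∀ a, ContDiffOn ℝ 1 (fun ω => Ω ω a) B) (hC₃ : 0 < C₃) (hC₄ : 0 < C₄)
    (hcl : CloseToSquares C₂ C₃ B Ω) (hTr : Transversal C₄ B Ω) (hH : FormLip (C₄ / 4) B H)
    (hHerm : ∀ ω ∈ U, (H ω).IsHermitian) (hT : ∀ ω ∈ U, IsNToplitz (d - 1) (H ω))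
    (hnorm : ∀ ω ∈ U, lipNormN Λ (d - 1) (H ω) ≤ ENNReal.ofReal h)
    (hh : 0 ≤ h) (hC₁ : 1 ≤ C₁) (hfin : blockDiam A Δ ≠ ⊤) (hΔ' : 1 < Δ')
    (hΛ : 0 ≤ Λ) (hκ0 : 0 < κ) (hκ : κ < 1) :
    volume (Metric.thickening κ (U \ {ω | ω ∈ U ∧ SecondMelnikov Δ Δ' κ Ω H ω})) ≤
      measureBound A (1 + 2 * d ^ 3 + 4 * d ^ 2 + 5 * d) (measureConst d A.card C₂ C₃ C₄) Δ Δ' κ Λ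
        C₁ (ENNReal.ofReal h) := by
  have hκ0' := hκ0.le
  rw [measureBound_eq_ofReal (measureConst_pos hd _ C₂ hC₃ hC₄).le hfin (by linarith)
    (by linarith) hh]
  set D := max Δ' (max ((blockDiam A Δ).toReal ^ 2) Λ) with hDdef
  have hΔ'D : Δ' ≤ D := le_max_left _ _
  have hD : 1 ≤ D := by linarith
  have hΛD : Λ ≤ D := (le_max_right _ _).trans (le_max_right _ _)
  -- `D` dominates the square of the diameter and is at least `1`.
  have hδ : (blockDiam A Δ).toReal ≤ D := by
    have : (blockDiam A Δ).toReal ^ 2 ≤ D := (le_max_left _ _).trans (le_max_right _ _)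
    nlinarith
  have hK : 1 ≤ C₁ + h := by linarith
  have hq1 := one_le_directionConst hd
  have hq := six_le_radiusConst hd A.card C₂ hC₃
  have hDp : ∀ k, (1 : ℝ) ≤ D ^ k := fun k => one_le_pow₀ hD
  have hτp := threshold_pos d hκ0
  have hτm := threshold_mono d hκ0 hκ.le
  set q := radiusConst d A.card C₂ C₃ with hqdef
  set Y := D ^ (4 * d + 2) * (C₁ + h) with hY
  have hY1 : 1 ≤ Y := one_le_mul_of_one_le_of_one_le (hDp _) hK
  have hκτ : ∀ j, κ ≤ threshold d κ j := fun j => by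
    simpa [threshold_zero] using hτm (Nat.zero_le j)
  -- The tolerance starts at `κ + κ_1 ≤ 2κ_1`, the error `κ_1` coming from the replacement of `Ω` by
  -- `|a|²`. The `j`-th limit adds `κ_j`, and since the thresholds increase, the tolerance after `j
  -- ≥ 1` limits is at most `(j + 2)κ_j`.
  have hmain := volume_thickening_compl_secondMelnikov_le hd hB hBc hUB hU hΩ rfl hC₃ hC₄ hcl hTr
    hH hHerm hT hnorm hh hC₁ hfin hδ (by linarith) hΔ'D hκ0' hκ.le
    (cm := directionConst d * D ^ (2 * d)) (Nc := 9 ^ d * D ^ d)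
    (R := fun j => q * Y / threshold d κ j) (ε := threshold d κ)
    (θ := fun j => if j = 0 then 2 * threshold d κ 1 else (j + 2) * threshold d κ j)
    (one_le_mul_of_one_le_of_one_le hq1 (hDp _))
    (one_le_mul_of_one_le_of_one_le (one_le_pow₀ (by norm_num)) (hDp _))
    (fun j _ => scales_standard hd A.card hC₃ hC₁ hh hD hΛ hΛD (hτp _)
      (threshold_le_one d hκ0' hκ.le _))
    (by simpa [two_mul] using hκτ 1)
    (fun j _ => by
      rcases Nat.eq_zero_or_pos j with rfl | hj
      · norm_num
        linarith
      · have h1 := mul_le_mul_of_nonneg_left (hτm (Nat.le_succ j))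
          (show (0 : ℝ) ≤ j + 2 by positivity)
        rw [if_neg hj.ne', if_neg (Nat.succ_ne_zero j)]
        push_cast
        linarith)
    (fun j => by
      have h1 := hτp j
      have h2 := hτp 1
      split_ifs with hj
      · linarith [hκτ 1]
      · have : (0 : ℝ) ≤ (j + 1) * threshold d κ j := by positivity
        linarith [hκτ j])
  refine hmain.trans (mul_le_mul_left (ENNReal.ofReal_le_ofReal ?_) _)
  have hsum := resonance_sum_le hd hκ0 hκ.le (W := (3 * D) ^ A.card)
    (X := 3 * (directionConst d * D ^ (2 * d))) (G := 3 * (q * Y))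
    (P := A.card * (18 * D) ^ d) (V := (9 * D) ^ d)
    (R := fun j => q * Y / threshold d κ j)
    (θ := fun j => if j = 0 then 2 * threshold d κ 1 else (j + 2) * threshold d κ j)
    (by positivity)
    (by linarith [one_le_mul_of_one_le_of_one_le hq1 (hDp (2 * d))])
    (by linarith [one_le_mul_of_one_le_of_one_le (show 1 ≤ q by linarith) hY1]) (by positivity)
    (one_le_pow₀ (by linarith)) (fun j => (mul_div_assoc _ _ _).symm)
    (fun j hj => by
      rw [Finset.mem_Icc] at hj
      rw [if_neg (by omega)]
      refine mul_le_mul_of_nonneg_right ?_ (hτp j).le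
      have : ((j + 2 : ℕ) : ℝ) ≤ (d + 1 : ℕ) := by exact_mod_cast (by omega : j + 2 ≤ d + 1)
      exact_mod_cast this)
  have hsl := slabConst_pos A.card C₂ hC₄
  refine (mul_le_mul_of_nonneg_left hsum (by positivity)).trans ?_
  exact le_measureConst_mul hd A.card hC₃ hC₄ hD hK (hτp d).le

end Final

end ToplitzLattice

theorem proposition5p2 (d : ℕ) (hd : 2 ≤ d) :
    ∃ e : ℕ, ∀ (n : ℕ) (C₂ C₃ C₄ : ℝ), 0 < C₃ → 0 < C₄ →
    ∃ cte : ℝ, 0 < cte ∧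
    ∀ (A : Finset (Fin d → ℤ)), A.card = n →
    ∀ (Δ : ℕ) (Δ' κ Λ C₁ : ℝ), 1 < Δ' → 0 < κ → κ < 1 → 0 ≤ Λ → 1 ≤ C₁ →
    ∀ (B U : Set (Param A)), IsOpen B → Convex ℝ B → U ⊆ B → (∀ ω ∈ U, ‖ω‖ ≤ C₁) →
    ∀ (Ω : Param A → Site A → ℝ) (H : Param A → Mat A),
    (∀ a, ContDiffOn ℝ 1 (fun ω => Ω ω a) B) →
    (∀ a b, ContDiffOn ℝ 1 (fun ω => H ω a b) B) →
    CloseToSquares C₂ C₃ B Ω →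
    Transversal C₄ B Ω →
    (∀ ω ∈ B, ∀ v : Param A, ‖v‖ ≤ 1 → opNorm (derivMat H ω v) ≤ ENNReal.ofReal (C₄ / 4)) →
    (∀ ω ∈ U, IsToplitz (H ω) ∧ NormalForm Δ (H ω)) →
    (∀ ω ∈ U, ∀ v : Param A,
      IsToplitz (derivMat H ω v) ∧ NormalForm Δ (derivMat H ω v)) →
    ∃ U' ⊆ U,
      volume (U \ U') ≤ measureBound A e cte Δ Δ' κ Λ C₁ (lipNormOn Λ U H) ∧
      volume (Metric.thickening κ (U \ U')) ≤
        measureBound A e cte Δ Δ' κ Λ C₁ (lipNormOn Λ U H) ∧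
      ∀ ω ∈ U', SecondMelnikov Δ Δ' κ Ω H ω := by
  refine ⟨1 + 2 * d ^ 3 + 4 * d ^ 2 + 5 * d, fun n C₂ C₃ C₄ hC₃ hC₄ =>
    ⟨measureConst d n C₂ C₃ C₄, measureConst_pos hd n C₂ hC₃ hC₄, ?_⟩⟩
  rintro A rfl Δ Δ' κ Λ C₁ hΔ' hκ0 hκ hΛ hC₁ B U hB hBc hUB hU Ω H hΩ hHC hcl hTr hop hHU -
  -- If the bound is infinite, `U' = ∅` serves; otherwise `U'` is the set of all good parameters and
  -- the norm is a real number.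
  by_cases htop : blockDiam A Δ = ⊤ ∨ lipNormOn Λ U H = ⊤
  · have hbound := measureBound_eq_top (e := 1 + 2 * d ^ 3 + 4 * d ^ 2 + 5 * d) (Δ' := Δ') (κ := κ)
      (Λ := Λ) (C₁ := C₁) (measureConst_pos hd A.card C₂ hC₃ hC₄) (by omega) (by omega)
      (by linarith) hκ0 (by linarith) htop
    refine ⟨∅, Set.empty_subset _, ?_, ?_, fun ω hω => absurd hω (Set.notMem_empty ω)⟩ <;>
    · rw [hbound]
      exact le_top
  obtain ⟨hfin, hL⟩ := not_or.mp htop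
  have hle : volume (Metric.thickening κ (U \ {ω | ω ∈ U ∧ SecondMelnikov Δ Δ' κ Ω H ω})) ≤
      measureBound A (1 + 2 * d ^ 3 + 4 * d ^ 2 + 5 * d) (measureConst d A.card C₂ C₃ C₄) Δ Δ' κ Λ
        C₁ (lipNormOn Λ U H) := by
    rw [← ENNReal.ofReal_toReal hL]
    refine volume_thickening_compl_le_measureBound hd hB hBc hUB hU hΩ hC₃ hC₄ hcl hTr
      (formLip_of_opNorm_derivMat_le hB hBc hHC (by positivity) hop) (fun ω hω => (hHU ω hω).2.1)
      (fun ω hω => (hHU ω hω).1) (fun ω hω => ?_) ENNReal.toReal_nonneg hC₁ hfin hΔ' hΛ hκ0 hκ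
    rw [ENNReal.ofReal_toReal hL]
    exact (le_max_left _ _).trans
      (le_iSup₂ (f := fun (ω : Param A) (_ : ω ∈ U) => max (lipNorm Λ (H ω))
        (⨆ (v : Param A) (_ : ‖v‖ ≤ 1), lipNorm Λ (derivMat H ω v))) ω hω)
  exact ⟨_, fun ω hω => hω.1,
    (measure_mono (Metric.self_subset_thickening hκ0 _)).trans hle, hle, fun ω hω => hω.2⟩
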